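/- Let $\mathbb K$ be a field of characteristic $0$. A ladder $l_n$ is the rooted tree with $n$ vertices and no side branches ($l_0$ is the empty forest), $B^+$ grafts the trees of a forest to a new root. Consider the following spaces with structure maps. - $NSYM=\mathbb K\langle z_1,z_2,\dots\rangle$, $\Delta z_n=\sum_{i=0}^n z_i\otimes z_{n-i}$ ($z_0=1$). - $QSYM$, $SYM\subset\mathbb K[[x_1,x_2,\dots]]$: the quasi-symmetric and the symmetric functions (series of bounded degree), with bases $M_I=\sum_{n_1<\dots<n_k}x_{n_1}^{i_1}\cdots x_{n_k}^{i_k}$ ($I$ a composition) and $m_\lambda$ ($\lambda$ a partition), product of series, $\Delta M_I=\sum_{I=I'I''}M_{I'}\otimes M_{I''}$ and $\Delta m_\lambda=\sum_{\mu\cup\nu=\lambda}m_\mu\otimes m_\nu$. Let $e_n=m_{(1,\dots,1)}$ ($n$ ones) and $e_\lambda=\prod_i e_{\lambda_i}$. - $H_F$: ordered forests of planar rooted trees, juxtaposition as product, coproduct by admissible cuts (pruned part on the left). $H_{CK}$: the same for commutative forests of non-planar rooted trees. - $H_{\mathbf P}$: planar rooted trees, where $t\diamond s$ is the sum of the trees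 obtained by shuffling the components of the balanced bracket word of $t$ into that of $s$, and $\Delta B^+(t_1\cdots t_k)=\sum_{i=0}^k B^+(t_1\cdots t_i)\otimes B^+(t_{i+1}\cdots t_k)$. - $H_{\mathbb U}$: noncommutative polynomials in $f_1,f_2,\dots$ with the shuffle product $\star$ and deconcatenation. $U(L_{\mathbb U})$: the enveloping algebra of the free Lie algebra on $e_{-1},e_{-2},\dots$, whose Lie elements are primitive. For a forest $v$ with vertex labels in $\{1,2,\dots\}$ let $\pi(v)\in H_{\mathbb U}$ be given by $\pi(\text{empty forest})=1$, $\pi(vw)=\pi(v)\star\pi(w)$ and $\pi(B^+_k(v))=\pi(v)f_k$, with $B_k^+$ grafting to a root labelled $k$. For a forest $u$ let $[u]$ be the family of labelled forests obtained from $u$ by partitioning the vertices of $u$ into paths directed away from the roots (consecutive vertices being joined by edges), and contracting each path with $k$ vertices to one vertex labelled $k$ (one member for each such partition). Then, with the usual units and counits, all these are Hopf algebras, and there are Hopf algebra homomorphisms as follows. 1. $\beta_1:NSYM\to H_F$ with $\beta_1(z_n)=l_n$; $\beta_3:NSYM\to SYM$ with $\beta_3(z_n)=e_n$; $\beta_2:H_F\to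 H_{\mathbb U}$ with $\beta_2(u)=\sum_{v\in[u]}\pi(v)$ for each planar forest $u$; $\beta_4:SYM\to H_{\mathbb U}$ with $\beta_4(e_n)=\sum_{v\in[l_n]}\pi(v)$; and $\beta_2\circ\beta_1=\beta_4\circ\beta_3$. 2. $\beta_1^\star:H_{\mathbf P}\to QSYM$ with $\beta_1^\star(B^+(l_{i_1}\cdots l_{i_k}))=M_{(i_1,\dots,i_k)}$ and $\beta_1^\star(t)=0$ for all other planar trees $t$; $\beta_2^\star:U(L_{\mathbb U})\to H_{\mathbf P}$ with $\beta_2^\star(e_{-n})=B^+(l_n)$; the inclusion $\beta_3^\star:SYM\to QSYM$; $\beta_4^\star:U(L_{\mathbb U})\to SYM$ with $\beta_4^\star(e_{-n})=m_{(n)}$; and $\beta_1^\star\circ\beta_2^\star=\beta_3^\star\circ\beta_4^\star$. 3. Each $\beta_i^\star$ is the transpose of $\beta_i$ for the pairings in which the following are dual bases: $z_{i_1}\cdots z_{i_k}$ and $M_{(i_1,\dots,i_k)}$ ($NSYM$, $QSYM$); planar forests $u$ and trees $B^+(u)$ ($H_F$, $H_{\mathbf P}$); $e_\lambda$ and $m_\lambda$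 ($SYM$ with itself); $f_{i_1}\cdots f_{i_k}$ and $e_{-i_1}\cdots e_{-i_k}$ ($H_{\mathbb U}$, $U(L_{\mathbb U})$). 4. The first square factors through Hoffman's square for $H_{CK}$: let $\alpha_2:H_F\to H_{CK}$ forget the planar structure, $\alpha_4:SYM\to H_{CK}$ have $\alpha_4(e_n)=l_n$, and $\rho:H_{CK}\to H_{\mathbb U}$ have $\rho(u)=\sum_{v\in[u]}\pi(v)$ for each forest $u$. These are Hopf algebra homomorphisms, $\alpha_2\circ\beta_1=\alpha_4\circ\beta_3$, $\beta_2=\rho\circ\alpha_2$ and $\beta_4=\rho\circ\alpha_4$. -/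

import Mathlib

open scoped TensorProduct

noncomputable section

/-! ### Hopf algebras and their homomorphisms, with explicit structure maps -/

/-- The structure maps (product, unit, coproduct, counit) of a Hopf algebra on a vector space. -/
structure HopfData (K V : Type*) [CommRing K] [AddCommGroup V] [Module K V] where
  mul : V →ₗ[K] V →ₗ[K] V
  one : V
  comul : V →ₗ[K] V ⊗[K] V
  counit : V →ₗ[K] K

namespace HopfData

variable {K V W : Type*} [CommRing K] [AddCommGroup V] [Module K V] [AddCommGroup W] [Module K W]

/-- The structure maps satisfy the axioms of a Hopf algebra. -/
structure IsHopfAlgebra (H : HopfData K V) : Prop where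
  mul_assoc : ∀ x y z, H.mul (H.mul x y) z = H.mul x (H.mul y z)
  one_mul : ∀ x, H.mul H.one x = x
  mul_one : ∀ x, H.mul x H.one = x
  coassoc : ∀ x, TensorProduct.assoc K V V V (H.comul.rTensor V (H.comul x)) =
    H.comul.lTensor V (H.comul x)
  counit_left : ∀ x, H.counit.rTensor V (H.comul x) = 1 ⊗ₜ[K] x
  counit_right : ∀ x, H.counit.lTensor V (H.comul x) = x ⊗ₜ[K] 1
  comul_mul : ∀ x y, H.comul (H.mul x y) =
    TensorProduct.map₂ H.mul H.mul (H.comul x) (H.comul y)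
  comul_one : H.comul H.one = H.one ⊗ₜ[K] H.one
  counit_mul : ∀ x y, H.counit (H.mul x y) = H.counit x * H.counit y
  counit_one : H.counit H.one = 1
  exists_antipode : ∃ S : V →ₗ[K] V,
    (∀ x, TensorProduct.lift H.mul (S.rTensor V (H.comul x)) = H.counit x • H.one) ∧
    (∀ x, TensorProduct.lift H.mul (S.lTensor V (H.comul x)) = H.counit x • H.one)

/-- `f` respects product, unit, coproduct and counit. Between Hopf algebras, such a map
automatically respects the antipodes, which are unique. -/
structure IsHom (H : HopfData K V) (H' : HopfData K W) (f : V →ₗ[K] W) : Prop where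
  map_mul : ∀ x y, f (H.mul x y) = H'.mul (f x) (f y)
  map_one : f H.one = H'.one
  map_comul : ∀ x, TensorProduct.map f f (H.comul x) = H'.comul (f x)
  map_counit : ∀ x, H'.counit (f x) = H.counit x

end HopfData

/-- Bilinear extension of a map given on pairs of basis vectors. -/
def bilinExt (K : Type*) {ι κ V : Type*} [CommRing K] [AddCommGroup V] [Module K V]
    (φ : ι → κ → V) : (ι →₀ K) →ₗ[K] (κ →₀ K) →ₗ[K] V :=
  Finsupp.linearCombination K fun i => Finsupp.linearCombination K (φ i)

/-- The pairing `∑ i, a i * b i`, for which the two standard bases are dual. -/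
def dot (K ι : Type*) [CommRing K] : (ι →₀ K) →ₗ[K] (ι →₀ K) →ₗ[K] K :=
  Finsupp.linearCombination K fun i => Finsupp.lapply i

/-! ### Planar forests -/

/-- Ordered forests of planar rooted trees whose vertices carry labels in `A`:
`cons a c f` has as its first tree the one with root label `a` and branches (in order) `c`,
followed by the forest `f`. -/
inductive PForest (A : Type) : Type
  | nil : PForest A
  | cons (a : A) (c f : PForest A) : PForest A

namespace PForest

variable {A : Type}

/-- Juxtaposition of ordered forests. -/
def append : PForest A → PForest A → PForest A
  | nil, g => g
  | cons a c f, g => cons a c (append f g)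

/-- All pairs (pruned part, part containing the roots) obtained from a forest by cutting, for each
of its trees, either the whole tree off, or along an admissible (possibly empty) cut. Each
admissible cut is listed once. -/
def cuts : PForest A → List (PForest A × PForest A)
  | nil => [(nil, nil)]
  | cons a c f => (cuts f).flatMap fun q =>
      (cons a c q.1, q.2) :: (cuts c).map fun p => (append p.1 q.1, cons a p.2 q.2)

/-- All ways to write an ordered forest as a juxtaposition of two. -/
def splits : PForest A → List (PForest A × PForest A)
  | nil => [(nil, nil)]
  | cons a c f => (nil, cons a c f) :: (splits f).map fun p => (cons a c p.1, p.2)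

/-- All shufflings of the trees of the first forest into the balanced bracket word of the second
one: the trees of the first forest are distributed, in their order, over the gaps of that word.
The gap before the first tree of `cons a c g` receives `p.1`, the gaps inside this tree receive
`q.1`, the gaps after it receive `q.2`. -/
def graft : PForest A → PForest A → List (PForest A)
  | f, nil => [f]
  | f, cons a c g => (splits f).flatMap fun p => (splits p.2).flatMap fun q =>
      (graft q.1 c).flatMap fun x => (graft q.2 g).map fun y => append p.1 (cons a x y)

/-- The ladder tree with `n` vertices, as a forest (empty for `n = 0`). -/
def ladder : ℕ → PForest Unit
  | 0 => nil
  | n + 1 => cons () (ladder n) nil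

/-- `l_{i₁} ⋯ l_{i_k}` for `I = (i₁, …, i_k)`. -/
def ladders : List ℕ+ → PForest Unit
  | [] => nil
  | i :: I => append (ladder i) (ladders I)

/-- Two ordered forests are equivalent if they agree up to permuting the trees and, at each
vertex, the branches. -/
inductive Equiv : PForest A → PForest A → Prop
  | nil : Equiv nil nil
  | cons (a : A) {c c' f f' : PForest A} : Equiv c c' → Equiv f f' →
      Equiv (cons a c f) (cons a c' f')
  | swap (a b : A) (c d f : PForest A) :
      Equiv (cons a c (cons b d f)) (cons b d (cons a c f))
  | trans {f g h : PForest A} : Equiv f g → Equiv g h → Equiv f h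

theorem Equiv.refl (f : PForest A) : Equiv f f := by
  induction f with
  | nil => exact .nil
  | cons a c f hc hf => exact .cons a hc hf

theorem Equiv.symm {f g : PForest A} (h : Equiv f g) : Equiv g f := by
  induction h with
  | nil => exact .nil
  | cons a _ _ h₁ h₂ => exact .cons a h₁ h₂
  | swap a b c d f => exact .swap b a d c f
  | trans _ _ h₁ h₂ => exact .trans h₂ h₁

/-- Non-planar rooted forests are classes of planar ones. -/
def setoid (A : Type) : Setoid (PForest A) :=
  ⟨Equiv, ⟨Equiv.refl, Equiv.symm, Equiv.trans⟩⟩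

/-- All ways to choose a set of edges of a forest, at most one of them from each vertex to its
children, and to contract these edges; a vertex that arises from `k` vertices (forming a
path directed away from the root) gets the label `k`. In an element `(n, v)` of
the list, `n` vertices forming a path that starts at one of the roots are left out of `v`. -/
def contract : PForest Unit → List (ℕ × PForest ℕ+)
  | nil => [(0, nil)]
  | cons _ c f => (contract c).flatMap fun p => (contract f).flatMap fun q =>
      (q.1, cons p.1.succPNat p.2 q.2) ::
        (if q.1 = 0 then [(p.1 + 1, append p.2 q.2)] else [])

/-- The class `[u]` of labelled forests obtained from `u` by contracting, in all possible ways,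
disjoint paths directed away from the root; the label of a vertex is the number of vertices it
arises from. A forest is listed as often as it arises. -/
def labelled (u : PForest Unit) : List (PForest ℕ+) :=
  ((contract u).filter fun p => p.1 = 0).map Prod.snd

end PForest

/-- Non-planar rooted forests (commutative monomials in non-planar rooted trees). -/
def RForest : Type := Quotient (PForest.setoid Unit)

/-- The class of a planar forest. -/
def RForest.mk (u : PForest Unit) : RForest := Quotient.mk (PForest.setoid Unit) u

/-- A planar representative of a non-planar forest. -/
def RForest.rep (u : RForest) : PForest Unit := Quotient.out u

/-- Planar rooted trees, `⟨f⟩` being the tree `B⁺(f)` whose branches form the ordered forest `f`. -/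
structure PTree : Type where
  branches : PForest Unit

/-! ### Words -/

/-- The list of all shuffles of two words. -/
def shuffles {A : Type} : List A → List A → List (List A)
  | [], w => [w]
  | a :: v, [] => [a :: v]
  | a :: v, b :: w =>
      (shuffles v (b :: w)).map (List.cons a) ++ (shuffles (a :: v) w).map (List.cons b)

/-- The words obtained by reading the labels of a labelled forest along all total orders of its
vertices that extend the forest order, with each root read after the vertices above it:
`π(B⁺_a(u)) = π(u) a` and `π(uv) = π(u) ⧢ π(v)`. -/
def linExt {A : Type} : PForest A → List (List A)
  | .nil => [[]]
  | .cons a c f => (linExt c).flatMap fun v => (linExt f).flatMap fun w => shuffles (v ++ [a]) w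

section

variable (K : Type*) [Field K]

/-! ### The Hopf algebra of planar forests (Foissy) -/

/-- The space of ordered forests of planar rooted trees, i.e. the tensor algebra on the space
of planar rooted trees. -/
abbrev HF := PForest Unit →₀ K

/-- Product: juxtaposition. Coproduct: admissible cuts. -/
def HF.hopf : HopfData K (HF K) where
  mul := bilinExt K fun u v => Finsupp.single (u.append v) 1
  one := Finsupp.single .nil 1
  comul := Finsupp.linearCombination K fun u =>
    ((u.cuts).map fun p => Finsupp.single p.1 (1 : K) ⊗ₜ[K] Finsupp.single p.2 (1 : K)).sum
  counit := Finsupp.lapply .nil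

/-! ### The Hopf algebra of planar trees -/

/-- The space of planar rooted trees. -/
abbrev HP := PTree →₀ K

/-- Product `t ◇ s`: shuffle the components of the bracket word of `t` into that of `s`.
Coproduct: split the sequence of the branches. -/
def HP.hopf : HopfData K (HP K) where
  mul := bilinExt K fun t s =>
    ((t.branches.graft s.branches).map fun w => Finsupp.single (⟨w⟩ : PTree) (1 : K)).sum
  one := Finsupp.single ⟨.nil⟩ 1
  comul := Finsupp.linearCombination K fun t =>
    ((t.branches.splits).map fun p =>
      Finsupp.single (⟨p.1⟩ : PTree) (1 : K) ⊗ₜ[K] Finsupp.single (⟨p.2⟩ : PTree) (1 : K)).sum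
  counit := Finsupp.lapply ⟨.nil⟩

/-! ### The Connes-Kreimer Hopf algebra -/

/-- The space of non-planar rooted forests, i.e. the symmetric algebra on the space of rooted
trees. -/
abbrev HCK := RForest →₀ K

/-- Product: disjoint union. Coproduct: admissible cuts. -/
def HCK.hopf : HopfData K (HCK K) where
  mul := bilinExt K fun u v => Finsupp.single (RForest.mk (u.rep.append v.rep)) 1
  one := Finsupp.single (RForest.mk .nil) 1
  comul := Finsupp.linearCombination K fun u =>
    ((u.rep.cuts).map fun p =>
      Finsupp.single (RForest.mk p.1) (1 : K) ⊗ₜ[K] Finsupp.single (RForest.mk p.2) (1 : K)).sum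
  counit := Finsupp.lapply (RForest.mk .nil)

/-! ### The universal Hopf algebra of renormalization and its dual -/

/-- The space of noncommutative polynomials in `f₁, f₂, …`; its basis is the set of words. -/
abbrev HU := List ℕ+ →₀ K

/-- Product: shuffle. Coproduct: deconcatenation. -/
def HU.hopf : HopfData K (HU K) where
  mul := bilinExt K fun v w => ((shuffles v w).map fun x => Finsupp.single x (1 : K)).sum
  one := Finsupp.single [] 1
  comul := Finsupp.linearCombination K fun w =>
    ∑ s ∈ Finset.range (w.length + 1),
      Finsupp.single (w.take s) (1 : K) ⊗ₜ[K] Finsupp.single (w.drop s) (1 : K)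
  counit := Finsupp.lapply []

/-- `π(v)`, the sum of the words attached to a labelled forest. -/
def piWord (v : PForest ℕ+) : HU K := ((linExt v).map fun w => Finsupp.single w (1 : K)).sum

/-- The sum of `π(v)` over all `v` in the class `[u]`. -/
def piClass (u : PForest Unit) : HU K := ((u.labelled).map fun v => piWord K v).sum

/-- The universal enveloping algebra of the free Lie algebra on generators `e₋₁, e₋₂, …`. -/
abbrev ULU := UniversalEnvelopingAlgebra K (FreeLieAlgebra K ℕ+)

/-- The generator `e₋ₙ`. -/
def ULU.e (n : ℕ+) : ULU K := UniversalEnvelopingAlgebra.ι K (FreeLieAlgebra.of K n)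

section

attribute [local instance 100] LieRing.ofAssociativeRing

/-- `x ↦ x ⊗ 1 + 1 ⊗ x` on the Lie algebra. -/
def ULU.primitive : FreeLieAlgebra K ℕ+ →ₗ⁅K⁆ ULU K ⊗[K] ULU K where
  toLinearMap :=
    ((TensorProduct.mk K (ULU K) (ULU K)).flip 1 + TensorProduct.mk K (ULU K) (ULU K) 1) ∘ₗ
      (UniversalEnvelopingAlgebra.ι K : FreeLieAlgebra K ℕ+ →ₗ⁅K⁆ ULU K).toLinearMap
  map_lie' := by
    intro x y
    simp only [LinearMap.comp_apply, LinearMap.add_apply, LinearMap.flip_apply,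
      TensorProduct.mk_apply, LieHom.coe_toLinearMap, AddHom.toFun_eq_coe,
      LinearMap.coe_toAddHom, LieHom.map_lie, LieRing.of_associative_ring_bracket,
      TensorProduct.sub_tmul, TensorProduct.tmul_sub, mul_add, add_mul,
      Algebra.TensorProduct.tmul_mul_tmul, one_mul, mul_one]
    abel

/-- The standard structure: elements of the Lie algebra are primitive. -/
def ULU.hopf : HopfData K (ULU K) where
  mul := LinearMap.mul K _
  one := 1
  comul := (UniversalEnvelopingAlgebra.lift K (ULU.primitive K)).toLinearMap
  counit := (UniversalEnvelopingAlgebra.lift K (0 : FreeLieAlgebra K ℕ+ →ₗ⁅K⁆ K)).toLinearMap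

end

/-- Coefficients of an element of a free algebra with respect to the basis of words. -/
def wordCoeff : FreeAlgebra K ℕ+ →ₗ[K] (List ℕ+ →₀ K) :=
  Finsupp.lmapDomain K K FreeMonoid.toList ∘ₗ
    (MonoidAlgebra.coeffLinearEquiv K).toLinearMap ∘ₗ
      (FreeAlgebra.equivMonoidAlgebraFreeMonoid (R := K) (X := ℕ+)).toLinearMap

/-! ### Noncommutative symmetric functions -/

/-- Noncommutative polynomials in `z₁, z₂, …`. -/
abbrev NSYM := FreeAlgebra K ℕ+

/-- `zₙ`, with `z₀ = 1`. -/
def NSYM.z : ℕ → NSYM K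
  | 0 => 1
  | n + 1 => FreeAlgebra.ι K n.succPNat

/-- The coproduct is `Δ zₙ = ∑ zᵢ ⊗ zₙ₋ᵢ`. -/
def NSYM.hopf : HopfData K (NSYM K) where
  mul := LinearMap.mul K _
  one := 1
  comul := (FreeAlgebra.lift K fun n : ℕ+ =>
    ∑ i ∈ Finset.range (n + 1), NSYM.z K i ⊗ₜ[K] NSYM.z K (n - i)).toLinearMap
  counit := (FreeAlgebra.lift K fun _ : ℕ+ => (0 : K)).toLinearMap

/-! ### Quasi-symmetric and symmetric functions -/

variable {K}

/-- The exponent of the monomial `x_{n₁}^{i₁} ⋯ x_{n_k}^{i_k}`. -/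
def place {k : ℕ} (n i : Fin k → ℕ) : ℕ →₀ ℕ := ∑ j, Finsupp.single (n j) (i j)

theorem place_eq {k : ℕ} (n i : Fin k → ℕ) :
    place n i = Finsupp.mapDomain n (Finsupp.equivFunOnFinite.symm i) := by
  rw [Finsupp.mapDomain, Finsupp.sum_fintype _ _ (by simp)]
  simp [place]

theorem coeff_place_mul {k : ℕ} {n : Fin k → ℕ} (hn : Function.Injective n) (i : Fin k → ℕ)
    (f g : MvPowerSeries ℕ K) :
    MvPowerSeries.coeff (place n i) (f * g) =
      ∑ p ∈ Finset.HasAntidiagonal.antidiagonal (Finsupp.equivFunOnFinite.symm i),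
        MvPowerSeries.coeff (place n p.1) f * MvPowerSeries.coeff (place n p.2) g := by
  classical
  have hp : ∀ a : Fin k →₀ ℕ, place n a = Finsupp.mapDomain n a := fun a => by
    rw [place_eq, Finsupp.equivFunOnFinite_symm_coe]
  rw [MvPowerSeries.coeff_mul, place_eq]
  symm
  apply Finset.sum_bij
    (fun p _ => (Finsupp.mapDomain n p.1, Finsupp.mapDomain n p.2))
  · intro p h
    rw [Finset.HasAntidiagonal.mem_antidiagonal] at h ⊢
    rw [← Finsupp.mapDomain_add, h]
  · intro p _ q _ h
    exact Prod.ext (Finsupp.mapDomain_injective hn (Prod.mk.inj h).1)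
      (Finsupp.mapDomain_injective hn (Prod.mk.inj h).2)
  · intro q h
    rw [Finset.HasAntidiagonal.mem_antidiagonal] at h
    have key : ∀ a b : ℕ →₀ ℕ,
        a + b = Finsupp.mapDomain n (Finsupp.equivFunOnFinite.symm i) →
        Finsupp.mapDomain n (Finsupp.comapDomain n a hn.injOn) = a := by
      intro a b hab
      apply Finsupp.mapDomain_comapDomain n hn
      intro x hx
      by_contra hne
      have h0 := DFunLike.congr_fun hab x
      rw [Finsupp.mapDomain_of_notMem_range _ _ hne] at h0
      simp at h0 hx
      exact hx h0.1
    refine ⟨(Finsupp.comapDomain n q.1 hn.injOn, Finsupp.comapDomain n q.2 hn.injOn), ?_,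
      Prod.ext (key _ _ h) (key _ _ (by rw [add_comm]; exact h))⟩
    rw [Finset.HasAntidiagonal.mem_antidiagonal]
    apply Finsupp.mapDomain_injective hn
    rw [Finsupp.mapDomain_add, key _ _ h, key _ _ (by rw [add_comm]; exact h), h]
  · intro p _
    rw [hp, hp]

theorem degree_place {k : ℕ} (n i : Fin k → ℕ) : (place n i).degree = ∑ j, i j := by
  simp [place, map_sum]

/-- The degrees of the monomials that occur in the series are bounded. -/
def BoundedDegree (f : MvPowerSeries ℕ K) : Prop :=
  ∃ d : ℕ, ∀ m, MvPowerSeries.coeff m f ≠ 0 → m.degree ≤ d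

/-- For each admissible index sequence `n`, the coefficient of `x_{n₁}^{i₁} ⋯ x_{n_k}^{i_k}`
equals that of `x₁^{i₁} ⋯ x_k^{i_k}` (the first variable has index `0`; allowing some of the
exponents to vanish does not change the condition). -/
def InvariantUnder (P : ∀ k : ℕ, (Fin k → ℕ) → Prop) (f : MvPowerSeries ℕ K) : Prop :=
  ∀ (k : ℕ) (i n : Fin k → ℕ), P k n →
    MvPowerSeries.coeff (place n i) f = MvPowerSeries.coeff (place (fun j => (j : ℕ)) i) f

variable (K)

/-- The series of bounded degree with the invariance property. -/
def invariantSubalgebra (P : ∀ k : ℕ, (Fin k → ℕ) → Prop)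
    (hP : ∀ (k : ℕ) (n : Fin k → ℕ), P k n → Function.Injective n) :
    Subalgebra K (MvPowerSeries ℕ K) where
  carrier := {f | BoundedDegree f ∧ InvariantUnder P f}
  mul_mem' := by
    classical
    rintro f g ⟨⟨d, hd⟩, hf⟩ ⟨⟨e, he⟩, hg⟩
    refine ⟨⟨d + e, fun m hm => ?_⟩, fun k i n hn => ?_⟩
    · rw [MvPowerSeries.coeff_mul] at hm
      obtain ⟨p, hp, h⟩ := Finset.exists_ne_zero_of_sum_ne_zero hm
      rw [Finset.HasAntidiagonal.mem_antidiagonal] at hp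
      rw [← hp, map_add]
      exact add_le_add (hd _ (left_ne_zero_of_mul h)) (he _ (right_ne_zero_of_mul h))
    · rw [coeff_place_mul (hP k n hn), coeff_place_mul Fin.val_injective]
      exact Finset.sum_congr rfl fun p _ => by rw [hf k p.1 n hn, hg k p.2 n hn]
  add_mem' := by
    rintro f g ⟨⟨d, hd⟩, hf⟩ ⟨⟨e, he⟩, hg⟩
    refine ⟨⟨max d e, fun m hm => ?_⟩, fun k i n hn => ?_⟩
    · rw [map_add] at hm
      by_cases h : MvPowerSeries.coeff m f = 0
      · rw [h, zero_add] at hm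
        exact le_max_of_le_right (he m hm)
      · exact le_max_of_le_left (hd m h)
    · rw [map_add, map_add, hf k i n hn, hg k i n hn]
  algebraMap_mem' := by
    classical
    intro r
    rw [MvPowerSeries.algebraMap_apply, Algebra.algebraMap_self, RingHom.id_apply]
    refine ⟨⟨0, fun m hm => ?_⟩, fun k i n _ => ?_⟩
    · rw [MvPowerSeries.coeff_C] at hm
      have : m = 0 := by
        by_contra h
        exact hm (if_neg h)
      simp [this]
    · have : ∀ n : Fin k → ℕ, place n i = 0 ↔ ∑ j, i j = 0 := fun n => by
        rw [← degree_place n i, Finsupp.degree_eq_zero_iff]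
      simp only [MvPowerSeries.coeff_C, this]

/-- Quasi-symmetric functions. -/
def QSYM : Subalgebra K (MvPowerSeries ℕ K) :=
  invariantSubalgebra K (fun _ n => StrictMono n) fun _ _ h => h.injective

/-- Symmetric functions. -/
def SYM : Subalgebra K (MvPowerSeries ℕ K) :=
  invariantSubalgebra K (fun _ n => Function.Injective n) fun _ _ h => h

/-- The exponents of a composition. -/
def parts (I : List ℕ+) : Fin I.length → ℕ := fun j => (I.get j : ℕ)

open Classical in
/-- The sum of all monomials `x_{n₁}^{i₁} ⋯ x_{n_k}^{i_k}`, each counted once, for the admissible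
index sequences `n`. -/
def monomialSeries (P : ∀ k : ℕ, (Fin k → ℕ) → Prop) (I : List ℕ+) : MvPowerSeries ℕ K :=
  fun m => if ∃ n : Fin I.length → ℕ, P I.length n ∧ m = place n (parts I) then 1 else 0

theorem place_transfer {P : ∀ k : ℕ, (Fin k → ℕ) → Prop}
    (hinj : ∀ (k : ℕ) (n : Fin k → ℕ), P k n → Function.Injective n)
    (hP : ∀ (k l : ℕ) (a b : Fin k → ℕ) (σ : Fin l → Fin k), P k a → P k b →
      P l (fun j => a (σ j)) → P l (fun j => b (σ j)))
    {k : ℕ} {a b : Fin k → ℕ} (ha : P k a) (hb : P k b) (i : Fin k → ℕ) (I : List ℕ+)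
    (h : ∃ n : Fin I.length → ℕ, P I.length n ∧ place a i = place n (parts I)) :
    ∃ n : Fin I.length → ℕ, P I.length n ∧ place b i = place n (parts I) := by
  classical
  obtain ⟨n, hn, h⟩ := h
  have hr : ∀ j, ∃ s, a s = n j := by
    intro j
    by_contra hne
    have h1 : place a i (n j) = 0 := by
      rw [place_eq]
      exact Finsupp.mapDomain_of_notMem_range _ _ hne
    rw [h, place_eq, Finsupp.mapDomain_apply (hinj _ n hn)] at h1
    exact (I.get j).ne_zero h1
  choose σ hσ using hr
  have hn' : n = fun j => a (σ j) := funext fun j => (hσ j).symm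
  subst hn'
  refine ⟨fun j => b (σ j), hP _ _ a b σ ha hb hn, ?_⟩
  have e : ∀ c : Fin k → ℕ, place (fun j => c (σ j)) (parts I) =
      Finsupp.mapDomain c (∑ j, Finsupp.single (σ j) (parts I j)) := by
    intro c
    rw [Finsupp.mapDomain_finsetSum]
    simp [place]
  rw [e, place_eq] at h ⊢
  rw [Finsupp.mapDomain_injective (hinj _ a ha) h]

theorem monomialSeries_mem {P : ∀ k : ℕ, (Fin k → ℕ) → Prop}
    (hinj : ∀ (k : ℕ) (n : Fin k → ℕ), P k n → Function.Injective n)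
    (hval : ∀ k : ℕ, P k (fun j : Fin k => (j : ℕ)))
    (hP : ∀ (k l : ℕ) (a b : Fin k → ℕ) (σ : Fin l → Fin k), P k a → P k b →
      P l (fun j => a (σ j)) → P l (fun j => b (σ j))) (I : List ℕ+) :
    monomialSeries K P I ∈ invariantSubalgebra K P hinj := by
  classical
  refine ⟨⟨∑ j, parts I j, fun m hm => ?_⟩, fun k i n hn => ?_⟩
  · by_cases h : ∃ n : Fin I.length → ℕ, P I.length n ∧ m = place n (parts I)
    · obtain ⟨n, _, rfl⟩ := h
      exact (degree_place n _).le
    · exact absurd (if_neg h) hm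
  · have : (∃ a : Fin I.length → ℕ, P I.length a ∧ place n i = place a (parts I)) ↔
        ∃ a : Fin I.length → ℕ, P I.length a ∧ place (fun j : Fin k => (j : ℕ)) i = place a (parts I) :=
      ⟨place_transfer hinj hP hn (hval k) i I, place_transfer hinj hP (hval k) hn i I⟩
    change (if _ then (1 : K) else 0) = if _ then (1 : K) else 0
    simp only [this]

/-- The monomial quasi-symmetric function `M_I`, for a composition `I`. -/
def QSYM.M (I : List ℕ+) : QSYM K :=
  ⟨monomialSeries K (fun _ n => StrictMono n) I, monomialSeries_mem K (fun _ _ h => h.injective)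
    (fun _ => Fin.val_strictMono)
    (fun _ _ _ _ _ ha hb h _ _ hxy => hb (ha.lt_iff_lt.1 (h hxy))) I⟩

/-- The monomial symmetric function `m_λ`, for a partition `λ` (a multiset of parts). -/
def SYM.m (l : Multiset ℕ+) : SYM K :=
  ⟨monomialSeries K (fun _ n => Function.Injective n) l.toList, monomialSeries_mem K (fun _ _ h => h)
    (fun _ => Fin.val_injective)
    (fun _ _ _ _ _ _ hb h _ _ hxy => h (congrArg _ (hb hxy))) l.toList⟩

/-- The coefficient of `x₁^{i₁} ⋯ x_k^{i_k}`. -/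
def leadCoeff (I : List ℕ+) : MvPowerSeries ℕ K →ₗ[K] K :=
  MvPowerSeries.coeff (place (fun j => (j : ℕ)) (parts I))

theorem leadCoeff_finite (f : MvPowerSeries ℕ K) (hf : BoundedDegree f) :
    {I : List ℕ+ | leadCoeff K I f ≠ 0}.Finite := by
  obtain ⟨d, hd⟩ := hf
  have h1 : (⋃ n ∈ Finset.range (d + 1),
      Set.range (fun c : Composition n => c.blocks)).Finite :=
    Set.Finite.biUnion (Finset.finite_toSet _) fun n _ => Set.finite_range _
  refine Set.Finite.of_finite_image (f := List.map (fun n : ℕ+ => (n : ℕ)))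
    (h1.subset ?_) (List.map_injective_iff.2 PNat.coe_injective).injOn
  rintro _ ⟨I, hI, rfl⟩
  have h2 := hd _ hI
  rw [degree_place] at h2
  have h3 : ∑ j, parts I j = (I.map (fun n : ℕ+ => (n : ℕ))).sum := by
    have : I.map (fun n : ℕ+ => (n : ℕ)) = List.ofFn (parts I) := by
      conv_lhs => rw [← List.ofFn_get I, List.map_ofFn]
      rfl
    rw [this, List.sum_ofFn]
  simp only [Set.mem_iUnion, Set.mem_range, Finset.mem_range]
  refine ⟨_, Nat.lt_succ_of_le (h3 ▸ h2),
    ⟨I.map (fun n : ℕ+ => (n : ℕ)), ?_, rfl⟩, rfl⟩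
  intro i hi
  obtain ⟨a, _, rfl⟩ := List.mem_map.1 hi
  exact a.pos

/-- The coefficients of a quasi-symmetric function in the expansion `f = ∑ c_I M_I`. -/
def QSYM.coeffs : QSYM K →ₗ[K] (List ℕ+ →₀ K) where
  toFun f := Finsupp.ofSupportFinite (fun I => leadCoeff K I f.1) (leadCoeff_finite K f.1 f.2.1)
  map_add' f g := Finsupp.ext fun I => map_add (leadCoeff K I) f.1 g.1
  map_smul' c f := Finsupp.ext fun I => map_smul (leadCoeff K I) c f.1

/-- The coefficients of a symmetric function in the expansion `f = ∑ c_λ m_λ`. -/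
def SYM.coeffs : SYM K →ₗ[K] (Multiset ℕ+ →₀ K) where
  toFun f := Finsupp.ofSupportFinite (fun l => leadCoeff K l.toList f.1)
    ((leadCoeff_finite K f.1 f.2.1).preimage
      (Function.LeftInverse.injective Multiset.coe_toList).injOn)
  map_add' f g := Finsupp.ext fun l => map_add (leadCoeff K l.toList) f.1 g.1
  map_smul' c f := Finsupp.ext fun l => map_smul (leadCoeff K l.toList) c f.1

/-- Product of power series, and `Δ M_I = ∑ M_{I'} ⊗ M_{I''}` over all ways to write `I` as a
concatenation of `I'` and `I''`. -/
def QSYM.hopf : HopfData K (QSYM K) where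
  mul := LinearMap.mul K _
  one := 1
  comul := (Finsupp.linearCombination K fun I : List ℕ+ =>
    ∑ s ∈ Finset.range (I.length + 1),
      QSYM.M K (I.take s) ⊗ₜ[K] QSYM.M K (I.drop s)) ∘ₗ QSYM.coeffs K
  counit := MvPowerSeries.coeff 0 ∘ₗ (QSYM K).val.toLinearMap

/-- Product of power series, and `Δ m_λ = ∑ m_μ ⊗ m_ν` over all pairs `(μ, ν)` with union `λ`. -/
def SYM.hopf : HopfData K (SYM K) where
  mul := LinearMap.mul K _
  one := 1
  comul := (Finsupp.linearCombination K fun l : Multiset ℕ+ =>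
    ∑ a ∈ Finset.Iic l, SYM.m K a ⊗ₜ[K] SYM.m K (l - a)) ∘ₗ SYM.coeffs K
  counit := MvPowerSeries.coeff 0 ∘ₗ (SYM K).val.toLinearMap

/-- The elementary symmetric function `e_n = m_{(1,…,1)}` (`n` ones). -/
def SYM.e (n : ℕ+) : SYM K := SYM.m K (Multiset.replicate n 1)

/-! ### The duality pairings -/

/-- The pairing of `NSYM` and `QSYM` for which the bases `z_I = z_{i₁} ⋯ z_{i_k}` and `M_I` are
dual. -/
def pairNQ (x : NSYM K) (f : QSYM K) : K := dot K _ (wordCoeff K x) (QSYM.coeffs K f)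

/-- The pairing of the space of forests and that of planar trees for which the forests `u` and the
trees `B⁺(u)` form dual bases. -/
def pairFP (x : HF K) (y : HP K) : K :=
  dot K _ x (Finsupp.lmapDomain K K PTree.branches y)

/-- The pairing for which the words `f_{i₁} ⋯ f_{i_k}` and the monomials `e_{-i₁} ⋯ e_{-i_k}` form
dual bases. -/
def pairUL (x : HU K) (y : ULU K) : K :=
  dot K _ x (wordCoeff K (FreeLieAlgebra.universalEnvelopingEquivFreeAlgebra K ℕ+ y))

end

end

/-! Only three of the eight bialgebras are verified directly. For NSYM and U(L) the coproduct and
counit are algebra homomorphisms, so the coalgebra axioms need only be tested on generators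
(`IsBialgebra.ofAlgHom_of_adjoin`). For H_F, grafting B⁺ is a Hochschild 1-cocycle, Δ B⁺(x) = B⁺(x)
⊗ 1 + (id ⊗ B⁺) Δ x (`HF.Δ_tree`), and the axioms follow by induction on forests.

The others are inherited. Bialgebra axioms cross a pairing that transposes structure maps into each
other (`IsBialgebra.dual`): QSYM is obtained from NSYM, H_P from H_F, and H_U from U(L). H_CK is a
quotient of H_F, and SYM embeds in QSYM. The duality inputs are combinatorial: coefficients of
products of series against Δ(z_I) (`NSYM.isDual`), graftings against admissible cuts
(`PForest.graftCount_eq_cutCount`), and removal of the first letter as a derivation of the shuffle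
product (`ULU.isDual`). Antipodes exist because each bialgebra is graded and connected
(`IsBialgebra.isHopfAlgebra`).

Homomorphisms out of NSYM and U(L) are prescribed on generators. The map H_P → QSYM is the transpose
of NSYM → H_F, and H_F → H_U is the transpose of U(L) → H_P. For the latter one has to see that the
transpose sends a forest u to the sum of π(v) over [u]. A word in π(v) starts with a letter k at a
vertex with nothing above it; in u this vertex is a ladder with k vertices that an admissible cut
can prune. Thus removal of the first letter k from the sum for u gives the sum over prunings of l_k
(`removeHead_piClass`). This is also the transpose of left multiplication by B⁺(l_k), the image of
e_{-k}, so the two maps agree by induction on words (`piClass_apply`).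

Since the e_λ form a basis of SYM (`SYM.eMap_injective`, `SYM.eMap_surjective`), the pairing on SYM
and the map SYM → H_CK are defined. The latter, and H_CK → H_U, are homomorphisms because they arise
by factoring homomorphisms through the surjections NSYM → SYM and H_F → H_CK. The second square is
checked on generators, and the remaining identities are diagram chases. -/

open scoped TensorProduct

noncomputable section

open HopfData

/-! ### Bialgebras, pairings and transposed homomorphisms -/

namespace HopfData

variable {K V W V' W' : Type*} [CommRing K] [AddCommGroup V] [Module K V]
  [AddCommGroup W] [Module K W] [AddCommGroup V'] [Module K V'] [AddCommGroup W'] [Module K W']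

/-- The axioms of a bialgebra. -/
structure IsBialgebra (H : HopfData K V) : Prop where
  mul_assoc : ∀ x y z, H.mul (H.mul x y) z = H.mul x (H.mul y z)
  one_mul : ∀ x, H.mul H.one x = x
  mul_one : ∀ x, H.mul x H.one = x
  coassoc : ∀ x, TensorProduct.assoc K V V V (H.comul.rTensor V (H.comul x)) =
    H.comul.lTensor V (H.comul x)
  counit_left : ∀ x, H.counit.rTensor V (H.comul x) = 1 ⊗ₜ[K] x
  counit_right : ∀ x, H.counit.lTensor V (H.comul x) = x ⊗ₜ[K] 1
  comul_mul : ∀ x y, H.comul (H.mul x y) =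
    TensorProduct.map₂ H.mul H.mul (H.comul x) (H.comul y)
  comul_one : H.comul H.one = H.one ⊗ₜ[K] H.one
  counit_mul : ∀ x y, H.counit (H.mul x y) = H.counit x * H.counit y
  counit_one : H.counit H.one = 1

/-! ### Duality -/

/-- The pairing of tensor products induced by two pairings. -/
def tpair (P : V →ₗ[K] W →ₗ[K] K) (Q : V' →ₗ[K] W' →ₗ[K] K) :
    V ⊗[K] V' →ₗ[K] W ⊗[K] W' →ₗ[K] K :=
  (TensorProduct.map₂ P Q).compr₂ (LinearMap.mul' K K)

@[simp]
theorem tpair_tmul (P : V →ₗ[K] W →ₗ[K] K) (Q : V' →ₗ[K] W' →ₗ[K] K) (x : V) (y : V') (w : W)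
    (z : W') : tpair P Q (x ⊗ₜ y) (w ⊗ₜ z) = P x w * Q y z := by
  simp [tpair]

theorem tpair_flip (P : V →ₗ[K] W →ₗ[K] K) (Q : V' →ₗ[K] W' →ₗ[K] K) (x : V ⊗[K] V')
    (w : W ⊗[K] W') : tpair P.flip Q.flip w x = tpair P Q x w := by
  induction x with
  | zero => simp
  | add x y hx hy => simp [hx, hy]
  | tmul x y =>
    induction w with
    | zero => simp
    | add x y hx hy => simp [hx, hy]
    | tmul w z => simp

/-- There are vectors of the first space that pair with the second one as the coordinates in some
basis. -/
def Separates (P : V →ₗ[K] W →ₗ[K] K) : Prop :=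
  ∃ (ι : Type) (b : Module.Basis ι K W) (x : ι → V), ∀ i w, P (x i) w = b.repr w i

theorem Separates.ext {P : V →ₗ[K] W →ₗ[K] K} (h : Separates P) {w z : W}
    (hwz : ∀ x, P x w = P x z) : w = z := by
  obtain ⟨ι, b, x, hx⟩ := h
  exact b.ext_elem fun i => by rw [← hx, ← hx, hwz]

/-- The tensors of the chosen vectors pair as the coordinates in the tensor product basis. This is
why separation is phrased by bases rather than by nondegeneracy. -/
theorem Separates.tpair {P : V →ₗ[K] W →ₗ[K] K} {Q : V' →ₗ[K] W' →ₗ[K] K} (hP : Separates P)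
    (hQ : Separates Q) : Separates (tpair P Q) := by
  obtain ⟨ι, b, x, hx⟩ := hP
  obtain ⟨κ, c, y, hy⟩ := hQ
  refine ⟨ι × κ, b.tensorProduct c, fun i => x i.1 ⊗ₜ y i.2, fun i w => ?_⟩
  induction w with
  | zero => simp
  | add x y hx hy => simp [hx, hy]
  | tmul w z => rw [tpair_tmul, hx, hy, Module.Basis.tensorProduct_repr_tmul_apply, smul_eq_mul,
      mul_comm]

theorem Separates.ext_tensor {P : V →ₗ[K] W →ₗ[K] K} {Q : V' →ₗ[K] W' →ₗ[K] K} (hP : Separates P)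
    (hQ : Separates Q) {w z : W ⊗[K] W'}
    (h : ∀ x y, HopfData.tpair P Q (x ⊗ₜ y) w = HopfData.tpair P Q (x ⊗ₜ y) z) : w = z := by
  refine (hP.tpair hQ).ext fun X => ?_
  induction X with
  | zero => simp
  | add x y hx hy => simp [hx, hy]
  | tmul x y => exact h x y

theorem tpair_assoc {V₁ V₂ V₃ W₁ W₂ W₃ : Type*} [AddCommGroup V₁] [Module K V₁] [AddCommGroup V₂]
    [Module K V₂] [AddCommGroup V₃] [Module K V₃] [AddCommGroup W₁] [Module K W₁] [AddCommGroup W₂]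
    [Module K W₂] [AddCommGroup W₃] [Module K W₃]
    (P : V₁ →ₗ[K] W₁ →ₗ[K] K) (Q : V₂ →ₗ[K] W₂ →ₗ[K] K) (R : V₃ →ₗ[K] W₃ →ₗ[K] K)
    (x : V₁) (y : V₂) (z : V₃) (Z : (W₁ ⊗[K] W₂) ⊗[K] W₃) :
    tpair P (tpair Q R) (x ⊗ₜ (y ⊗ₜ z)) (TensorProduct.assoc K W₁ W₂ W₃ Z) =
      tpair (tpair P Q) R ((x ⊗ₜ y) ⊗ₜ z) Z := by
  induction Z with
  | zero => simp
  | add x y hx hy => simp [hx, hy]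
  | tmul w c =>
    induction w with
    | zero => simp
    | add x y hx hy => simp only [TensorProduct.add_tmul, map_add, hx, hy]
    | tmul a b => simp [mul_assoc]

/-- A pairing of two Hopf algebras for which the structure maps of each are transposes of those of
the other. -/
structure IsDual (H : HopfData K V) (G : HopfData K W) (P : V →ₗ[K] W →ₗ[K] K) : Prop where
  mul_left : ∀ x y w, P (H.mul x y) w = tpair P P (x ⊗ₜ y) (G.comul w)
  mul_right : ∀ x w z, P x (G.mul w z) = tpair P P (H.comul x) (w ⊗ₜ z)
  one_left : ∀ w, P H.one w = G.counit w
  one_right : ∀ x, P x G.one = H.counit x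

theorem IsDual.flip {H : HopfData K V} {G : HopfData K W} {P : V →ₗ[K] W →ₗ[K] K}
    (h : IsDual H G P) : IsDual G H P.flip where
  mul_left x y w := by rw [tpair_flip]; exact h.mul_right w x y
  mul_right x w z := by rw [tpair_flip]; exact h.mul_left w z x
  one_left := h.one_right
  one_right := h.one_left

/-- In the pairing of fourfold tensor products, the middle factors may be interchanged on both
sides. -/
theorem tpair_map₂ {H : HopfData K V} {G : HopfData K W} {P : V →ₗ[K] W →ₗ[K] K}
    (h : IsDual H G P) (x y : V) (w z : W) :
    tpair P P (TensorProduct.map₂ H.mul H.mul (H.comul x) (H.comul y)) (w ⊗ₜ z) =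
      tpair P P (x ⊗ₜ y) (TensorProduct.map₂ G.mul G.mul (G.comul w) (G.comul z)) := by
  -- Both sides equal the fourfold pairing of Δx ⊗ Δy with Δw ⊗ Δz after interchanging the middle
  -- factors: `h1` unfolds the products of `H`, and `h3` those of `G`.
  let T := TensorProduct.tensorTensorTensorComm K W W W W
  have h1 : ∀ X Y : V ⊗[K] V, ∀ w z, tpair P P (TensorProduct.map₂ H.mul H.mul X Y) (w ⊗ₜ z) =
      tpair (tpair P P) (tpair P P) (X ⊗ₜ Y) (T (G.comul w ⊗ₜ G.comul z)) := by
    intro X Y w z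
    have h2 : ∀ a b a' b' : V, ∀ A B : W ⊗[K] W,
        tpair (tpair P P) (tpair P P) ((a ⊗ₜ b) ⊗ₜ (a' ⊗ₜ b')) (T (A ⊗ₜ B)) =
        tpair P P (a ⊗ₜ a') A * tpair P P (b ⊗ₜ b') B := by
      intro a b a' b' A B
      induction A with
      | zero => simp
      | add x y hx hy => simp only [TensorProduct.add_tmul, map_add, hx, hy, add_mul]
      | tmul c d =>
        induction B with
        | zero => simp
        | add x y hx hy => simp only [TensorProduct.tmul_add, map_add, hx, hy, mul_add]
        | tmul e f => simp [T]; ring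
    induction X with
    | zero => simp
    | add x y hx hy => simp only [TensorProduct.add_tmul, map_add, LinearMap.add_apply, hx, hy]
    | tmul a b =>
      induction Y with
      | zero => simp
      | add x y hx hy => simp only [TensorProduct.tmul_add, map_add, LinearMap.add_apply, hx, hy]
      | tmul a' b' =>
        rw [h2, TensorProduct.map₂_apply_tmul, TensorProduct.map_tmul, tpair_tmul, h.mul_left, h.mul_left]
  have h3 : ∀ x y, ∀ A B : W ⊗[K] W, tpair P P (x ⊗ₜ y) (TensorProduct.map₂ G.mul G.mul A B) =
      tpair (tpair P P) (tpair P P) (H.comul x ⊗ₜ H.comul y) (T (A ⊗ₜ B)) := by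
    intro x y A B
    induction A with
    | zero => simp
    | add x y hx hy => simp only [TensorProduct.add_tmul, map_add, LinearMap.add_apply, hx, hy]
    | tmul a b =>
      induction B with
      | zero => simp
      | add x y hx hy => simp only [TensorProduct.tmul_add, map_add, hx, hy]
      | tmul a' b' =>
        rw [TensorProduct.map₂_apply_tmul, TensorProduct.map_tmul, tpair_tmul, h.mul_right, h.mul_right]
        simp [T]
  rw [h1, h3]

/-- The bialgebra axioms pass to the other side of a duality. -/
theorem IsBialgebra.dual {H : HopfData K V} {G : HopfData K W} {P : V →ₗ[K] W →ₗ[K] K}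
    (hH : H.IsBialgebra) (h : IsDual H G P) (hP : Separates P) : G.IsBialgebra where
  mul_assoc a b c := by
    refine hP.ext fun x => ?_
    have h1 : ∀ (X : V ⊗[K] V) (a b c : W), tpair P P X (G.mul a b ⊗ₜ c) =
        tpair (tpair P P) P (H.comul.rTensor V X) ((a ⊗ₜ b) ⊗ₜ c) := by
      intro X a b c
      induction X with
      | zero => simp
      | add x y hx hy => simp only [map_add, LinearMap.add_apply, hx, hy]
      | tmul x y => simp [h.mul_right]
    have h2 : ∀ (X : V ⊗[K] V) (a b c : W), tpair P P X (a ⊗ₜ G.mul b c) =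
        tpair P (tpair P P) (H.comul.lTensor V X) (a ⊗ₜ (b ⊗ₜ c)) := by
      intro X a b c
      induction X with
      | zero => simp
      | add x y hx hy => simp only [map_add, LinearMap.add_apply, hx, hy]
      | tmul x y => simp [h.mul_right]
    rw [h.mul_right, h.mul_right, h1, h2, ← hH.coassoc]
    -- The associator now acts on the side of `V`, so the pairing has to be read in the other
    -- direction.
    have := tpair_assoc P.flip P.flip P.flip a b c (H.comul.rTensor V (H.comul x))
    have h3 : tpair P.flip (tpair P.flip P.flip) = (tpair P (tpair P P)).flip := by
      ext; simp
    have h4 : tpair (tpair P.flip P.flip) P.flip = (tpair (tpair P P) P).flip := by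
      ext; simp
    rw [h3, h4] at this
    exact this.symm
  one_mul a := by
    refine hP.ext fun x => ?_
    have h1 : ∀ (X : V ⊗[K] V), tpair P P X (G.one ⊗ₜ a) =
        tpair (LinearMap.mul K K) P (H.counit.rTensor V X) (1 ⊗ₜ a) := by
      intro X
      induction X with
      | zero => simp
      | add x y hx hy => simp only [map_add, LinearMap.add_apply, hx, hy]
      | tmul x y => simp [h.one_right]
    rw [h.mul_right, h1, hH.counit_left]
    simp
  mul_one a := by
    refine hP.ext fun x => ?_
    have h1 : ∀ (X : V ⊗[K] V), tpair P P X (a ⊗ₜ G.one) =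
        tpair P (LinearMap.mul K K) (H.counit.lTensor V X) (a ⊗ₜ 1) := by
      intro X
      induction X with
      | zero => simp
      | add x y hx hy => simp only [map_add, LinearMap.add_apply, hx, hy]
      | tmul x y => simp [h.one_right]
    rw [h.mul_right, h1, hH.counit_right]
    simp
  coassoc w := by
    refine hP.ext_tensor (hP.tpair hP) fun x Y => ?_
    induction Y with
    | zero => simp
    | add x y hx hy => simp only [TensorProduct.tmul_add, map_add, LinearMap.add_apply, hx, hy]
    | tmul y z =>
      rw [tpair_assoc]
      have h1 : ∀ Z : W ⊗[K] W, tpair (tpair P P) P ((x ⊗ₜ y) ⊗ₜ z) (G.comul.rTensor W Z) =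
          tpair P P (H.mul x y ⊗ₜ z) Z := by
        intro Z
        induction Z with
        | zero => simp
        | add x y hx hy => simp only [map_add, hx, hy]
        | tmul a b => simp [h.mul_left]
      have h2 : ∀ Z : W ⊗[K] W, tpair P (tpair P P) (x ⊗ₜ (y ⊗ₜ z)) (G.comul.lTensor W Z) =
          tpair P P (x ⊗ₜ H.mul y z) Z := by
        intro Z
        induction Z with
        | zero => simp
        | add x y hx hy => simp only [map_add, hx, hy]
        | tmul a b => simp [h.mul_left]
      rw [h1, h2, ← h.mul_left, ← h.mul_left, hH.mul_assoc]
  counit_left w := by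
    -- The scalar factor is tested against the pairing of `K` with itself by multiplication.
    have hK : Separates (LinearMap.mul K K) := ⟨Unit, Module.Basis.singleton Unit K, fun _ => 1,
      fun i w => by simp⟩
    refine hK.ext_tensor hP fun r y => ?_
    have h1 : ∀ Z : W ⊗[K] W, tpair (LinearMap.mul K K) P (r ⊗ₜ y) (G.counit.rTensor W Z) =
        tpair P P ((r • H.one) ⊗ₜ y) Z := by
      intro Z
      induction Z with
      | zero => simp
      | add x y hx hy => simp only [map_add, hx, hy]
      | tmul a b => simp [h.one_left]
    rw [h1, ← h.mul_left]
    simp [hH.one_mul]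
  counit_right w := by
    have hK : Separates (LinearMap.mul K K) := ⟨Unit, Module.Basis.singleton Unit K, fun _ => 1,
      fun i w => by simp⟩
    refine hP.ext_tensor hK fun y r => ?_
    have h1 : ∀ Z : W ⊗[K] W, tpair P (LinearMap.mul K K) (y ⊗ₜ r) (G.counit.lTensor W Z) =
        tpair P P (y ⊗ₜ (r • H.one)) Z := by
      intro Z
      induction Z with
      | zero => simp
      | add x y hx hy => simp only [map_add, hx, hy]
      | tmul a b => simp [h.one_left, mul_left_comm]
    rw [h1, ← h.mul_left]
    simp [hH.mul_one, mul_comm]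
  comul_mul w z := by
    refine hP.ext_tensor hP fun x y => ?_
    -- Compatibility of product and coproduct is its own transpose, up to the interchange of the
    -- middle factors.
    rw [← h.mul_left, h.mul_right, hH.comul_mul, tpair_map₂ h]
  comul_one := by
    refine hP.ext_tensor hP fun x y => ?_
    rw [← h.mul_left, tpair_tmul, h.one_right, h.one_right, h.one_right, hH.counit_mul]
  counit_mul w z := by
    rw [← h.one_left, ← h.one_left, ← h.one_left, h.mul_right, hH.comul_one, tpair_tmul]
  counit_one := by rw [← h.one_left, h.one_right, hH.counit_one]

theorem tpair_map {V₁ W₁ : Type*} [AddCommGroup V₁] [Module K V₁] [AddCommGroup W₁] [Module K W₁]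
    {P : V →ₗ[K] W →ₗ[K] K} {Q : V₁ →ₗ[K] W₁ →ₗ[K] K} {f : V →ₗ[K] V₁} {g : W₁ →ₗ[K] W}
    (h : ∀ x w, Q (f x) w = P x (g w)) (X : V ⊗[K] V) (Z : W₁ ⊗[K] W₁) :
    tpair Q Q (TensorProduct.map f f X) Z = tpair P P X (TensorProduct.map g g Z) := by
  induction X with
  | zero => simp
  | add x y hx hy => simp only [map_add, LinearMap.add_apply, hx, hy]
  | tmul x y =>
    induction Z with
    | zero => simp
    | add x y hx hy => simp only [map_add, hx, hy]
    | tmul a b => simp [h]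

/-- The transpose of a homomorphism is a homomorphism. -/
theorem IsHom.transpose {V₁ W₁ : Type*} [AddCommGroup V₁] [Module K V₁] [AddCommGroup W₁]
    [Module K W₁] {H : HopfData K V} {G : HopfData K W} {H₁ : HopfData K V₁} {G₁ : HopfData K W₁}
    {P : V →ₗ[K] W →ₗ[K] K} {Q : V₁ →ₗ[K] W₁ →ₗ[K] K} {f : V →ₗ[K] V₁} {g : W₁ →ₗ[K] W}
    (hf : H.IsHom H₁ f) (hP : IsDual H G P) (hQ : IsDual H₁ G₁ Q) (hsep : Separates P)
    (h : ∀ x w, Q (f x) w = P x (g w)) : G₁.IsHom G g where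
  map_mul w z := by
    refine hsep.ext fun x => ?_
    rw [← h, hQ.mul_right, ← hf.map_comul, hP.mul_right, tpair_map h, TensorProduct.map_tmul]
  map_one := by
    refine hsep.ext fun x => ?_
    rw [← h, hQ.one_right, hP.one_right, hf.map_counit]
  map_comul w := by
    refine hsep.ext_tensor hsep fun x y => ?_
    rw [← tpair_map h, ← hP.mul_left, ← h, hf.map_mul, hQ.mul_left, TensorProduct.map_tmul]
  map_counit w := by rw [← hP.one_left, ← hQ.one_left, ← h, hf.map_one]

end HopfData

namespace HopfData

variable {K V W : Type*} [CommRing K] [AddCommGroup V] [Module K V]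
  [AddCommGroup W] [Module K W]

/-! ### The ring given by a product -/

/-- The product is associative and unital. -/
structure IsMonoid (H : HopfData K V) : Prop where
  mul_assoc : ∀ x y z, H.mul (H.mul x y) z = H.mul x (H.mul y z)
  one_mul : ∀ x, H.mul H.one x = x
  mul_one : ∀ x, H.mul x H.one = x

theorem IsBialgebra.isMonoid {H : HopfData K V} (h : H.IsBialgebra) : H.IsMonoid :=
  ⟨h.mul_assoc, h.one_mul, h.mul_one⟩

/-- The underlying space, as an algebra. -/
def Carrier (H : HopfData K V) (_ : H.IsMonoid) : Type _ := V

variable {H : HopfData K V}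

instance (h : H.IsMonoid) : AddCommGroup (H.Carrier h) := inferInstanceAs (AddCommGroup V)

instance (h : H.IsMonoid) : Ring (H.Carrier h) where
  __ := (inferInstance : AddCommGroup (H.Carrier h))
  mul x y := H.mul x y
  one := H.one
  mul_assoc := h.mul_assoc
  one_mul := h.one_mul
  mul_one := h.mul_one
  left_distrib x y z := LinearMap.map_add (H.mul x) y z
  right_distrib x y z := LinearMap.map_add₂ H.mul x y z
  zero_mul x := LinearMap.map_zero₂ H.mul x
  mul_zero x := LinearMap.map_zero (H.mul x)

instance (h : H.IsMonoid) : Module K (H.Carrier h) := inferInstanceAs (Module K V)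

instance (h : H.IsMonoid) : Algebra K (H.Carrier h) :=
  Algebra.ofModule (fun r x y => LinearMap.map_smul₂ H.mul r x y)
    (fun r x y => LinearMap.map_smul (H.mul x) r y)

/-- Identifies the product in the compatibility axiom with that of the tensor product algebra, so
that the axiom says that the coproduct is multiplicative. -/
theorem map₂_mul {A : Type*} [Ring A] [Algebra K A] (X Y : A ⊗[K] A) :
    TensorProduct.map₂ (LinearMap.mul K A) (LinearMap.mul K A) X Y = X * Y := by
  induction X with
  | zero => simp
  | add x y hx hy => simp only [map_add, LinearMap.add_apply, hx, hy, add_mul]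
  | tmul a b =>
    induction Y with
    | zero => simp
    | add x y hx hy => simp only [map_add, hx, hy, mul_add]
    | tmul c d => simp

/-- A bialgebra given by algebra homomorphisms. -/
theorem IsBialgebra.ofAlgHom {A : Type*} [Ring A] [Algebra K A] {H : HopfData K A}
    (Δ : A →ₐ[K] A ⊗[K] A) (ε : A →ₐ[K] K) (hmul : H.mul = LinearMap.mul K A) (hone : H.one = 1)
    (hΔ : H.comul = Δ.toLinearMap) (hε : H.counit = ε.toLinearMap)
    (coassoc : ∀ x, TensorProduct.assoc K A A A (H.comul.rTensor A (H.comul x)) =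
      H.comul.lTensor A (H.comul x))
    (counit_left : ∀ x, H.counit.rTensor A (H.comul x) = 1 ⊗ₜ[K] x)
    (counit_right : ∀ x, H.counit.lTensor A (H.comul x) = x ⊗ₜ[K] 1) : H.IsBialgebra where
  mul_assoc := by simp [hmul, _root_.mul_assoc]
  one_mul := by simp [hmul, hone]
  mul_one := by simp [hmul, hone]
  coassoc := coassoc
  counit_left := counit_left
  counit_right := counit_right
  comul_mul x y := by
    rw [hmul, hΔ, map₂_mul]
    exact map_mul Δ x y
  comul_one := by
    rw [hone, hΔ]
    exact map_one Δ
  counit_mul x y := by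
    rw [hmul, hε]
    exact map_mul ε x y
  counit_one := by
    rw [hone, hε]
    exact map_one ε

/-- Given that coproduct and counit are algebra homomorphisms, the coalgebra axioms need only be
checked on generators. -/
theorem IsBialgebra.ofAlgHom_of_adjoin {A : Type*} [Ring A] [Algebra K A] {H : HopfData K A}
    (Δ : A →ₐ[K] A ⊗[K] A) (ε : A →ₐ[K] K) (hmul : H.mul = LinearMap.mul K A) (hone : H.one = 1)
    (hΔ : H.comul = Δ.toLinearMap) (hε : H.counit = ε.toLinearMap)
    {s : Set A} (hs : Algebra.adjoin K s = ⊤)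
    (coassoc : ∀ x ∈ s, TensorProduct.assoc K A A A (H.comul.rTensor A (H.comul x)) =
      H.comul.lTensor A (H.comul x))
    (counit_left : ∀ x ∈ s, H.counit.rTensor A (H.comul x) = 1 ⊗ₜ[K] x)
    (counit_right : ∀ x ∈ s, H.counit.lTensor A (H.comul x) = x ⊗ₜ[K] 1) : H.IsBialgebra := by
  refine .ofAlgHom Δ ε hmul hone hΔ hε (fun x => ?_) (fun x => ?_) (fun x => ?_)
  -- Both sides of each coalgebra axiom are algebra homomorphisms, hence determined by their values
  -- on generators.
  · have h : ((Algebra.TensorProduct.assoc K K K A A A).toAlgHom.comp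
        (Algebra.TensorProduct.map Δ (AlgHom.id K A))).comp Δ =
        (Algebra.TensorProduct.map (AlgHom.id K A) Δ).comp Δ :=
      AlgHom.ext_of_adjoin_eq_top hs fun x hx => by
        have := coassoc x hx
        rw [hΔ] at this
        exact this
    rw [hΔ]
    exact DFunLike.congr_fun h x
  · have h : (Algebra.TensorProduct.map ε (AlgHom.id K A)).comp Δ =
        Algebra.TensorProduct.includeRight :=
      AlgHom.ext_of_adjoin_eq_top hs fun x hx => by
        have := counit_left x hx
        rw [hΔ, hε] at this
        exact this
    rw [hΔ, hε]
    exact DFunLike.congr_fun h x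
  · have h : (Algebra.TensorProduct.map (AlgHom.id K A) ε).comp Δ =
        Algebra.TensorProduct.includeLeft :=
      AlgHom.ext_of_adjoin_eq_top hs fun x hx => by
        have := counit_right x hx
        rw [hΔ, hε] at this
        exact this
    rw [hΔ, hε]
    exact DFunLike.congr_fun h x

/-! ### Transport of the axioms along homomorphisms -/

theorem map_map₂ {H : HopfData K V} {G : HopfData K W} {f : V →ₗ[K] W}
    (hf : ∀ x y, f (H.mul x y) = G.mul (f x) (f y)) (X Y : V ⊗[K] V) :
    TensorProduct.map f f (TensorProduct.map₂ H.mul H.mul X Y) =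
      TensorProduct.map₂ G.mul G.mul (TensorProduct.map f f X) (TensorProduct.map f f Y) := by
  induction X with
  | zero => simp
  | add x y hx hy => simp only [map_add, LinearMap.add_apply, hx, hy]
  | tmul a b =>
    induction Y with
    | zero => simp
    | add x y hx hy => simp only [map_add, hx, hy]
    | tmul c d => simp [hf]

section transport

variable {H : HopfData K V} {G : HopfData K W} {f : V →ₗ[K] W}

/-- Both sides of each coalgebra axiom are natural in the coalgebra. This lemma and the next three
express that, and let the axioms descend along surjections and be reflected by injections. -/
theorem IsHom.map_coassoc_left (hf : H.IsHom G f) (x : V) :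
    TensorProduct.assoc K W W W (G.comul.rTensor W (G.comul (f x))) =
      TensorProduct.map f (TensorProduct.map f f)
        (TensorProduct.assoc K V V V (H.comul.rTensor V (H.comul x))) := by
  have h1 : ∀ X : V ⊗[K] V, G.comul.rTensor W (TensorProduct.map f f X) =
      TensorProduct.map (TensorProduct.map f f) f (H.comul.rTensor V X) := by
    intro X
    induction X with
    | zero => simp
    | add x y hx hy => simp only [map_add, hx, hy]
    | tmul a b => simp [hf.map_comul]
  rw [← hf.map_comul, h1]
  generalize H.comul.rTensor V (H.comul x) = Z
  induction Z with
  | zero => simp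
  | add x y hx hy => simp only [map_add, hx, hy]
  | tmul z c =>
    induction z with
    | zero => simp
    | add x y hx hy => simp only [TensorProduct.add_tmul, map_add, hx, hy]
    | tmul a b => simp

theorem IsHom.map_coassoc_right (hf : H.IsHom G f) (x : V) :
    G.comul.lTensor W (G.comul (f x)) =
      TensorProduct.map f (TensorProduct.map f f) (H.comul.lTensor V (H.comul x)) := by
  rw [← hf.map_comul]
  generalize H.comul x = Z
  induction Z with
  | zero => simp
  | add x y hx hy => simp only [map_add, hx, hy]
  | tmul a b => simp [hf.map_comul]

theorem IsHom.map_counit_left (hf : H.IsHom G f) (x : V) :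
    G.counit.rTensor W (G.comul (f x)) =
      f.lTensor K (H.counit.rTensor V (H.comul x)) := by
  rw [← hf.map_comul]
  generalize H.comul x = Z
  induction Z with
  | zero => simp
  | add x y hx hy => simp only [map_add, hx, hy]
  | tmul a b => simp [hf.map_counit]

theorem IsHom.map_counit_right (hf : H.IsHom G f) (x : V) :
    G.counit.lTensor W (G.comul (f x)) =
      f.rTensor K (H.counit.lTensor V (H.comul x)) := by
  rw [← hf.map_comul]
  generalize H.comul x = Z
  induction Z with
  | zero => simp
  | add x y hx hy => simp only [map_add, hx, hy]
  | tmul a b => simp [hf.map_counit]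

/-- The bialgebra axioms pass to quotients. -/
theorem IsBialgebra.of_surjective (hH : H.IsBialgebra) (hf : H.IsHom G f)
    (hs : Function.Surjective f) : G.IsBialgebra where
  mul_assoc := by
    simp only [hs.forall, ← hf.map_mul, hH.mul_assoc, implies_true]
  one_mul := by simp only [hs.forall, ← hf.map_mul, ← hf.map_one, hH.one_mul, implies_true]
  mul_one := by simp only [hs.forall, ← hf.map_mul, ← hf.map_one, hH.mul_one, implies_true]
  coassoc := by
    simp only [hs.forall, hf.map_coassoc_left, hf.map_coassoc_right, hH.coassoc, implies_true]
  counit_left := by simp [hs.forall, hf.map_counit_left, hH.counit_left]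
  counit_right := by simp [hs.forall, hf.map_counit_right, hH.counit_right]
  comul_mul := by
    simp only [hs.forall, ← hf.map_mul, ← hf.map_comul, hH.comul_mul, map_map₂ hf.map_mul,
      implies_true]
  comul_one := by rw [← hf.map_one, ← hf.map_comul, hH.comul_one, TensorProduct.map_tmul]
  counit_mul := by
    simp only [hs.forall, ← hf.map_mul, hf.map_counit, hH.counit_mul, implies_true]
  counit_one := by rw [← hf.map_one, hf.map_counit, hH.counit_one]

end transport

/-- The bialgebra axioms pass to subspaces, over a field. -/
theorem IsBialgebra.of_injective {K V W : Type*} [Field K] [AddCommGroup V] [Module K V]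
    [AddCommGroup W] [Module K W] {H : HopfData K V} {G : HopfData K W} {f : V →ₗ[K] W}
    (hG : G.IsBialgebra) (hf : H.IsHom G f) (hi : Function.Injective f) : H.IsBialgebra where
  mul_assoc x y z := hi <| by simp only [hf.map_mul, hG.mul_assoc]
  one_mul x := hi <| by rw [hf.map_mul, hf.map_one, hG.one_mul]
  mul_one x := hi <| by rw [hf.map_mul, hf.map_one, hG.mul_one]
  coassoc x := by
    -- Over a field all modules are flat, so tensor powers of an injective map remain injective and
    -- the axioms can be tested in the larger space.
    have h2 : Function.Injective (TensorProduct.map f f) := by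
      exact TensorProduct.map_injective_of_flat_flat f f hi hi
    refine TensorProduct.map_injective_of_flat_flat f _ hi h2 ?_
    rw [← hf.map_coassoc_left, ← hf.map_coassoc_right, hG.coassoc]
  counit_left x := by
    refine Module.Flat.lTensor_preserves_injective_linearMap (M := K) f hi ?_
    rw [← hf.map_counit_left, hG.counit_left, LinearMap.lTensor_tmul]
  counit_right x := by
    refine Module.Flat.rTensor_preserves_injective_linearMap (M := K) f hi ?_
    rw [← hf.map_counit_right, hG.counit_right, LinearMap.rTensor_tmul]
  comul_mul x y := by
    refine TensorProduct.map_injective_of_flat_flat f f hi hi ?_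
    rw [hf.map_comul, hf.map_mul, hG.comul_mul, map_map₂ hf.map_mul, hf.map_comul, hf.map_comul]
  comul_one := by
    refine TensorProduct.map_injective_of_flat_flat f f hi hi ?_
    rw [hf.map_comul, hf.map_one, hG.comul_one, TensorProduct.map_tmul, hf.map_one]
  counit_mul x y := by
    rw [← hf.map_counit, hf.map_mul, hG.counit_mul, hf.map_counit, hf.map_counit]
  counit_one := by rw [← hf.map_counit, hf.map_one, hG.counit_one]

theorem IsHom.comp {U : Type*} [AddCommGroup U] [Module K U] {H : HopfData K V}
    {G : HopfData K W} {F : HopfData K U} {f : V →ₗ[K] W} {g : W →ₗ[K] U} (hg : G.IsHom F g)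
    (hf : H.IsHom G f) : H.IsHom F (g ∘ₗ f) where
  map_mul x y := by simp [hf.map_mul, hg.map_mul]
  map_one := by simp [hf.map_one, hg.map_one]
  map_comul x := by
    rw [TensorProduct.map_comp, LinearMap.comp_apply, hf.map_comul, hg.map_comul]; rfl
  map_counit x := by simp [hf.map_counit, hg.map_counit]

/-- If `g ∘ f` and `f` are homomorphisms and `f` is surjective, then `g` is a homomorphism. -/
theorem IsHom.of_comp_surjective {U : Type*} [AddCommGroup U] [Module K U] {H : HopfData K V}
    {G : HopfData K W} {F : HopfData K U} {f : V →ₗ[K] W} {g : W →ₗ[K] U}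
    (h : H.IsHom F (g ∘ₗ f)) (hf : H.IsHom G f) (hs : Function.Surjective f) : G.IsHom F g where
  map_mul x y := by
    obtain ⟨x, rfl⟩ := hs x
    obtain ⟨y, rfl⟩ := hs y
    rw [← hf.map_mul]
    exact h.map_mul x y
  map_one := by
    rw [← hf.map_one]
    exact h.map_one
  map_comul x := by
    obtain ⟨x, rfl⟩ := hs x
    rw [← hf.map_comul, ← LinearMap.comp_apply, ← TensorProduct.map_comp]
    exact h.map_comul x
  map_counit x := by
    obtain ⟨x, rfl⟩ := hs x
    rw [hf.map_counit]
    exact h.map_counit x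

/-! ### Antipodes of connected graded bialgebras -/

/-- A spanning family with degrees, for which the coproduct is homogeneous and the only members of
degree zero are the unit. -/
structure IsConnected {ι : Type*} (H : HopfData K V) (b : ι → V) (deg : ι → ℕ) : Prop where
  span : ⊤ ≤ Submodule.span K (Set.range b)
  comul_mem : ∀ i, H.comul (b i) ∈
    Submodule.span K {z | ∃ j k, deg j + deg k = deg i ∧ z = b j ⊗ₜ[K] b k}
  eq_one : ∀ i, deg i = 0 → b i = H.one

theorem IsConnected.of_surjective {ι : Type*} {H : HopfData K V} {G : HopfData K W} {f : V →ₗ[K] W}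
    {b : ι → V} {deg : ι → ℕ} (h : H.IsConnected b deg) (hf : H.IsHom G f)
    (hs : Function.Surjective f) : G.IsConnected (fun i => f (b i)) deg where
  span := by
    rw [Set.range_comp' f b, ← Submodule.map_span, top_le_iff.1 h.span, Submodule.map_top,
      LinearMap.range_eq_top.2 hs]
  comul_mem i := by
    rw [← hf.map_comul]
    have := Submodule.mem_map_of_mem (f := TensorProduct.map f f) (h.comul_mem i)
    rw [Submodule.map_span] at this
    refine Submodule.span_mono ?_ this
    rintro _ ⟨_, ⟨j, k, hjk, rfl⟩, rfl⟩
    exact ⟨j, k, hjk, by simp⟩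
  eq_one i hi := by rw [h.eq_one i hi, hf.map_one]

/-- In the convolution algebra of endomorphisms put J = ηε − id. Then id = 1 − J is inverted by the
geometric series of J, which is finite on each vector since J kills degree zero. Degrees are used
only for members of the spanning family, so no direct sum decomposition is needed. -/
theorem IsBialgebra.isHopfAlgebra {ι : Type*} {H : HopfData K V} (h : H.IsBialgebra) {b : ι → V}
    {deg : ι → ℕ} (hb : H.IsConnected b deg) : H.IsHopfAlgebra := by
  let A := H.Carrier h.isMonoid
  let _ : Coalgebra K A :=
    { comul := H.comul
      counit := H.counit
      coassoc := LinearMap.ext h.coassoc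
      rTensor_counit_comp_comul := LinearMap.ext h.counit_left
      lTensor_counit_comp_comul := LinearMap.ext h.counit_right }
  let b' : ι → A := b
  let J : WithConv (A →ₗ[K] A) := 1 - WithConv.toConv LinearMap.id
  have hmem : ∀ {p : A → Prop} (_ : ∀ i, p (b' i)) (_ : p 0) (_ : ∀ x y, p x → p y → p (x + y))
      (_ : ∀ (r : K) x, p x → p (r • x)) (x : A), p x := by
    intro p h1 h2 h3 h4 x
    have hx : x ∈ Submodule.span K (Set.range b') := hb.span trivial
    induction hx using Submodule.span_induction with
    | mem x hx =>
      obtain ⟨i, rfl⟩ := hx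
      exact h1 i
    | zero => exact h2
    | add x y _ _ hx hy => exact h3 x y hx hy
    | smul r x _ hx => exact h4 r x hx
  -- Convolution products at `b' i` depend only on the values at pairs of members whose degrees add
  -- up to `deg i`.
  have hconv : ∀ (F G F' G' : WithConv (A →ₗ[K] A)) (i : ι),
      (∀ j k, deg j + deg k = deg i →
        F (b' j) * G (b' k) = F' (b' j) * G' (b' k)) → (F * G) (b' i) = (F' * G') (b' i) := by
    intro F G F' G' i hi
    rw [LinearMap.convMul_apply, LinearMap.convMul_apply]
    have hx : Coalgebra.comul (R := K) (b' i) ∈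
      Submodule.span K {z | ∃ j k, deg j + deg k = deg i ∧ z = b' j ⊗ₜ[K] b' k} := hb.comul_mem i
    generalize Coalgebra.comul (R := K) (b' i) = X at hx
    induction hx using Submodule.span_induction with
    | mem x hx =>
      obtain ⟨j, k, hjk, rfl⟩ := hx
      simpa using hi j k hjk
    | zero => simp
    | add x y _ _ hx hy => simp only [map_add, hx, hy]
    | smul r x _ hx => simp only [map_smul, hx]
  have hJ0 : ∀ i, deg i = 0 → J (b' i) = 0 := by
    intro i hi
    have h1 : b' i = 1 := hb.eq_one i hi
    have h2 : Coalgebra.counit (R := K) (1 : A) = 1 := h.counit_one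
    have h3 : J (b' i) = algebraMap K A (Coalgebra.counit (R := K) (b' i)) - b' i := rfl
    rw [h3, h1, h2, map_one, sub_self]
  have hJ : ∀ n i, deg i < n → (J ^ n) (b' i) = 0 := by
    intro n
    induction n with
    | zero => intro i hi; omega
    | succ n ih =>
      intro i hi
      rw [pow_succ', hconv J (J ^ n) 0 0 i, zero_mul]
      · rfl
      -- Either `deg j = 0` and J kills the left factor, or `deg k < n` and the power of J kills the
      -- right factor.
      · intro j k hjk
        by_cases hj : deg j = 0
        · rw [hJ0 j hj, zero_mul]
          simp
        · rw [ih k (by omega), mul_zero]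
          simp
  have hfin : ∀ x : A, (Function.support fun n => (J ^ n) x).Finite := by
    refine hmem (fun i => ?_) ?_ ?_ ?_
    · refine (Set.finite_Iic (deg i)).subset fun n hn => ?_
      by_contra hlt
      exact hn (hJ n i (by simpa using hlt))
    · simp
    · intro x y hx hy
      refine (hx.union hy).subset fun n hn => ?_
      by_contra hlt
      simp only [Set.mem_union, Function.mem_support, not_or, not_not] at hlt
      exact hn (by simp [hlt])
    · intro r x hx
      refine hx.subset fun n hn => ?_
      by_contra hlt
      simp only [Function.mem_support, not_not] at hlt
      exact hn (by simp [hlt])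
  let S : A →ₗ[K] A :=
    { toFun := fun x => ∑ᶠ n, (J ^ n) x
      map_add' := fun x y => by
        rw [← finsum_add_distrib (hfin x) (hfin y)]
        simp
      map_smul' := fun r x => by
        rw [RingHom.id_apply, smul_finsum' r (hfin x)]
        simp }
  have hsum : ∀ (N : ℕ) (x : A),
      (∑ n ∈ Finset.range N, J ^ n : WithConv (A →ₗ[K] A)) x = ∑ n ∈ Finset.range N, (J ^ n) x := by
    intro N x
    induction N with
    | zero => rfl
    | succ N ih => rw [Finset.sum_range_succ, Finset.sum_range_succ, ← ih]; rfl
  -- Any bound `N` above the degree gives the same truncation. Hence a single partial sum replaces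
  -- `S` on all terms of a coproduct at once, and then telescopes against 1 − J.
  have hS : ∀ N i, deg i < N →
      S (b' i) = (∑ n ∈ Finset.range N, J ^ n : WithConv (A →ₗ[K] A)) (b' i) := by
    intro N i hi
    rw [hsum]
    refine finsum_eq_sum_of_support_subset _ fun n hn => ?_
    by_contra hlt
    simp only [Finset.coe_range, Set.mem_Iio, not_lt] at hlt
    exact hn (hJ n i (by omega))
  have hid : WithConv.toConv LinearMap.id = 1 - J := (sub_sub_cancel _ _).symm
  have hl : ∀ x, (WithConv.toConv S * WithConv.toConv LinearMap.id : WithConv (A →ₗ[K] A)) x =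
      (1 : WithConv (A →ₗ[K] A)) x := by
    refine hmem (fun i => ?_) (by simp) (fun x y hx hy => by rw [map_add, map_add, hx, hy])
      (fun r x hx => by rw [map_smul, map_smul, hx])
    rw [hconv _ _ (∑ n ∈ Finset.range (deg i + 1), J ^ n) (WithConv.toConv LinearMap.id) i, hid,
      geom_sum_mul_neg]
    · change (1 : WithConv (A →ₗ[K] A)) (b' i) - (J ^ (deg i + 1)) (b' i) = _
      rw [hJ _ _ (Nat.lt_succ_self _), sub_zero]
    · intro j k hjk
      congr 1
      exact hS _ _ (by omega)
  have hr : ∀ x, (WithConv.toConv LinearMap.id * WithConv.toConv S : WithConv (A →ₗ[K] A)) x =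
      (1 : WithConv (A →ₗ[K] A)) x := by
    refine hmem (fun i => ?_) (by simp) (fun x y hx hy => by rw [map_add, map_add, hx, hy])
      (fun r x hx => by rw [map_smul, map_smul, hx])
    rw [hconv _ _ (WithConv.toConv LinearMap.id) (∑ n ∈ Finset.range (deg i + 1), J ^ n) i, hid,
      mul_neg_geom_sum]
    · change (1 : WithConv (A →ₗ[K] A)) (b' i) - (J ^ (deg i + 1)) (b' i) = _
      rw [hJ _ _ (Nat.lt_succ_self _), sub_zero]
    · intro j k hjk
      congr 1
      exact hS _ _ (by omega)
  have hone : ∀ x, (1 : WithConv (A →ₗ[K] A)) x = (H.counit x • H.one : V) := fun x =>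
    Algebra.algebraMap_eq_smul_one (A := A) (H.counit x)
  refine { h with exists_antipode := ⟨S, fun x => ?_, fun x => ?_⟩ }
  · exact (hl x).trans (hone x)
  · exact (hr x).trans (hone x)

end HopfData

/-! ### Verification on generators and spanning families -/

namespace HopfData

variable {K V W : Type*} [CommRing K] [AddCommGroup V] [Module K V]
  [AddCommGroup W] [Module K W]

/-- The coproduct of a word in generators is homogeneous if that of each generator is. -/
theorem isConnected_words {A : Type*} [Ring A] [Algebra K A] {H : HopfData K A}
    (Δ : A →ₐ[K] A ⊗[K] A) (hone : H.one = 1) (hΔ : H.comul = Δ.toLinearMap) {X : Type*} (g : X → A)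
    (d : X → ℕ) (hd : ∀ n, d n ≠ 0)
    (hs : ⊤ ≤ Submodule.span K (Set.range fun I : List X => (I.map g).prod))
    (hg : ∀ n, H.comul (g n) ∈ Submodule.span K {z | ∃ I J : List X,
      (I.map d).sum + (J.map d).sum = d n ∧ z = (I.map g).prod ⊗ₜ[K] (J.map g).prod}) :
    H.IsConnected (fun I : List X => (I.map g).prod) (fun I => (I.map d).sum) where
  span := hs
  comul_mem I := by
    induction I with
    | nil =>
      refine Submodule.subset_span ⟨[], [], rfl, ?_⟩
      simp [hΔ, Algebra.TensorProduct.one_def]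
    | cons n I ih =>
      have h1 : H.comul ((List.map g (n :: I)).prod) = H.comul (g n) * H.comul (I.map g).prod := by
        simp [hΔ]
      rw [h1]
      -- The coproduct is multiplicative, products of pairs of words are pairs of concatenated
      -- words, and degrees add.
      have h2 := Submodule.mul_mem_mul (hg n) ih
      rw [Submodule.span_mul_span] at h2
      refine Submodule.span_mono ?_ h2
      rintro _ ⟨_, ⟨I₁, J₁, h₁, rfl⟩, _, ⟨I₂, J₂, h₂, rfl⟩, rfl⟩
      refine ⟨I₁ ++ I₂, J₁ ++ J₂, ?_, by simp⟩
      simp only [List.map_append, List.sum_append, List.map_cons, List.sum_cons]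
      omega
  eq_one I hI := by
    cases I with
    | nil => simp [hone]
    | cons n I =>
      simp only [List.map_cons, List.sum_cons, Nat.add_eq_zero_iff] at hI
      exact absurd hI.1 (hd n)

/-- The conditions for a duality need only be checked on spanning families. -/
theorem IsDual.of_span {H : HopfData K V} {G : HopfData K W} {P : V →ₗ[K] W →ₗ[K] K}
    {ι κ : Type*} {b : ι → V} {c : κ → W} (hb : ⊤ ≤ Submodule.span K (Set.range b))
    (hc : ⊤ ≤ Submodule.span K (Set.range c))
    (mul_left : ∀ i j k, P (H.mul (b i) (b j)) (c k) = tpair P P (b i ⊗ₜ b j) (G.comul (c k)))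
    (mul_right : ∀ i j k, P (b i) (G.mul (c j) (c k)) = tpair P P (H.comul (b i)) (c j ⊗ₜ c k))
    (one_left : ∀ k, P H.one (c k) = G.counit (c k))
    (one_right : ∀ i, P (b i) G.one = H.counit (b i)) : IsDual H G P where
  mul_left x y w := by
    have h : H.mul.compr₂ P = ((TensorProduct.mk K V V).compr₂
        ((tpair P P).compl₂ G.comul)) :=
      LinearMap.ext_on_range (top_le_iff.1 hb) fun i => LinearMap.ext_on_range (top_le_iff.1 hb)
        fun j => LinearMap.ext_on_range (top_le_iff.1 hc) fun k => mul_left i j k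
    exact DFunLike.congr_fun (DFunLike.congr_fun (DFunLike.congr_fun h x) y) w
  mul_right x w z := by
    have h : G.mul.compr₂ P.flip = ((TensorProduct.mk K W W).compr₂
        ((tpair P P).flip.compl₂ H.comul)) :=
      LinearMap.ext_on_range (top_le_iff.1 hc) fun i => LinearMap.ext_on_range (top_le_iff.1 hc)
        fun j => LinearMap.ext_on_range (top_le_iff.1 hb) fun k => mul_right k i j
    exact DFunLike.congr_fun (DFunLike.congr_fun (DFunLike.congr_fun h w) z) x
  one_left w := by
    have h : P H.one = G.counit := LinearMap.ext_on_range (top_le_iff.1 hc) one_left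
    rw [h]
  one_right x := by
    have h : P.flip G.one = H.counit := LinearMap.ext_on_range (top_le_iff.1 hb) one_right
    rw [← h]
    rfl

end HopfData

/-! ### Words in a free algebra -/

section words

variable (K : Type*) [Field K]

theorem span_single (ι : Type*) :
    ⊤ ≤ Submodule.span K (Set.range fun i : ι => Finsupp.single i (1 : K)) := by
  have := (Finsupp.basisSingleOne (R := K) (ι := ι)).span_eq
  rw [Finsupp.coe_basisSingleOne] at this
  exact this.ge

@[simp]
theorem dot_single {ι : Type*} (i : ι) (r : K) (f : ι →₀ K) :
    dot K ι (Finsupp.single i r) f = r * f i := by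
  simp [dot]

theorem dot_single_right {ι : Type*} (i : ι) (r : K) (f : ι →₀ K) :
    dot K ι f (Finsupp.single i r) = f i * r := by
  classical
  induction f using Finsupp.induction_linear with
  | zero => simp
  | add f g hf hg => simp [hf, hg, add_mul]
  | single j s => simp [Finsupp.single_apply, eq_comm]

/-- `wordCoeff` as an equivalence. -/
def wordEquiv : FreeAlgebra K ℕ+ ≃ₗ[K] (List ℕ+ →₀ K) :=
  (FreeAlgebra.equivMonoidAlgebraFreeMonoid (R := K) (X := ℕ+)).toLinearEquiv.trans <|
    (MonoidAlgebra.coeffLinearEquiv K).trans <| Finsupp.domLCongr FreeMonoid.toList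

theorem wordEquiv_apply (x : FreeAlgebra K ℕ+) : wordEquiv K x = wordCoeff K x := by
  simp [wordEquiv, wordCoeff, Finsupp.domLCongr_apply, Finsupp.equivMapDomain_eq_mapDomain]

/-- The monomial in a free algebra given by a word. -/
def freeWord (I : List ℕ+) : FreeAlgebra K ℕ+ := (I.map (FreeAlgebra.ι K)).prod

theorem freeWord_append (I J : List ℕ+) :
    freeWord K (I ++ J) = freeWord K I * freeWord K J := by
  simp [freeWord]

theorem wordCoeff_freeWord (I : List ℕ+) : wordCoeff K (freeWord K I) = Finsupp.single I 1 := by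
  have h : FreeAlgebra.equivMonoidAlgebraFreeMonoid (freeWord K I) =
      MonoidAlgebra.of K (FreeMonoid ℕ+) (FreeMonoid.ofList I) := by
    induction I with
    | nil => simp [freeWord, MonoidAlgebra.one_def]
    | cons a I ih =>
      rw [freeWord, List.map_cons, List.prod_cons, map_mul]
      rw [freeWord] at ih
      rw [ih, FreeMonoid.ofList_cons, map_mul]
      congr 1
      simp [FreeAlgebra.equivMonoidAlgebraFreeMonoid]
  simp [wordCoeff, h]

theorem span_freeWord : ⊤ ≤ Submodule.span K (Set.range (freeWord K)) := by
  have h : freeWord K = fun I => (wordEquiv K).symm (Finsupp.single I 1) := by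
    ext1 I
    rw [LinearEquiv.eq_symm_apply, wordEquiv_apply, wordCoeff_freeWord]
  rw [h, Set.range_comp' (wordEquiv K).symm]
  have := Submodule.map_span (wordEquiv K).symm.toLinearMap
    (Set.range fun I : List ℕ+ => Finsupp.single I (1 : K))
  rw [top_le_iff.1 (span_single K (List ℕ+)), Submodule.map_top, LinearEquiv.range] at this
  exact this.le

end words

/-! ### Noncommutative symmetric functions -/

section NSYM

variable (K : Type*) [Field K]

/-- Both sides run over all triples with sum `n`. Applied to `z` this is coassociativity on
generators. -/
theorem sum_antidiagonal_assoc {M : Type*} [AddCommMonoid M] (n : ℕ) (f : ℕ → ℕ → ℕ → M) :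
    ∑ p ∈ Finset.HasAntidiagonal.antidiagonal n, ∑ q ∈ Finset.HasAntidiagonal.antidiagonal p.1, f q.1 q.2 p.2 =
      ∑ p ∈ Finset.HasAntidiagonal.antidiagonal n, ∑ q ∈ Finset.HasAntidiagonal.antidiagonal p.2, f p.1 q.1 q.2 := by
  rw [Finset.sum_sigma', Finset.sum_sigma']
  refine Finset.sum_nbij' (fun x => ⟨(x.2.1, x.2.2 + x.1.2), (x.2.2, x.1.2)⟩)
    (fun x => ⟨(x.1.1 + x.2.1, x.2.2), (x.1.1, x.2.1)⟩) ?_ ?_ ?_ ?_ ?_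
  · rintro ⟨⟨a, b⟩, ⟨c, d⟩⟩ h
    simp only [Finset.mem_sigma, Finset.HasAntidiagonal.mem_antidiagonal] at h ⊢
    obtain ⟨rfl, rfl⟩ := h
    simp [add_assoc]
  · rintro ⟨⟨a, b⟩, ⟨c, d⟩⟩ h
    simp only [Finset.mem_sigma, Finset.HasAntidiagonal.mem_antidiagonal] at h ⊢
    obtain ⟨rfl, rfl⟩ := h
    simp [add_assoc]
  · rintro ⟨⟨a, b⟩, ⟨c, d⟩⟩ h
    simp only [Finset.mem_sigma, Finset.HasAntidiagonal.mem_antidiagonal] at h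
    obtain ⟨-, rfl⟩ := h
    rfl
  · rintro ⟨⟨a, b⟩, ⟨c, d⟩⟩ h
    simp only [Finset.mem_sigma, Finset.HasAntidiagonal.mem_antidiagonal] at h
    obtain ⟨-, rfl⟩ := h
    rfl
  · simp

/-- The coproduct of `NSYM` as an algebra homomorphism. -/
def NSYM.Δ : NSYM K →ₐ[K] NSYM K ⊗[K] NSYM K :=
  FreeAlgebra.lift K fun n : ℕ+ =>
    ∑ i ∈ Finset.range (n + 1), NSYM.z K i ⊗ₜ[K] NSYM.z K (n - i)

theorem NSYM.comul_eq : (NSYM.hopf K).comul = (NSYM.Δ K).toLinearMap := rfl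

theorem NSYM.z_coe (n : ℕ+) : NSYM.z K n = FreeAlgebra.ι K n := by
  obtain ⟨m, hm⟩ : ∃ m, (n : ℕ) = m + 1 := ⟨n.natPred, by simp⟩
  rw [hm, NSYM.z]
  congr 1
  exact PNat.eq (by simp [hm])

/-- The convention z₀ = 1 makes the formula hold for all `n`, so that it can be iterated without
treating the outer terms of Δ zₙ separately. -/
theorem NSYM.Δ_z (n : ℕ) :
    NSYM.Δ K (NSYM.z K n) = ∑ p ∈ Finset.HasAntidiagonal.antidiagonal n, NSYM.z K p.1 ⊗ₜ[K] NSYM.z K p.2 := by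
  rcases Nat.eq_zero_or_pos n with rfl | hn
  · simp [NSYM.z, Algebra.TensorProduct.one_def]
  · lift n to ℕ+ using hn
    rw [NSYM.z_coe, NSYM.Δ, FreeAlgebra.lift_ι_apply,
      Finset.Nat.sum_antidiagonal_eq_sum_range_succ fun i j => NSYM.z K i ⊗ₜ[K] NSYM.z K j]

theorem NSYM.counit_z (n : ℕ) : (NSYM.hopf K).counit (NSYM.z K n) = if n = 0 then 1 else 0 := by
  cases n with
  | zero => simp [NSYM.z, NSYM.hopf]
  | succ n => simp [NSYM.z, NSYM.hopf]

theorem NSYM.isBialgebra : (NSYM.hopf K).IsBialgebra := by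
  refine .ofAlgHom_of_adjoin (NSYM.Δ K) (FreeAlgebra.lift K fun _ : ℕ+ => (0 : K)) rfl rfl rfl rfl
    (FreeAlgebra.adjoin_range_ι (R := K) (X := ℕ+)) ?_ ?_ ?_
  · rintro _ ⟨n, rfl⟩
    rw [← NSYM.z_coe, NSYM.comul_eq, AlgHom.toLinearMap_apply, NSYM.Δ_z]
    simp only [map_sum, LinearMap.rTensor_tmul, LinearMap.lTensor_tmul, AlgHom.toLinearMap_apply,
      NSYM.Δ_z, TensorProduct.sum_tmul, TensorProduct.tmul_sum, TensorProduct.assoc_tmul]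
    exact sum_antidiagonal_assoc n
      fun a b c => NSYM.z K a ⊗ₜ[K] (NSYM.z K b ⊗ₜ[K] NSYM.z K c)
  · rintro _ ⟨n, rfl⟩
    rw [← NSYM.z_coe, NSYM.comul_eq, AlgHom.toLinearMap_apply, NSYM.Δ_z, map_sum]
    simp only [LinearMap.rTensor_tmul, NSYM.counit_z]
    rw [Finset.sum_eq_single (0, (n : ℕ))]
    · simp
    · rintro ⟨a, b⟩ h hne
      rw [if_neg, TensorProduct.zero_tmul]
      rintro rfl
      simp_all
    · simp
  · rintro _ ⟨n, rfl⟩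
    rw [← NSYM.z_coe, NSYM.comul_eq, AlgHom.toLinearMap_apply, NSYM.Δ_z, map_sum]
    simp only [LinearMap.lTensor_tmul, NSYM.counit_z]
    rw [Finset.sum_eq_single ((n : ℕ), 0)]
    · simp
    · rintro ⟨a, b⟩ h hne
      rw [if_neg, TensorProduct.tmul_zero]
      rintro rfl
      simp_all
    · simp

theorem NSYM.z_eq_freeWord (n : ℕ) :
    ∃ I : List ℕ+, (I.map fun n : ℕ+ => (n : ℕ)).sum = n ∧ NSYM.z K n = freeWord K I := by
  rcases Nat.eq_zero_or_pos n with rfl | hn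
  · exact ⟨[], rfl, rfl⟩
  · lift n to ℕ+ using hn
    exact ⟨[n], by simp, by simp [freeWord, NSYM.z_coe]⟩

theorem NSYM.isConnected :
    (NSYM.hopf K).IsConnected (freeWord K) fun I => (I.map fun n : ℕ+ => (n : ℕ)).sum := by
  refine HopfData.isConnected_words (NSYM.Δ K) rfl rfl (FreeAlgebra.ι K) (fun n : ℕ+ => (n : ℕ))
    (fun n => n.ne_zero) (span_freeWord K) fun n => ?_
  rw [← NSYM.z_coe, NSYM.comul_eq, AlgHom.toLinearMap_apply, NSYM.Δ_z]
  refine Submodule.sum_mem _ fun p hp => Submodule.subset_span ?_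
  obtain ⟨I, hI, h1⟩ := NSYM.z_eq_freeWord K p.1
  obtain ⟨J, hJ, h2⟩ := NSYM.z_eq_freeWord K p.2
  exact ⟨I, J, by rw [hI, hJ]; exact Finset.HasAntidiagonal.mem_antidiagonal.1 hp, by rw [h1, h2]; rfl⟩

theorem NSYM.isHopfAlgebra : (NSYM.hopf K).IsHopfAlgebra :=
  (NSYM.isBialgebra K).isHopfAlgebra (NSYM.isConnected K)

end NSYM

/-! ### The enveloping algebra of the free Lie algebra -/

section ULU

variable (K : Type*) [Field K]

section

attribute [local instance 100] LieRing.ofAssociativeRing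

/-- The coproduct of the enveloping algebra as an algebra homomorphism. -/
def ULU.Δ : ULU K →ₐ[K] ULU K ⊗[K] ULU K :=
  UniversalEnvelopingAlgebra.lift K (ULU.primitive K)

/-- The counit of the enveloping algebra as an algebra homomorphism. -/
def ULU.ε : ULU K →ₐ[K] K :=
  UniversalEnvelopingAlgebra.lift K (0 : FreeLieAlgebra K ℕ+ →ₗ⁅K⁆ K)

/-- The algebra homomorphism with given values on the generators. -/
def ULU.liftGen {A : Type*} [Ring A] [Algebra K A] (g : ℕ+ → A) : ULU K →ₐ[K] A :=
  UniversalEnvelopingAlgebra.lift K (FreeLieAlgebra.lift K g)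

@[simp]
theorem ULU.liftGen_e {A : Type*} [Ring A] [Algebra K A] (g : ℕ+ → A) (n : ℕ+) :
    ULU.liftGen K g (ULU.e K n) = g n := by
  simp [ULU.liftGen, ULU.e]

theorem ULU.comul_eq : (ULU.hopf K).comul = (ULU.Δ K).toLinearMap := rfl

theorem ULU.counit_eq : (ULU.hopf K).counit = (ULU.ε K).toLinearMap := rfl

theorem ULU.Δ_e (n : ℕ+) : ULU.Δ K (ULU.e K n) = ULU.e K n ⊗ₜ[K] 1 + 1 ⊗ₜ[K] ULU.e K n := by
  rw [ULU.Δ, ULU.e, UniversalEnvelopingAlgebra.lift_ι_apply]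
  rfl

theorem ULU.ε_e (n : ℕ+) : ULU.ε K (ULU.e K n) = 0 := by
  rw [ULU.ε, ULU.e, UniversalEnvelopingAlgebra.lift_ι_apply]
  rfl

end

theorem ULU.equiv_e (n : ℕ+) :
    FreeLieAlgebra.universalEnvelopingEquivFreeAlgebra K ℕ+ (ULU.e K n) = FreeAlgebra.ι K n := by
  simp [ULU.e]

/-- The monomial in the enveloping algebra given by a word. -/
def ULU.word (I : List ℕ+) : ULU K := (I.map (ULU.e K)).prod

theorem ULU.word_append (I J : List ℕ+) : ULU.word K (I ++ J) = ULU.word K I * ULU.word K J := by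
  simp [ULU.word]

theorem ULU.word_cons (a : ℕ+) (I : List ℕ+) : ULU.word K (a :: I) = ULU.e K a * ULU.word K I := by
  simp [ULU.word]

theorem ULU.equiv_word (I : List ℕ+) :
    FreeLieAlgebra.universalEnvelopingEquivFreeAlgebra K ℕ+ (ULU.word K I) = freeWord K I := by
  rw [ULU.word, freeWord, map_list_prod, List.map_map]
  congr 2
  funext n
  exact ULU.equiv_e K n

theorem ULU.span_word : ⊤ ≤ Submodule.span K (Set.range (ULU.word K)) := by
  let E := FreeLieAlgebra.universalEnvelopingEquivFreeAlgebra K ℕ+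
  have h : ULU.word K = fun I => E.symm (freeWord K I) := by
    ext1 I
    rw [← ULU.equiv_word, AlgEquiv.symm_apply_apply]
  rw [h, Set.range_comp' E.symm]
  have := Submodule.map_span E.symm.toLinearEquiv.toLinearMap (Set.range (freeWord K))
  rw [top_le_iff.1 (span_freeWord K), Submodule.map_top, LinearEquiv.range] at this
  exact this.le

/-- The enveloping algebra of a free Lie algebra is the free algebra on the same generators, so
already the words in the generators span. -/
theorem ULU.adjoin_e : Algebra.adjoin K (Set.range (ULU.e K)) = ⊤ := by
  rw [← top_le_iff]
  intro x _
  have hx : x ∈ Submodule.span K (Set.range (ULU.word K)) := ULU.span_word K trivial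
  refine (Submodule.span_le (p := Subalgebra.toSubmodule (Algebra.adjoin K (Set.range (ULU.e K))))).2 ?_ hx
  rintro _ ⟨I, rfl⟩
  refine Subalgebra.list_prod_mem _ fun y hy => ?_
  obtain ⟨n, _, rfl⟩ := List.mem_map.1 hy
  exact Algebra.subset_adjoin ⟨n, rfl⟩

theorem ULU.isBialgebra : (ULU.hopf K).IsBialgebra := by
  have h1 : ∀ n, (ULU.hopf K).comul (ULU.e K n) = ULU.e K n ⊗ₜ[K] 1 + 1 ⊗ₜ[K] ULU.e K n :=
    ULU.Δ_e K
  have h2 : (ULU.hopf K).comul 1 = 1 ⊗ₜ[K] 1 := map_one (ULU.Δ K)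
  have h3 : ∀ n, (ULU.hopf K).counit (ULU.e K n) = 0 := ULU.ε_e K
  have h4 : (ULU.hopf K).counit 1 = 1 := map_one (ULU.ε K)
  refine .ofAlgHom_of_adjoin (ULU.Δ K) (ULU.ε K) rfl rfl rfl rfl (ULU.adjoin_e K) ?_ ?_ ?_
  · rintro _ ⟨n, rfl⟩
    simp [h1, h2, TensorProduct.add_tmul, TensorProduct.tmul_add, add_assoc]
  · rintro _ ⟨n, rfl⟩
    simp [h1, h3, h4]
  · rintro _ ⟨n, rfl⟩
    simp [h1, h3, h4]

theorem ULU.isHopfAlgebra : (ULU.hopf K).IsHopfAlgebra := by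
  -- Since all generators are primitive, each may be given degree 1; the grading is by word length.
  refine (ULU.isBialgebra K).isHopfAlgebra <| HopfData.isConnected_words (ULU.Δ K) rfl rfl
    (ULU.e K) (fun _ => 1) (fun _ => one_ne_zero) (ULU.span_word K) fun n => ?_
  rw [ULU.comul_eq, AlgHom.toLinearMap_apply, ULU.Δ_e]
  exact add_mem (Submodule.subset_span ⟨[n], [], by simp⟩)
    (Submodule.subset_span ⟨[], [n], by simp⟩)

/-! ### The shuffle algebra -/

/-- The pairing of the enveloping algebra with the space of words. -/
def pairULBilin : ULU K →ₗ[K] HU K →ₗ[K] K :=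
  ((dot K (List ℕ+)).compl₂ (wordCoeff K ∘ₗ
    (FreeLieAlgebra.universalEnvelopingEquivFreeAlgebra K ℕ+).toLinearMap)).flip

theorem pairULBilin_apply (y : ULU K) (x : HU K) : pairULBilin K y x = pairUL K x y := rfl

@[simp]
theorem pairULBilin_word (I : List ℕ+) (x : HU K) : pairULBilin K (ULU.word K I) x = x I := by
  rw [pairULBilin_apply, pairUL, ULU.equiv_word, wordCoeff_freeWord, dot_single_right, mul_one]

theorem separates_pairUL : Separates (pairULBilin K) :=
  ⟨_, Finsupp.basisSingleOne, ULU.word K, fun I x => by simp⟩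

/-- Removal of the first letter `a` (words with another first letter go to `0`). -/
def HU.removeHead (a : ℕ+) : HU K →ₗ[K] HU K :=
  Finsupp.lcomapDomain (List.cons a) (List.cons_injective)

@[simp]
theorem HU.removeHead_apply (a : ℕ+) (x : HU K) (w : List ℕ+) :
    HU.removeHead K a x w = x (a :: w) := rfl

theorem HU.removeHead_nil (a : ℕ+) (r : K) : HU.removeHead K a (Finsupp.single [] r) = 0 := by
  ext w
  simp

theorem HU.removeHead_cons (a b : ℕ+) (x : HU K) :
    HU.removeHead K a (Finsupp.lmapDomain K K (List.cons b) x) = if a = b then x else 0 := by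
  ext w
  rw [HU.removeHead_apply, Finsupp.lmapDomain_apply]
  split_ifs with h
  · subst h
    exact Finsupp.mapDomain_apply List.cons_injective x w
  · refine Finsupp.mapDomain_of_notMem_range _ _ ?_
    rintro ⟨v, hv⟩
    exact h (List.cons.inj hv).1.symm

/-- The sum of all shuffles of two words. -/
def HU.shuffle (v w : List ℕ+) : HU K := ((shuffles v w).map fun x => Finsupp.single x (1 : K)).sum

theorem HU.mul_single (v w : List ℕ+) :
    (HU.hopf K).mul (Finsupp.single v 1) (Finsupp.single w 1) = HU.shuffle K v w := by
  simp [HU.hopf, bilinExt, HU.shuffle]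

theorem HU.single_cons (a : ℕ+) (v : List ℕ+) : Finsupp.single (a :: v) (1 : K) =
    Finsupp.lmapDomain K K (List.cons a) (Finsupp.single v 1) := by
  simp

theorem HU.shuffle_cons (a b : ℕ+) (v w : List ℕ+) : HU.shuffle K (a :: v) (b :: w) =
    Finsupp.lmapDomain K K (List.cons a) (HU.shuffle K v (b :: w)) +
      Finsupp.lmapDomain K K (List.cons b) (HU.shuffle K (a :: v) w) := by
  simp only [HU.shuffle, shuffles, map_list_sum, List.map_append, List.map_map, List.sum_append,
    Function.comp_def, Finsupp.lmapDomain_apply, Finsupp.mapDomain_single]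

theorem HU.shuffle_nil (w : List ℕ+) : HU.shuffle K [] w = Finsupp.single w 1 := by
  simp [HU.shuffle, shuffles]

theorem HU.shuffle_nil_right (w : List ℕ+) : HU.shuffle K w [] = Finsupp.single w 1 := by
  cases w <;> simp [HU.shuffle, shuffles]

theorem HU.nil_mul (x : HU K) : (HU.hopf K).mul (Finsupp.single [] 1) x = x := by
  have h : (HU.hopf K).mul (Finsupp.single [] 1) = LinearMap.id := by
    ext1 w
    ext1
    simp [HU.mul_single, HU.shuffle_nil]
  rw [h, LinearMap.id_apply]

theorem HU.mul_nil (x : HU K) : (HU.hopf K).mul x (Finsupp.single [] 1) = x := by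
  have h : (HU.hopf K).mul.flip (Finsupp.single [] 1) = LinearMap.id := by
    ext1 w
    ext1
    simp [HU.mul_single, HU.shuffle_nil_right]
  exact DFunLike.congr_fun h x

/-- Removal of the first letter is a derivation for the shuffle product. -/
theorem HU.removeHead_mul (a : ℕ+) (x y : HU K) : HU.removeHead K a ((HU.hopf K).mul x y) =
    (HU.hopf K).mul (HU.removeHead K a x) y + (HU.hopf K).mul x (HU.removeHead K a y) := by
  have h : (HU.hopf K).mul.compr₂ (HU.removeHead K a) =
      (HU.hopf K).mul ∘ₗ HU.removeHead K a + (HU.hopf K).mul.compl₂ (HU.removeHead K a) := by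
    refine LinearMap.ext_on_range (top_le_iff.1 (span_single K _)) fun v =>
      LinearMap.ext_on_range (top_le_iff.1 (span_single K _)) fun w => ?_
    simp only [LinearMap.compr₂_apply, LinearMap.add_apply, LinearMap.comp_apply,
      LinearMap.compl₂_apply]
    cases v with
    | nil => rw [HU.removeHead_nil, HU.nil_mul, HU.nil_mul, map_zero, LinearMap.zero_apply, zero_add]
    | cons b v =>
      cases w with
      | nil => rw [HU.removeHead_nil, HU.mul_nil, HU.mul_nil, map_zero, add_zero]
      | cons c w =>
        rw [HU.mul_single, HU.shuffle_cons, map_add, HU.removeHead_cons, HU.removeHead_cons,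
          HU.single_cons K b, HU.removeHead_cons, HU.single_cons K c, HU.removeHead_cons,
          ← HU.single_cons, ← HU.single_cons]
        congr 1 <;> split_ifs <;> simp [HU.mul_single]
  exact DFunLike.congr_fun (DFunLike.congr_fun h x) y

theorem HU.mul_apply_nil (x y : HU K) : (HU.hopf K).mul x y [] = x [] * y [] := by
  have h : (HU.hopf K).mul.compr₂ (Finsupp.lapply []) =
      (LinearMap.mul K K).compl₁₂ (Finsupp.lapply []) (Finsupp.lapply []) := by
    refine LinearMap.ext_on_range (top_le_iff.1 (span_single K _)) fun v =>
      LinearMap.ext_on_range (top_le_iff.1 (span_single K _)) fun w => ?_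
    cases v with
    | nil => simp [HU.nil_mul]
    | cons b v =>
      cases w with
      | nil => simp [HU.mul_nil]
      | cons c w =>
        simp only [LinearMap.compr₂_apply, HU.mul_single, HU.shuffle_cons]
        simp [Finsupp.mapDomain_of_notMem_range]
  exact DFunLike.congr_fun (DFunLike.congr_fun h x) y

/-- Only the cut after `I.length` letters can produce the pair `(I, J)`: deconcatenation is the
transpose of concatenation. -/
theorem sum_single_take_drop {A : Type*} (w I J : List A) :
    ∑ s ∈ Finset.range (w.length + 1),
      Finsupp.single (w.take s) (1 : K) I * Finsupp.single (w.drop s) (1 : K) J =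
      Finsupp.single w (1 : K) (I ++ J) := by
  classical
  simp only [Finsupp.single_apply]
  by_cases h : w = I ++ J
  · rw [if_pos h, Finset.sum_eq_single I.length]
    · simp [h]
    · intro s hs hne
      rw [if_neg, zero_mul]
      intro hI
      apply hne
      rw [← hI, List.length_take]
      have := Finset.mem_range.1 hs
      omega
    · simp [h]
  · rw [if_neg h]
    refine Finset.sum_eq_zero fun s _ => ?_
    by_cases h1 : w.take s = I
    · rw [if_neg (c := w.drop s = J), mul_zero]
      rintro rfl
      exact h (by rw [← h1, List.take_append_drop])
    · rw [if_neg h1, zero_mul]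

/-- Prepending a letter and removing it are transposes of each other. This reduces statements about
words to an induction on the first letter. -/
theorem pairULBilin_e_mul (a : ℕ+) (y : ULU K) (x : HU K) :
    pairULBilin K (ULU.e K a * y) x = pairULBilin K y (HU.removeHead K a x) := by
  have h : pairULBilin K ∘ₗ LinearMap.mulLeft K (ULU.e K a) =
      (pairULBilin K).compl₂ (HU.removeHead K a) := by
    refine LinearMap.ext_on_range (top_le_iff.1 (ULU.span_word K)) fun I => ?_
    ext1 w
    ext1
    simp [← ULU.word_cons]
  exact DFunLike.congr_fun (DFunLike.congr_fun h y) x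

/-- Concatenation and deconcatenation are matched by `sum_single_take_drop`. For the shuffle
product, induct on the word: the two terms of Δ e_a = e_a ⊗ 1 + 1 ⊗ e_a transpose to the two terms
of the Leibniz rule `HU.removeHead_mul`. -/
theorem ULU.isDual : IsDual (ULU.hopf K) (HU.hopf K) (pairULBilin K) := by
  have h1 : (1 : ULU K) = ULU.word K [] := rfl
  have hmul : ∀ I x y, pairULBilin K (ULU.word K I) ((HU.hopf K).mul x y) =
      tpair (pairULBilin K) (pairULBilin K) ((ULU.hopf K).comul (ULU.word K I)) (x ⊗ₜ y) := by
    intro I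
    rw [ULU.comul_eq, AlgHom.toLinearMap_apply]
    induction I with
    | nil =>
      intro x y
      rw [← h1, map_one (ULU.Δ K), Algebra.TensorProduct.one_def, tpair_tmul, h1, pairULBilin_word,
        pairULBilin_word, pairULBilin_word, HU.mul_apply_nil]
    | cons a I ih =>
      intro x y
      have h2 : ∀ Z : ULU K ⊗[K] ULU K, tpair (pairULBilin K) (pairULBilin K)
          ((ULU.e K a ⊗ₜ[K] 1 + 1 ⊗ₜ[K] ULU.e K a) * Z) (x ⊗ₜ y) =
          tpair (pairULBilin K) (pairULBilin K) Z (HU.removeHead K a x ⊗ₜ y) +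
          tpair (pairULBilin K) (pairULBilin K) Z (x ⊗ₜ HU.removeHead K a y) := by
        intro Z
        induction Z with
        | zero => simp
        | add u v hu hv => 
          rw [mul_add, map_add, map_add, LinearMap.add_apply, hu, hv, LinearMap.add_apply,
            LinearMap.add_apply]
          abel
        | tmul u v => simp [add_mul, pairULBilin_e_mul]
      rw [ULU.word_cons, map_mul (ULU.Δ K), ULU.Δ_e, h2, ← ih, ← ih, pairULBilin_e_mul, HU.removeHead_mul,
        map_add]
  refine IsDual.of_span (ULU.span_word K) (span_single K _) ?_ (fun I v w => hmul I _ _) ?_ ?_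
  · intro I J w
    rw [show (ULU.hopf K).mul (ULU.word K I) (ULU.word K J) = ULU.word K (I ++ J) from
      (ULU.word_append K I J).symm, pairULBilin_word, ← sum_single_take_drop]
    simp [HU.hopf]
  · intro w
    exact pairULBilin_word K [] _
  · intro I
    rw [pairULBilin_word, ULU.counit_eq, AlgHom.toLinearMap_apply]
    cases I with
    | nil => exact (Finsupp.single_eq_same).trans (map_one (ULU.ε K)).symm
    | cons a I => rw [ULU.word_cons, map_mul, ULU.ε_e, zero_mul]; simp [HU.hopf]

theorem HU.isBialgebra : (HU.hopf K).IsBialgebra :=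
  (ULU.isBialgebra K).dual (ULU.isDual K) (separates_pairUL K)

theorem HU.isHopfAlgebra : (HU.hopf K).IsHopfAlgebra := by
  refine (HU.isBialgebra K).isHopfAlgebra (b := fun w => Finsupp.single w 1) (deg := List.length)
    ⟨span_single K _, fun w => ?_, fun w hw => ?_⟩
  · simp only [HU.hopf, Finsupp.linearCombination_single, one_smul]
    refine Submodule.sum_mem _ fun s hs => Submodule.subset_span ⟨w.take s, w.drop s, ?_, rfl⟩
    rw [← List.length_append, List.take_append_drop]
  · rw [List.length_eq_zero_iff.1 hw]
    rfl

end ULU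

/-! ### Exponents of monomials -/

section place

/-- Each exponent is that of a monomial with increasing indices and positive exponents. -/
theorem exists_place (m : ℕ →₀ ℕ) :
    ∃ (I : List ℕ+) (n : Fin I.length → ℕ), StrictMono n ∧ m = place n (parts I) := by
  have hm : ∀ j : Fin m.support.card, 0 < m (m.support.orderEmbOfFin rfl j) := fun j =>
    Nat.pos_of_ne_zero (Finsupp.mem_support_iff.1 (m.support.orderEmbOfFin_mem rfl j))
  let I : List ℕ+ := List.ofFn fun j => ⟨m (m.support.orderEmbOfFin rfl j), hm j⟩
  have hI : I.length = m.support.card := List.length_ofFn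
  refine ⟨I, fun j => m.support.orderEmbOfFin rfl (Fin.cast hI j), ?_, ?_⟩
  · exact (m.support.orderEmbOfFin rfl).strictMono.comp (Fin.cast_strictMono hI)
  · have h1 : ∀ j : Fin I.length, parts I j = m (m.support.orderEmbOfFin rfl (Fin.cast hI j)) := by
      intro j
      exact congrArg PNat.val (List.get_ofFn _ j)
    simp only [place, h1]
    conv_lhs => rw [← Finsupp.sum_single m]
    rw [Finsupp.sum, ← Finset.sum_coe_sort]
    symm
    exact Fintype.sum_equiv ((finCongr hI).trans (m.support.orderIsoOfFin rfl).toEquiv)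
      _ _ fun j => rfl

theorem place_apply {k : ℕ} {n : Fin k → ℕ} (hn : Function.Injective n) (i : Fin k → ℕ) (j : Fin k) :
    place n i (n j) = i j := by
  rw [place_eq, Finsupp.mapDomain_apply hn]
  rfl

theorem place_apply_ne_zero {I : List ℕ+} {n : Fin I.length → ℕ} (hn : Function.Injective n) (x : ℕ) :
    place n (parts I) x ≠ 0 ↔ x ∈ Set.range n := by
  constructor
  · intro h
    by_contra hx
    rw [place_eq] at h
    exact h (Finsupp.mapDomain_of_notMem_range _ _ hx)
  · rintro ⟨j, rfl⟩
    rw [place_apply hn]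
    exact (I.get j).ne_zero

/-- The support of the monomial is the range of the index sequence, an increasing sequence is
determined by its range, and then the exponents can be read off. -/
theorem place_strictMono_inj {I J : List ℕ+} {n : Fin I.length → ℕ} {m : Fin J.length → ℕ}
    (hn : StrictMono n) (hm : StrictMono m) (h : place n (parts I) = place m (parts J)) : I = J := by
  have hr : Set.range n = Set.range m := by
    ext x
    rw [← place_apply_ne_zero hn.injective, h, place_apply_ne_zero hm.injective]
  have hl : I.length = J.length := by
    have := congrArg Set.ncard hr
    rwa [← Set.image_univ, ← Set.image_univ, Set.ncard_image_of_injective _ hn.injective,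
      Set.ncard_image_of_injective _ hm.injective, Set.ncard_univ, Set.ncard_univ, Nat.card_fin,
      Nat.card_fin] at this
  have hnm : n = m ∘ Fin.cast hl := by
    refine hn.range_inj (hm.comp (Fin.cast_strictMono hl)) |>.1 ?_
    exact hr.trans ((finCongr hl).surjective.range_comp m).symm
  refine List.ext_get hl fun j h1 h2 => PNat.eq ?_
  have h3 := place_apply hn.injective (parts I) ⟨j, h1⟩
  rw [h, hnm, Function.comp_apply, place_apply hm.injective] at h3
  exact h3.symm

theorem place_cons {k : ℕ} (n : Fin (k + 1) → ℕ) (i : Fin (k + 1) → ℕ) :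
    place n i = Finsupp.single (n 0) (i 0) + place (n ∘ Fin.succ) (i ∘ Fin.succ) := by
  simp [place, Fin.sum_univ_succ]

end place

/-! ### Quasi-symmetric functions as the dual of NSYM -/

section QSYM

variable (K : Type*) [Field K]

theorem leadCoeff_M (I J : List ℕ+) :
    leadCoeff K J (QSYM.M K I : MvPowerSeries ℕ K) = Finsupp.single I (1 : K) J := by
  classical
  rw [Finsupp.single_apply]
  change (if _ then (1 : K) else 0) = _
  congr 1
  refine propext ⟨?_, ?_⟩
  · rintro ⟨n, hn, h⟩
    exact (place_strictMono_inj Fin.val_strictMono hn h).symm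
  · rintro rfl
    exact ⟨_, Fin.val_strictMono, rfl⟩

theorem QSYM.coeffs_apply (f : QSYM K) (I : List ℕ+) : QSYM.coeffs K f I = leadCoeff K I f.1 := rfl

@[simp]
theorem QSYM.coeffs_M (I : List ℕ+) : QSYM.coeffs K (QSYM.M K I) = Finsupp.single I 1 :=
  Finsupp.ext fun J => leadCoeff_M K I J

theorem QSYM.coeff_place {I : List ℕ+} {n : Fin I.length → ℕ} (hn : StrictMono n) (f : QSYM K) :
    MvPowerSeries.coeff (place n (parts I)) f.1 = leadCoeff K I f.1 :=
  f.2.2 _ _ _ hn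

/-- Every monomial has increasing indices once its variables are sorted, so by quasi-symmetry its
coefficient equals one of the leading coefficients. -/
theorem QSYM.coeffs_injective : Function.Injective (QSYM.coeffs K) := by
  intro f g h
  refine Subtype.ext (MvPowerSeries.ext fun m => ?_)
  obtain ⟨I, n, hn, rfl⟩ := exists_place m
  rw [QSYM.coeff_place K hn, QSYM.coeff_place K hn]
  exact DFunLike.congr_fun h I

theorem QSYM.coeffs_surjective : Function.Surjective (QSYM.coeffs K) := by
  intro x
  induction x using Finsupp.induction_linear with
  | zero => exact ⟨0, map_zero _⟩
  | add f g hf hg =>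
    obtain ⟨a, rfl⟩ := hf
    obtain ⟨b, rfl⟩ := hg
    exact ⟨a + b, map_add _ _ _⟩
  | single I r => exact ⟨r • QSYM.M K I, by simp⟩

/-- The basis of the monomial quasi-symmetric functions. -/
def QSYM.basis : Module.Basis (List ℕ+) K (QSYM K) :=
  ⟨LinearEquiv.ofBijective (QSYM.coeffs K) ⟨QSYM.coeffs_injective K, QSYM.coeffs_surjective K⟩⟩

theorem QSYM.basis_repr (f : QSYM K) : (QSYM.basis K).repr f = QSYM.coeffs K f := rfl

theorem QSYM.basis_apply (I : List ℕ+) : QSYM.basis K I = QSYM.M K I := by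
  rw [← (QSYM.basis K).repr.injective.eq_iff, Module.Basis.repr_self, QSYM.basis_repr,
    QSYM.coeffs_M]

theorem QSYM.span_M : ⊤ ≤ Submodule.span K (Set.range (QSYM.M K)) := by
  have := (QSYM.basis K).span_eq.ge
  rwa [show ⇑(QSYM.basis K) = QSYM.M K from funext (QSYM.basis_apply K)] at this

/-- The pairing of noncommutative symmetric and quasi-symmetric functions. -/
def pairNQBilin : NSYM K →ₗ[K] QSYM K →ₗ[K] K :=
  (dot K (List ℕ+)).compl₁₂ (wordCoeff K) (QSYM.coeffs K)

theorem pairNQBilin_apply (x : NSYM K) (f : QSYM K) : pairNQBilin K x f = pairNQ K x f := rfl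

theorem pairNQBilin_freeWord (I : List ℕ+) (f : QSYM K) :
    pairNQBilin K (freeWord K I) f = leadCoeff K I f.1 := by
  rw [pairNQBilin_apply, pairNQ, wordCoeff_freeWord, dot_single, one_mul, QSYM.coeffs_apply]

theorem separates_pairNQ : Separates (pairNQBilin K) :=
  ⟨_, QSYM.basis K, freeWord K, fun I f => pairNQBilin_freeWord K I f⟩

/-- The product `z_{i₁} ⋯ z_{i_k}`, where exponents may vanish. -/
def NSYM.zProd {k : ℕ} (i : Fin k → ℕ) : NSYM K := (List.ofFn fun j => NSYM.z K (i j)).prod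

theorem NSYM.zProd_succ {k : ℕ} (i : Fin (k + 1) → ℕ) :
    NSYM.zProd K i = NSYM.z K (i 0) * NSYM.zProd K (i ∘ Fin.succ) := by
  simp [NSYM.zProd, List.ofFn_succ]

theorem NSYM.zProd_parts (I : List ℕ+) : NSYM.zProd K (parts I) = freeWord K I := by
  rw [NSYM.zProd, freeWord]
  congr 1
  conv_rhs => rw [← List.ofFn_get I, List.map_ofFn]
  congr 1
  funext j
  exact NSYM.z_coe K _

/-- Vanishing exponents can be dropped on both sides at once, because x⁰ = 1 and z₀ = 1. The
inclusion of ranges is what keeps the index sequence increasing when a new first index is put in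
front. -/
theorem NSYM.exists_zProd {k : ℕ} (n : Fin k → ℕ) (hn : StrictMono n) (i : Fin k → ℕ) :
    ∃ (I : List ℕ+) (m : Fin I.length → ℕ), StrictMono m ∧ Set.range m ⊆ Set.range n ∧
      place n i = place m (parts I) ∧ NSYM.zProd K i = freeWord K I := by
  induction k with
  | zero =>
    refine ⟨[], fun j => j.elim0, fun j => j.elim0, ?_, ?_, ?_⟩
    · rintro _ ⟨j, _⟩
      exact j.elim0
    · simp [place]
    · simp [NSYM.zProd, freeWord]
  | succ k ih =>
    obtain ⟨I, m, hm, hr, hp, hz⟩ := ih (n ∘ Fin.succ) (hn.comp Fin.strictMono_succ) (i ∘ Fin.succ)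
    have hr' : Set.range m ⊆ Set.range n := hr.trans (Set.range_comp_subset_range _ _)
    rcases Nat.eq_zero_or_pos (i 0) with h0 | h0
    · refine ⟨I, m, hm, hr', ?_, ?_⟩
      · rw [place_cons, h0, Finsupp.single_zero, zero_add, hp]
      · rw [NSYM.zProd_succ, h0, hz, NSYM.z, one_mul]
    · let a : ℕ+ := ⟨i 0, h0⟩
      refine ⟨a :: I, Fin.cons (n 0) m, ?_, ?_, ?_, ?_⟩
      · intro x y
        refine Fin.cases ?_ (fun y => ?_) y
        · intro h
          exact absurd h (Fin.not_lt_zero _)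
        · refine Fin.cases ?_ (fun x => ?_) x
          · intro _
            obtain ⟨j, hj⟩ := hr ⟨y, rfl⟩
            change n 0 < m y
            rw [← hj]
            exact hn (Fin.succ_pos j)
          · intro h
            exact hm (Fin.succ_lt_succ_iff.1 h)
      · rintro _ ⟨j, rfl⟩
        refine Fin.cases ⟨0, rfl⟩ (fun j => ?_) j
        exact hr' ⟨j, rfl⟩
      · have := place_cons (k := I.length) (Fin.cons (n 0) m : Fin (I.length + 1) → ℕ)
          (parts (a :: I))
        rw [place_cons, hp]
        exact this.symm
      · rw [NSYM.zProd_succ, hz, freeWord, freeWord, List.map_cons, List.prod_cons, ← NSYM.z_coe]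
        rfl

/-- The factors in a factorization of a monomial may lack some of its variables; the pairing
therefore has to be known for exponents that may be zero. -/
theorem pairNQBilin_zProd {k : ℕ} (i : Fin k → ℕ) (f : QSYM K) :
    pairNQBilin K (NSYM.zProd K i) f = MvPowerSeries.coeff (place (fun j => (j : ℕ)) i) f.1 := by
  obtain ⟨I, m, hm, -, hp, hz⟩ := NSYM.exists_zProd K _ Fin.val_strictMono i
  rw [hz, hp, QSYM.coeff_place K hm, pairNQBilin_freeWord]

theorem sum_antidiagonal_fin_succ {M : Type*} [AddCommMonoid M] {k : ℕ} (i : Fin (k + 1) → ℕ)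
    (F : (Fin (k + 1) → ℕ) → (Fin (k + 1) → ℕ) → M) :
    ∑ p ∈ Finset.HasAntidiagonal.antidiagonal (Finsupp.equivFunOnFinite.symm i), F p.1 p.2 =
      ∑ a ∈ Finset.HasAntidiagonal.antidiagonal (i 0),
        ∑ p ∈ Finset.HasAntidiagonal.antidiagonal (Finsupp.equivFunOnFinite.symm (i ∘ Fin.succ)),
          F (Fin.cons a.1 p.1) (Fin.cons a.2 p.2) := by
  have hcons : ∀ x : Fin (k + 1) →₀ ℕ, (Fin.cons (x 0) x.tail : Fin (k + 1) → ℕ) = x := by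
    intro x
    funext j
    refine Fin.cases ?_ (fun j => ?_) j <;> simp [Finsupp.tail_apply]
  rw [← Finset.sum_product']
  refine Finset.sum_nbij' (fun p => ((p.1 0, p.2 0), (p.1.tail, p.2.tail)))
    (fun q => (Finsupp.cons q.1.1 q.2.1, Finsupp.cons q.1.2 q.2.2)) ?_ ?_ ?_ ?_ ?_
  · rintro ⟨x, y⟩ h
    rw [Finset.HasAntidiagonal.mem_antidiagonal] at h
    rw [Finset.mem_product, Finset.HasAntidiagonal.mem_antidiagonal,
      Finset.HasAntidiagonal.mem_antidiagonal]
    refine ⟨DFunLike.congr_fun h 0, Finsupp.ext fun j => ?_⟩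
    exact DFunLike.congr_fun h j.succ
  · rintro ⟨⟨a, b⟩, ⟨x, y⟩⟩ h
    rw [Finset.mem_product, Finset.HasAntidiagonal.mem_antidiagonal,
      Finset.HasAntidiagonal.mem_antidiagonal] at h
    rw [Finset.HasAntidiagonal.mem_antidiagonal]
    refine Finsupp.ext fun j => Fin.cases ?_ (fun j => ?_) j
    · simpa using h.1
    · simpa using DFunLike.congr_fun h.2 j
  · rintro ⟨x, y⟩ _
    simp
  · rintro ⟨⟨a, b⟩, ⟨x, y⟩⟩ _
    simp
  · rintro ⟨x, y⟩ _
    dsimp only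
    rw [hcons, hcons]

/-- Multiplicativity of Δ splits each exponent independently, which amounts to splitting the
exponent vector. The coefficients of a product of series have the same index set, by
`coeff_place_mul`. -/
theorem NSYM.Δ_zProd {k : ℕ} (i : Fin k → ℕ) : NSYM.Δ K (NSYM.zProd K i) =
    ∑ p ∈ Finset.HasAntidiagonal.antidiagonal (Finsupp.equivFunOnFinite.symm i),
      NSYM.zProd K p.1 ⊗ₜ[K] NSYM.zProd K p.2 := by
  induction k with
  | zero =>
    have : Finsupp.equivFunOnFinite.symm i = (0 : Fin 0 →₀ ℕ) := Subsingleton.elim _ _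
    rw [this]
    simp [NSYM.zProd, Algebra.TensorProduct.one_def]
  | succ k ih =>
    rw [NSYM.zProd_succ, map_mul, NSYM.Δ_z, ih, Finset.sum_mul_sum,
      sum_antidiagonal_fin_succ i fun x y => NSYM.zProd K x ⊗ₜ[K] NSYM.zProd K y]
    refine Finset.sum_congr rfl fun a _ => Finset.sum_congr rfl fun p _ => ?_
    rw [Algebra.TensorProduct.tmul_mul_tmul, NSYM.zProd_succ, NSYM.zProd_succ]
    rfl

/-- Products of series against Δ(z_I): both are sums over the splittings of the exponent vector `I`.
The coproduct of the M_I against products of words is concatenation against deconcatenation. -/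
theorem NSYM.isDual : IsDual (NSYM.hopf K) (QSYM.hopf K) (pairNQBilin K) := by
  refine IsDual.of_span (span_freeWord K) (QSYM.span_M K) ?_ (fun I J L => ?_) ?_ ?_
  · intro I J L
    rw [show (NSYM.hopf K).mul (freeWord K I) (freeWord K J) = freeWord K (I ++ J) from
      (freeWord_append K I J).symm, pairNQBilin_freeWord, leadCoeff_M, ← sum_single_take_drop]
    simp [QSYM.hopf, pairNQBilin_freeWord, leadCoeff_M]
  · rw [NSYM.comul_eq, AlgHom.toLinearMap_apply, ← NSYM.zProd_parts, NSYM.Δ_zProd,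
      pairNQBilin_zProd, map_sum, LinearMap.sum_apply]
    simp only [tpair_tmul, pairNQBilin_zProd]
    exact coeff_place_mul Fin.val_injective _ _ _
  · intro I
    have h1 : (NSYM.hopf K).one = freeWord K [] := rfl
    rw [h1, pairNQBilin_freeWord]
    simp [leadCoeff, QSYM.hopf, place]
  · intro I
    have h1 : (QSYM.hopf K).one = (1 : QSYM K) := rfl
    rw [h1, pairNQBilin_freeWord, leadCoeff, OneMemClass.coe_one]
    classical
    simp only [MvPowerSeries.coeff_one, ← Finsupp.degree_eq_zero_iff, degree_place]
    cases I with
    | nil => simp [parts, NSYM.hopf, freeWord]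
    | cons a I =>
      rw [if_neg]
      · simp [NSYM.hopf, freeWord]
      · simp only [Finset.sum_eq_zero_iff, Finset.mem_univ, true_implies, not_forall]
        exact ⟨⟨0, by simp⟩, a.ne_zero⟩

theorem QSYM.isBialgebra : (QSYM.hopf K).IsBialgebra :=
  (NSYM.isBialgebra K).dual (NSYM.isDual K) (separates_pairNQ K)

theorem QSYM.comul_M (I : List ℕ+) : (QSYM.hopf K).comul (QSYM.M K I) =
    ∑ s ∈ Finset.range (I.length + 1), QSYM.M K (I.take s) ⊗ₜ[K] QSYM.M K (I.drop s) := by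
  simp [QSYM.hopf]

/-- Both sides have the same leading coefficients: by duality the series 1 pairs with words as the
counit of NSYM does. -/
theorem QSYM.M_nil : QSYM.M K [] = 1 := by
  apply QSYM.coeffs_injective K
  ext J
  rw [QSYM.coeffs_M, QSYM.coeffs_apply, ← pairNQBilin_freeWord]
  refine Eq.trans ?_ ((NSYM.isDual K).one_right (freeWord K J)).symm
  cases J <;> simp [NSYM.hopf, freeWord]

theorem QSYM.isHopfAlgebra : (QSYM.hopf K).IsHopfAlgebra := by
  refine (QSYM.isBialgebra K).isHopfAlgebra (b := QSYM.M K) (deg := List.length)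
    ⟨QSYM.span_M K, fun w => ?_, fun w hw => ?_⟩
  · rw [QSYM.comul_M]
    refine Submodule.sum_mem _ fun s hs => Submodule.subset_span ⟨w.take s, w.drop s, ?_, rfl⟩
    rw [← List.length_append, List.take_append_drop]
  · rw [List.length_eq_zero_iff.1 hw, QSYM.M_nil]
    rfl

end QSYM

/-! ### Sums over lists -/

theorem list_sum_flatMap {α β M : Type*} [AddCommMonoid M] (l : List α) (f : α → List β) (g : β → M) :
    ((l.flatMap f).map g).sum = (l.map fun x => ((f x).map g).sum).sum := by
  induction l with
  | nil => rfl
  | cons a l ih => simp [List.flatMap_cons, ih]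

theorem list_sum_comm {α β M : Type*} [AddCommMonoid M] (l : List α) (m : List β) (f : α → β → M) :
    (l.map fun x => (m.map fun y => f x y).sum).sum =
      (m.map fun y => (l.map fun x => f x y).sum).sum := by
  induction l with
  | nil => simp
  | cons a l ih => simp [ih, List.sum_map_add]

theorem list_sum_mul_sum {α β M : Type*} [NonUnitalNonAssocSemiring M] (l : List α) (m : List β)
    (f : α → M) (g : β → M) :
    (l.map f).sum * (m.map g).sum = (l.map fun x => (m.map fun y => f x * g y).sum).sum := by
  simp only [List.sum_map_mul_left, List.sum_map_mul_right]

/-! ### Planar forests -/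

namespace PForest

variable {A : Type}

theorem append_nil (u : PForest A) : u.append nil = u := by
  induction u with
  | nil => rfl
  | cons a c f _ ih => rw [append, ih]

theorem append_assoc (u v w : PForest A) : (u.append v).append w = u.append (v.append w) := by
  induction u with
  | nil => rfl
  | cons a c f _ ih => rw [append, append, append, ih]

/-- The number of vertices. -/
def size : PForest A → ℕ
  | nil => 0
  | cons _ c f => size c + size f + 1

theorem size_append (u v : PForest A) : (u.append v).size = u.size + v.size := by
  induction u with
  | nil => simp [append, size]
  | cons a c f _ ih => simp only [append, size, ih]; omega

theorem size_cuts (u : PForest A) : ∀ p ∈ u.cuts, p.1.size + p.2.size = u.size := by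
  induction u with
  | nil => simp [cuts, size]
  | cons a c f hc hf =>
    intro p hp
    simp only [cuts, List.mem_flatMap, List.mem_cons, List.mem_map] at hp
    obtain ⟨q, hq, rfl | ⟨r, hr, rfl⟩⟩ := hp
    · have := hf q hq
      simp only [size]
      omega
    · have h1 := hf q hq
      have h2 := hc r hr
      simp only [size, size_append]
      omega

theorem size_splits (u : PForest A) : ∀ p ∈ u.splits, p.1.size + p.2.size = u.size := by
  induction u with
  | nil => simp [splits, size]
  | cons a c f _ hf =>
    intro p hp
    simp only [splits, List.mem_cons, List.mem_map] at hp
    obtain rfl | ⟨r, hr, rfl⟩ := hp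
    · simp [size]
    · have h2 := hf r hr
      simp only [size]
      omega

theorem eq_nil_of_size {u : PForest A} (h : u.size = 0) : u = nil := by
  cases u with
  | nil => rfl
  | cons a c f => simp [size] at h

end PForest

/-! ### Planar forests as a bialgebra -/

section HF

variable (K : Type*) [Field K]

theorem HF.mul_single (u v : PForest Unit) : (HF.hopf K).mul (Finsupp.single u 1) (Finsupp.single v 1)
    = Finsupp.single (u.append v) 1 := by
  simp [HF.hopf, bilinExt]

theorem HF.comul_single (u : PForest Unit) : (HF.hopf K).comul (Finsupp.single u 1) =
    ((u.cuts).map fun p => Finsupp.single p.1 (1 : K) ⊗ₜ[K] Finsupp.single p.2 (1 : K)).sum := by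
  simp [HF.hopf]

theorem HF.isMonoid : (HF.hopf K).IsMonoid where
  mul_assoc x y z := by
    induction x using Finsupp.induction_linear with
    | zero => simp
    | add f g hf hg => simp only [map_add, LinearMap.add_apply, hf, hg]
    | single u r =>
      induction y using Finsupp.induction_linear with
      | zero => simp
      | add f g hf hg => simp only [map_add, LinearMap.add_apply, hf, hg]
      | single v s =>
        induction z using Finsupp.induction_linear with
        | zero => simp
        | add f g hf hg => simp only [map_add, hf, hg]
        | single w t =>
          rw [← Finsupp.smul_single_one u, ← Finsupp.smul_single_one v, ← Finsupp.smul_single_one w]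
          simp only [map_smul, LinearMap.smul_apply, HF.mul_single, PForest.append_assoc]
  one_mul x := by
    induction x using Finsupp.induction_linear with
    | zero => simp
    | add f g hf hg => simp only [map_add, hf, hg]
    | single u r => simp [HF.hopf, bilinExt, PForest.append]
  mul_one x := by
    induction x using Finsupp.induction_linear with
    | zero => simp
    | add f g hf hg => simp only [map_add, LinearMap.add_apply, hf, hg]
    | single u r => simp [HF.hopf, bilinExt, PForest.append_nil]

/-- The space of planar forests as an algebra. -/
abbrev HF.Alg := (HF.hopf K).Carrier (HF.isMonoid K)

namespace HF

/-- A forest as an element of the algebra. -/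
def of (u : PForest Unit) : HF.Alg K := (Finsupp.single u 1 : HF K)

theorem of_append (u v : PForest Unit) : of K (u.append v) = of K u * of K v :=
  (HF.mul_single K u v).symm

theorem of_nil : of K .nil = 1 := rfl

theorem of_cons (a : Unit) (c f : PForest Unit) :
    of K (.cons a c f) = of K (.cons a c .nil) * of K f := by
  rw [← of_append]
  rfl

/-- The coproduct as a linear map on the algebra of planar forests. -/
def Δₗ : HF.Alg K →ₗ[K] HF.Alg K ⊗[K] HF.Alg K := (HF.hopf K).comul

/-- The counit as a linear map on the algebra of planar forests. -/
def εₗ : HF.Alg K →ₗ[K] K := (HF.hopf K).counit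

/-- Grafting to a common root. -/
def graftRoot : HF.Alg K →ₗ[K] HF.Alg K :=
  Finsupp.lmapDomain K K fun u => PForest.cons () u .nil

@[simp]
theorem graftRoot_of (u : PForest Unit) : graftRoot K (of K u) = of K (.cons () u .nil) :=
  Finsupp.mapDomain_single

theorem linearMap_ext {M : Type*} [AddCommGroup M] [Module K M] {f g : HF.Alg K →ₗ[K] M}
    (h : ∀ u, f (of K u) = g (of K u)) : f = g :=
  LinearMap.ext_on_range (v := of K) (top_le_iff.1 (span_single K _)) h

theorem Δₗ_of (u : PForest Unit) :
    Δₗ K (of K u) = ((u.cuts).map fun p => of K p.1 ⊗ₜ[K] of K p.2).sum :=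
  HF.comul_single K u

/-- For the first tree, a cut either removes it whole, or keeps its root and cuts the forest of its
branches; the other trees are cut independently. This recursion replaces the list of cuts in all
that follows. -/
theorem Δₗ_cons (a : Unit) (c f : PForest Unit) : Δₗ K (of K (.cons a c f)) =
    (of K (.cons a c .nil) ⊗ₜ[K] 1 + (graftRoot K).lTensor _ (Δₗ K (of K c))) * Δₗ K (of K f) := by
  rw [Δₗ_of, Δₗ_of, Δₗ_of, PForest.cuts, list_sum_flatMap, map_list_sum, List.map_map,
    ← List.sum_map_mul_left]
  congr 1
  refine List.map_congr_left fun q _ => ?_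
  rw [List.map_cons, List.sum_cons, add_mul, Algebra.TensorProduct.tmul_mul_tmul, one_mul,
    ← of_cons, ← List.sum_map_mul_right, List.map_map]
  congr 2
  refine List.map_congr_left fun p _ => ?_
  simp only [Function.comp_apply, LinearMap.lTensor_tmul, graftRoot_of,
    Algebra.TensorProduct.tmul_mul_tmul]
  rw [← of_append, ← of_append]
  rfl

theorem Δₗ_one : Δₗ K 1 = 1 := by
  rw [← of_nil, Δₗ_of]
  simp [PForest.cuts, of_nil, Algebra.TensorProduct.one_def]

theorem Δₗ_append (u v : PForest Unit) : Δₗ K (of K (u.append v)) = Δₗ K (of K u) * Δₗ K (of K v) := by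
  induction u with
  | nil => rw [of_nil, Δₗ_one, one_mul]; rfl
  | cons a c f _ ih => rw [PForest.append, Δₗ_cons, ih, ← mul_assoc, ← Δₗ_cons]

/-- The coproduct as an algebra homomorphism. -/
def Δ : HF.Alg K →ₐ[K] HF.Alg K ⊗[K] HF.Alg K :=
  AlgHom.ofLinearMap (Δₗ K) (Δₗ_one K) fun x y => by
    have h : (LinearMap.mul K (HF.Alg K)).compr₂ (Δₗ K) =
        (LinearMap.mul K _).compl₁₂ (Δₗ K) (Δₗ K) :=
      linearMap_ext K fun u => linearMap_ext K fun v => by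
        simp only [LinearMap.compr₂_apply, LinearMap.mul_apply', LinearMap.compl₁₂_apply,
          ← of_append, Δₗ_append]
    exact DFunLike.congr_fun (DFunLike.congr_fun h x) y

theorem εₗ_cons (a : Unit) (c f : PForest Unit) : εₗ K (of K (.cons a c f)) = 0 :=
  Finsupp.single_eq_of_ne (by simp)

theorem εₗ_nil : εₗ K (of K .nil) = 1 := Finsupp.single_eq_same

/-- The counit as an algebra homomorphism. -/
def ε : HF.Alg K →ₐ[K] K :=
  AlgHom.ofLinearMap (εₗ K) (εₗ_nil K) fun x y => by
    have h : (LinearMap.mul K (HF.Alg K)).compr₂ (εₗ K) =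
        (LinearMap.mul K _).compl₁₂ (εₗ K) (εₗ K) :=
      linearMap_ext K fun u => linearMap_ext K fun v => by
        simp only [LinearMap.compr₂_apply, LinearMap.mul_apply', LinearMap.compl₁₂_apply,
          ← of_append]
        cases u with
        | nil => rw [PForest.append, εₗ_nil, one_mul]
        | cons a c f => rw [PForest.append, εₗ_cons, εₗ_cons, zero_mul]
    exact DFunLike.congr_fun (DFunLike.congr_fun h x) y

theorem Δ_cons (a : Unit) (c f : PForest Unit) : Δ K (of K (.cons a c f)) =
    (of K (.cons a c .nil) ⊗ₜ[K] 1 + (graftRoot K).lTensor _ (Δ K (of K c))) * Δ K (of K f) :=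
  Δₗ_cons K a c f

theorem Δ_tree (a : Unit) (c : PForest Unit) : Δ K (of K (.cons a c .nil)) =
    of K (.cons a c .nil) ⊗ₜ[K] 1 + (graftRoot K).lTensor _ (Δ K (of K c)) := by
  rw [Δ_cons, of_nil, map_one, mul_one]

/-- Two algebra homomorphisms agree if, for each tree, they agree on it once they agree on the
forest of its branches. -/
theorem algHom_ext {B : Type*} [Ring B] [Algebra K B] {f g : HF.Alg K →ₐ[K] B}
    (h : ∀ a c, f (of K c) = g (of K c) → f (of K (.cons a c .nil)) = g (of K (.cons a c .nil))) :
    f = g := by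
  have h1 : ∀ u, f (of K u) = g (of K u) := by
    intro u
    induction u with
    | nil => rw [of_nil, map_one, map_one]
    | cons a c v hc hv => rw [of_cons, map_mul, map_mul, hv, h a c hc]
  exact AlgHom.toLinearMap_injective (linearMap_ext K h1)

theorem counit_left : (Algebra.TensorProduct.map (ε K) (AlgHom.id K (HF.Alg K))).comp (Δ K) =
    Algebra.TensorProduct.includeRight := by
  refine algHom_ext K fun a c hc => ?_
  rw [AlgHom.comp_apply] at hc ⊢
  have h1 : ∀ Z : HF.Alg K ⊗[K] HF.Alg K, Algebra.TensorProduct.map (ε K) (AlgHom.id K (HF.Alg K))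
      ((graftRoot K).lTensor _ Z) = (graftRoot K).lTensor K
        (Algebra.TensorProduct.map (ε K) (AlgHom.id K (HF.Alg K)) Z) := by
    intro Z
    induction Z with
    | zero => simp
    | add x y hx hy => simp only [map_add, hx, hy]
    | tmul x y => simp
  rw [Δ_tree, map_add, Algebra.TensorProduct.map_tmul, h1, hc,
    show ε K (of K (.cons a c .nil)) = 0 from εₗ_cons K a c _]
  simp

/-- The counit vanishes on every grafted tree, so only the term t ⊗ 1 of Δ t survives; no induction
hypothesis is needed, in contrast to the left counit. -/
theorem counit_right : (Algebra.TensorProduct.map (AlgHom.id K (HF.Alg K)) (ε K)).comp (Δ K) =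
    Algebra.TensorProduct.includeLeft := by
  refine algHom_ext K fun a c hc => ?_
  rw [AlgHom.comp_apply] at hc ⊢
  have h2 : (ε K).toLinearMap ∘ₗ graftRoot K = 0 := linearMap_ext K fun u => by
    rw [LinearMap.comp_apply, graftRoot_of]
    exact εₗ_cons K _ _ _
  have h1 : ∀ Z : HF.Alg K ⊗[K] HF.Alg K, Algebra.TensorProduct.map (AlgHom.id K (HF.Alg K)) (ε K)
      ((graftRoot K).lTensor _ Z) = 0 := by
    intro Z
    induction Z with
    | zero => simp
    | add x y hx hy => rw [map_add, map_add, hx, hy, add_zero]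
    | tmul x y =>
      have := DFunLike.congr_fun h2 y
      simp only [LinearMap.comp_apply, AlgHom.toLinearMap_apply, LinearMap.zero_apply] at this
      simp [this]
  rw [Δ_tree, map_add, Algebra.TensorProduct.map_tmul, h1]
  simp

/-- Let t = B⁺(c). Applying the cocycle identity twice, both sides become t ⊗ 1 ⊗ 1 + (id ⊗ B⁺)Δ(c)
⊗ 1 plus the image under id ⊗ id ⊗ B⁺ of the corresponding iterated coproduct of c. These last terms
agree by induction. -/
theorem coassoc : ((Algebra.TensorProduct.assoc K K K (HF.Alg K) (HF.Alg K) (HF.Alg K)).toAlgHom.comp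
      (Algebra.TensorProduct.map (Δ K) (AlgHom.id K (HF.Alg K)))).comp (Δ K) =
    (Algebra.TensorProduct.map (AlgHom.id K (HF.Alg K)) (Δ K)).comp (Δ K) := by
  refine algHom_ext K fun a c hc => ?_
  simp only [AlgHom.comp_apply] at hc ⊢
  let as := (Algebra.TensorProduct.assoc K K K (HF.Alg K) (HF.Alg K) (HF.Alg K)).toAlgHom
  have h1 : ∀ Z : HF.Alg K ⊗[K] HF.Alg K, as (Algebra.TensorProduct.map (Δ K) (AlgHom.id K (HF.Alg K))
      ((graftRoot K).lTensor _ Z)) = ((graftRoot K).lTensor _).lTensor _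
        (as (Algebra.TensorProduct.map (Δ K) (AlgHom.id K (HF.Alg K)) Z)) := by
    intro Z
    induction Z with
    | zero => simp
    | add x y hx hy => simp only [map_add, hx, hy]
    | tmul x y =>
      simp only [LinearMap.lTensor_tmul, Algebra.TensorProduct.map_tmul, AlgHom.id_apply]
      generalize Δ K x = X
      induction X with
      | zero => simp
      | add x y hx hy => simp only [TensorProduct.add_tmul, map_add, hx, hy]
      | tmul x z => simp [as]
  -- The cocycle identity as an equation of linear maps, so that it applies to arbitrary right
  -- tensor factors.
  have h3 : (Δ K).toLinearMap ∘ₗ graftRoot K =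
      (TensorProduct.mk K (HF.Alg K) (HF.Alg K)).flip 1 ∘ₗ graftRoot K +
        (graftRoot K).lTensor _ ∘ₗ (Δ K).toLinearMap := linearMap_ext K fun u => by
    simp only [LinearMap.comp_apply, graftRoot_of, AlgHom.toLinearMap_apply, Δ_tree,
      LinearMap.add_apply, LinearMap.flip_apply, TensorProduct.mk_apply]
  have h2 : ∀ Z : HF.Alg K ⊗[K] HF.Alg K, Algebra.TensorProduct.map (AlgHom.id K (HF.Alg K)) (Δ K)
      ((graftRoot K).lTensor _ Z) = as ((graftRoot K).lTensor _ Z ⊗ₜ 1) +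
        ((graftRoot K).lTensor _).lTensor _
        (Algebra.TensorProduct.map (AlgHom.id K (HF.Alg K)) (Δ K) Z) := by
    intro Z
    induction Z with
    | zero => simp
    | add x y hx hy =>
      simp only [map_add, TensorProduct.add_tmul, hx, hy]
      abel
    | tmul x y =>
      have := DFunLike.congr_fun h3 y
      simp only [LinearMap.comp_apply, AlgHom.toLinearMap_apply, LinearMap.add_apply,
        LinearMap.flip_apply, TensorProduct.mk_apply] at this
      simp [this, TensorProduct.tmul_add, as]
  rw [Δ_tree, map_add, map_add, map_add, h1, h2, ← hc, ← add_assoc]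
  congr 1
  rw [Algebra.TensorProduct.map_tmul, Algebra.TensorProduct.map_tmul, Δ_tree, AlgHom.id_apply,
    AlgHom.id_apply, TensorProduct.add_tmul, map_add, map_one]
  rfl

theorem isBialgebra : (HF.hopf K).IsBialgebra :=
  IsBialgebra.ofAlgHom (A := HF.Alg K) (H := HF.hopf K) (Δ K) (ε K) rfl rfl rfl rfl
    (fun x => DFunLike.congr_fun (coassoc K) x) (fun x => DFunLike.congr_fun (counit_left K) x)
    (fun x => DFunLike.congr_fun (counit_right K) x)

theorem isConnected : (HF.hopf K).IsConnected (fun u => Finsupp.single u 1) PForest.size := by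
  refine ⟨span_single K _, fun u => ?_, fun u hu => ?_⟩
  · rw [comul_single]
    refine list_sum_mem fun z hz => ?_
    obtain ⟨p, hp, rfl⟩ := List.mem_map.1 hz
    exact Submodule.subset_span ⟨p.1, p.2, PForest.size_cuts u p hp, rfl⟩
  · rw [PForest.eq_nil_of_size hu]
    rfl

theorem isHopfAlgebra : (HF.hopf K).IsHopfAlgebra :=
  (isBialgebra K).isHopfAlgebra (isConnected K)

end HF

end HF

/-! ### The Hopf algebra of planar trees -/

namespace PForest

variable {A : Type} {M : Type*}

open Classical in
/-- The indicator of equality. -/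
def ind (M : Type*) [Semiring M] {ι : Type*} (x y : ι) : M := if x = y then 1 else 0

theorem ind_def [Semiring M] {ι : Type*} [DecidableEq ι] (x y : ι) :
    ind M x y = if x = y then 1 else 0 := by
  rw [ind]
  congr

@[simp]
theorem ind_self [Semiring M] {ι : Type*} (x : ι) : ind M x x = 1 := if_pos rfl

theorem ind_cons [CommSemiring M] (a b : A) (c d f g : PForest A) :
    ind M (cons a c f) (cons b d g) = ind M a b * (ind M c d * ind M f g) := by
  classical
  simp only [ind_def, cons.injEq, mul_ite, mul_one, mul_zero, ← ite_and]
  congr 1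
  simp only [eq_iff_iff]
  tauto

@[simp]
theorem ind_cons_nil [CommSemiring M] (a : A) (c f : PForest A) : ind M (cons a c f) nil = 0 :=
  if_neg (by simp)

@[simp]
theorem ind_nil_cons [CommSemiring M] (a : A) (c f : PForest A) : ind M nil (cons a c f) = 0 :=
  if_neg (by simp)

theorem ind_comm [CommSemiring M] {ι : Type*} (x y : ι) : ind M x y = ind M y x := by
  classical
  simp only [ind_def, eq_comm]

/-- The splittings of a forest are the pairs whose juxtaposition is the forest. -/
theorem sum_splits [CommSemiring M] (u f g : PForest A) :
    ((u.splits).map fun p => ind M p.1 f * ind M p.2 g).sum = ind M u (f.append g) := by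
  induction u generalizing f with
  | nil =>
    cases f with
    | nil => simp [splits, append]
    | cons b d f => simp [splits, append]
  | cons a c u _ ih =>
    cases f with
    | nil => simp [splits, append, Function.comp_def]
    | cons b d f =>
      simp only [splits, append, List.map_cons, List.sum_cons, List.map_map, Function.comp_def,
        ind_cons, ind_nil_cons, zero_mul, zero_add, mul_assoc, List.sum_map_mul_left, ih]

/-- The number of cuts of `u` with given parts. -/
def cutCount (M : Type*) [CommSemiring M] (f g u : PForest A) : M :=
  ((u.cuts).map fun p => ind M p.1 f * ind M p.2 g).sum

/-- The multiplicity of `u` among the graftings of `f` to `g`. -/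
def graftCount (M : Type*) [CommSemiring M] (f g u : PForest A) : M :=
  ((f.graft g).map fun w => ind M w u).sum

/-- Nothing remains only if all trees are pruned whole. This is the case of grafting onto the bare
root. -/
theorem cutCount_nil [CommSemiring M] (f u : PForest A) : cutCount M f nil u = ind M u f := by
  induction u generalizing f with
  | nil => simp [cutCount, cuts]
  | cons b d e _ ih =>
    simp only [cutCount, cuts, list_sum_flatMap, List.map_cons, List.sum_cons, List.map_map,
      Function.comp_def, ind_cons_nil, mul_zero, List.sum_map_zero, add_zero]
    cases f with
    | nil => simp
    | cons a c f =>
      simp only [ind_cons, mul_assoc, List.sum_map_mul_left, ← ih f]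
      rfl

/-- Grafting undoes pruning: placing the trees of `f` in the gaps of the bracket word of `g` so as
to obtain `u` corresponds to a cut of `u` with pruned part `f` and remainder `g`. Induct on `u`,
according to whether the first tree of `u` is a tree of `f` or contains the first root of `g`. -/
theorem graftCount_eq_cutCount [CommSemiring M] (f g u : PForest A) :
    graftCount M f g u = cutCount M f g u := by
  induction u generalizing f g with
  | nil =>
    cases g with
    | nil => rw [cutCount_nil]; simp [graftCount, graft, ind_comm]
    | cons a c g =>
      simp only [graftCount, cutCount, graft, cuts, list_sum_flatMap, List.map_map,
        Function.comp_def, List.map_cons, List.map_nil, ind_nil_cons, mul_zero, List.sum_cons,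
        List.sum_nil, add_zero]
      refine List.sum_eq_zero fun x hx => ?_
      obtain ⟨p, _, rfl⟩ := List.mem_map.1 hx
      cases p.1 <;> simp [append]
  | cons b d e hd he =>
    cases g with
    | nil => rw [cutCount_nil]; simp [graftCount, graft, ind_comm]
    | cons a c g =>
      -- The first tree is either pruned whole or keeps its root. In the second case the splittings
      -- of `f` record which trees were pruned from `d` and which from `e`.
      have hC : cutCount M f (cons a c g) (cons b d e) =
          ((cuts e).map fun q => ind M (cons b d q.1) f * ind M q.2 (cons a c g)).sum +
          ind M b a * ((splits f).map fun s => cutCount M s.1 c d * cutCount M s.2 g e).sum := by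
        simp only [cutCount, cuts, list_sum_flatMap, List.map_cons, List.sum_cons, List.map_map,
          Function.comp_def, List.sum_map_add]
        congr 1
        have hL : ∀ q p : PForest A × PForest A, ind M (p.1.append q.1) f *
            ind M (cons b p.2 q.2) (cons a c g) = ((splits f).map fun s => ind M b a *
              (ind M p.1 s.1 * ind M p.2 c * (ind M q.1 s.2 * ind M q.2 g))).sum := by
          intro q p
          rw [ind_comm, ← sum_splits, ind_cons, ← List.sum_map_mul_right]
          refine congrArg List.sum (List.map_congr_left fun s _ => ?_)
          rw [ind_comm s.1, ind_comm s.2]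
          ring
        simp only [hL, list_sum_mul_sum]
        refine ((list_sum_comm _ _ _).trans <| Eq.trans (congrArg List.sum <|
          List.map_congr_left fun p _ => list_sum_comm _ _ _) (list_sum_comm _ _ _)).trans ?_
        simp only [List.sum_map_mul_left]
      have hG : graftCount M f (cons a c g) (cons b d e) =
          ((splits f).map fun p => ((splits p.2).map fun q => ((graft q.1 c).map fun x =>
            ((graft q.2 g).map fun y => ind M (append p.1 (cons a x y)) (cons b d e)).sum).sum).sum).sum := by
        simp only [graftCount, graft, list_sum_flatMap, List.map_map, Function.comp_def]
      -- Nothing is placed before the first tree of the second forest, so its root is the first root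
      -- of the result, and the two induction hypotheses apply inside and after it.
      have h0 : ∀ q : PForest A × PForest A, ((graft q.1 c).map fun x =>
            ((graft q.2 g).map fun y => ind M (append nil (cons a x y)) (cons b d e)).sum).sum =
            ind M b a * (cutCount M q.1 c d * cutCount M q.2 g e) := by
        intro q
        rw [← hd, ← he, graftCount, graftCount, list_sum_mul_sum]
        simp only [append, ind_cons, List.sum_map_mul_left, ind_comm b a]
      rw [hC, hG]
      cases f with
      | nil =>
        simp only [splits, List.map_cons, List.map_nil, List.sum_cons, List.sum_nil, add_zero, h0,
          ind_cons_nil, zero_mul, List.sum_map_zero, zero_add]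
      | cons b' d' f' =>
        -- Something is placed in front: the first tree of the result is that of `f`, and the rest
        -- is a grafting of `f'` to the same forest.
        have h1 := he f' (cons a c g)
        simp only [graftCount, graft, list_sum_flatMap, List.map_map, Function.comp_def] at h1
        rw [splits, List.map_cons, List.sum_cons]
        simp only [h0, List.sum_map_mul_left]
        rw [add_comm]
        congr 1
        simp only [List.map_map, Function.comp_def, append, ind_cons, List.sum_map_mul_left, h1]
        simp only [cutCount, mul_assoc, List.sum_map_mul_left, ind_comm b b', ind_comm d d']

end PForest

/-! ### Duality of planar forests and planar trees -/

section HP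

variable (K : Type*) [Field K]

theorem PTree.branches_injective : Function.Injective PTree.branches := by
  rintro ⟨u⟩ ⟨v⟩ h
  exact congrArg _ h

/-- The pairing of planar forests and planar trees. -/
def pairFPBilin : HF K →ₗ[K] HP K →ₗ[K] K :=
  (dot K (PForest Unit)).compl₂ (Finsupp.lmapDomain K K PTree.branches)

theorem pairFPBilin_apply (x : HF K) (t : HP K) : pairFPBilin K x t = pairFP K x t := rfl

theorem pairFPBilin_single (u : PForest Unit) (t : HP K) :
    pairFPBilin K (Finsupp.single u 1) t = t ⟨u⟩ := by
  rw [pairFPBilin_apply, pairFP, dot_single, one_mul, Finsupp.lmapDomain_apply]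
  exact Finsupp.mapDomain_apply PTree.branches_injective t ⟨u⟩

theorem pairFPBilin_single_right (x : HF K) (u : PForest Unit) :
    pairFPBilin K x (Finsupp.single ⟨u⟩ 1) = x u := by
  rw [pairFPBilin_apply, pairFP, Finsupp.lmapDomain_apply, Finsupp.mapDomain_single,
    dot_single_right, mul_one]

theorem separates_pairFP : Separates (pairFPBilin K) :=
  ⟨_, Finsupp.basisSingleOne, fun t => Finsupp.single t.branches 1, fun t x => by
    simp [pairFPBilin_single]⟩

theorem HP.mul_single (f g : PForest Unit) :
    (HP.hopf K).mul (Finsupp.single ⟨f⟩ 1) (Finsupp.single ⟨g⟩ 1) =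
      ((f.graft g).map fun w => Finsupp.single (⟨w⟩ : PTree) (1 : K)).sum := by
  simp [HP.hopf, bilinExt]

theorem HP.comul_single (f : PForest Unit) :
    (HP.hopf K).comul (Finsupp.single ⟨f⟩ 1) = ((f.splits).map fun p =>
      Finsupp.single (⟨p.1⟩ : PTree) (1 : K) ⊗ₜ[K] Finsupp.single (⟨p.2⟩ : PTree) (1 : K)).sum := by
  simp [HP.hopf]

theorem PForest.single_apply (u v : PForest Unit) :
    Finsupp.single u (1 : K) v = PForest.ind K u v := by
  classical
  rw [Finsupp.single_apply, PForest.ind_def]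

theorem HP.single_apply (u v : PForest Unit) :
    Finsupp.single (⟨u⟩ : PTree) (1 : K) ⟨v⟩ = PForest.ind K u v := by
  classical
  simp [Finsupp.single_apply, PForest.ind_def]

theorem HF.isDual : IsDual (HF.hopf K) (HP.hopf K) (pairFPBilin K) := by
  refine IsDual.of_span (span_single K _) (span_single K _) ?_ ?_ ?_ ?_
  · rintro u v ⟨w⟩
    rw [HF.mul_single, pairFPBilin_single, HP.comul_single, HP.single_apply, ← PForest.sum_splits,
      map_list_sum, List.map_map]
    refine congrArg List.sum (List.map_congr_left fun p _ => ?_)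
    simp only [Function.comp_apply, tpair_tmul, pairFPBilin_single, HP.single_apply]
  · rintro u ⟨f⟩ ⟨g⟩
    rw [HP.mul_single, HF.comul_single, map_list_sum (pairFPBilin K _), List.map_map]
    refine Eq.trans (b := PForest.graftCount K f g u) ?_ ?_
    · refine congrArg List.sum (List.map_congr_left fun w _ => ?_)
      simp only [Function.comp_apply, pairFPBilin_single, HP.single_apply]
    · rw [PForest.graftCount_eq_cutCount, ← LinearMap.flip_apply (tpair _ _), map_list_sum, List.map_map]
      refine congrArg List.sum (List.map_congr_left fun p _ => ?_)
      simp only [Function.comp_apply, LinearMap.flip_apply, tpair_tmul, pairFPBilin_single_right,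
        PForest.single_apply]
  · intro t
    exact pairFPBilin_single K _ _
  · intro u
    exact pairFPBilin_single_right K _ _

theorem HP.isBialgebra : (HP.hopf K).IsBialgebra :=
  (HF.isBialgebra K).dual (HF.isDual K) (separates_pairFP K)

theorem HP.isHopfAlgebra : (HP.hopf K).IsHopfAlgebra := by
  refine (HP.isBialgebra K).isHopfAlgebra (b := fun t => Finsupp.single t 1)
    (deg := fun t => t.branches.size) ⟨span_single K _, fun ⟨u⟩ => ?_, fun ⟨u⟩ hu => ?_⟩
  · rw [HP.comul_single]
    refine list_sum_mem fun z hz => ?_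
    obtain ⟨p, hp, rfl⟩ := List.mem_map.1 hz
    exact Submodule.subset_span ⟨⟨p.1⟩, ⟨p.2⟩, PForest.size_splits u p hp, rfl⟩
  · cases PForest.eq_nil_of_size hu
    rfl

end HP

/-! ### The Connes-Kreimer Hopf algebra -/

namespace PForest

variable {A : Type}

theorem Equiv.append_left {u u' : PForest A} (h : Equiv u u') (v : PForest A) :
    Equiv (u.append v) (u'.append v) := by
  induction h with
  | nil => exact .refl _
  | cons a hc _ _ hf => exact .cons a hc hf
  | swap a b c d f => exact .swap a b c d _
  | trans _ _ h₁ h₂ => exact .trans h₁ h₂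

theorem Equiv.append_right (u : PForest A) {v v' : PForest A} (h : Equiv v v') :
    Equiv (u.append v) (u.append v') := by
  induction u with
  | nil => exact h
  | cons a c f _ hf => exact .cons a (.refl c) hf

theorem Equiv.append_cons (a : A) (c u v : PForest A) :
    Equiv (PForest.cons a c (u.append v)) (u.append (PForest.cons a c v)) := by
  induction u with
  | nil => exact .refl _
  | cons b d f _ hf => exact .trans (.swap a b c d _) (.cons b (.refl d) hf)

theorem Equiv.append_comm (u v : PForest A) : Equiv (u.append v) (v.append u) := by
  induction u with
  | nil => rw [append_nil]; exact .refl _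
  | cons a c f _ hf => exact .trans (.cons a (.refl c) hf) (.append_cons a c v f)

end PForest

theorem RForest.mk_eq_iff {u v : PForest Unit} : RForest.mk u = RForest.mk v ↔ u.Equiv v :=
  Quotient.eq (r := PForest.setoid Unit)

@[simp]
theorem RForest.mk_rep (u : RForest) : RForest.mk u.rep = u := Quotient.out_eq u

theorem RForest.rep_mk (u : PForest Unit) : (RForest.mk u).rep.Equiv u :=
  RForest.mk_eq_iff.1 (RForest.mk_rep _)

section HCK

variable (K : Type*) [Field K]

namespace HCK

/-- The map that forgets the planar structure. -/
def forget : HF K →ₗ[K] HCK K := Finsupp.lmapDomain K K RForest.mk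

@[simp]
theorem forget_single (u : PForest Unit) :
    forget K (Finsupp.single u 1) = Finsupp.single (RForest.mk u) 1 :=
  Finsupp.mapDomain_single

theorem forget_surjective : Function.Surjective (forget K) :=
  Finsupp.mapDomain_surjective fun u => ⟨u.rep, u.mk_rep⟩

theorem mul_single (u v : PForest Unit) : (HCK.hopf K).mul (Finsupp.single (RForest.mk u) 1)
    (Finsupp.single (RForest.mk v) 1) = Finsupp.single (RForest.mk (u.append v)) 1 := by
  simp only [HCK.hopf, bilinExt, Finsupp.linearCombination_single, one_smul]
  congr 1
  exact RForest.mk_eq_iff.2 (((RForest.rep_mk u).append_left _).trans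
    (.append_right u (RForest.rep_mk v)))

theorem forget_mul (x y : HF K) :
    forget K ((HF.hopf K).mul x y) = (HCK.hopf K).mul (forget K x) (forget K y) := by
  have h : (HF.hopf K).mul.compr₂ (forget K) = (HCK.hopf K).mul.compl₁₂ (forget K) (forget K) :=
    LinearMap.ext_on_range (top_le_iff.1 (span_single K _)) fun u =>
      LinearMap.ext_on_range (top_le_iff.1 (span_single K _)) fun v => by
        simp only [LinearMap.compr₂_apply, LinearMap.compl₁₂_apply, HF.mul_single, forget_single,
          mul_single]
  exact DFunLike.congr_fun (DFunLike.congr_fun h x) y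

theorem forget_one : forget K (HF.hopf K).one = (HCK.hopf K).one := forget_single K _

theorem isMonoid : (HCK.hopf K).IsMonoid := by
  have hs := forget_surjective K
  refine ⟨?_, ?_, ?_⟩
  · simp only [hs.forall, ← forget_mul, (HF.isMonoid K).mul_assoc, implies_true]
  · simp only [hs.forall, ← forget_mul, ← forget_one, (HF.isMonoid K).one_mul, implies_true]
  · simp only [hs.forall, ← forget_mul, ← forget_one, (HF.isMonoid K).mul_one, implies_true]

/-- The space of non-planar forests as an algebra. -/
abbrev Alg := (HCK.hopf K).Carrier (isMonoid K)

/-- A forest as an element of the algebra. -/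
def of (u : RForest) : Alg K := (Finsupp.single u 1 : HCK K)

theorem of_append (u v : PForest Unit) :
    of K (RForest.mk (u.append v)) = of K (RForest.mk u) * of K (RForest.mk v) :=
  (mul_single K u v).symm

theorem mul_comm' (x y : Alg K) : x * y = y * x := by
  have h : LinearMap.mul K (Alg K) = (LinearMap.mul K (Alg K)).flip :=
    LinearMap.ext_on_range (v := of K) (top_le_iff.1 (span_single K _)) fun u =>
      LinearMap.ext_on_range (v := of K) (top_le_iff.1 (span_single K _)) fun v => by
        rw [LinearMap.flip_apply, LinearMap.mul_apply', LinearMap.mul_apply', ← u.mk_rep,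
          ← v.mk_rep, ← of_append, ← of_append, RForest.mk_eq_iff.2 (.append_comm _ _)]
  exact DFunLike.congr_fun (DFunLike.congr_fun h x) y

theorem mul_comm_tensor (X Y : Alg K ⊗[K] Alg K) : X * Y = Y * X := by
  induction X with
  | zero => simp
  | add x y hx hy => rw [add_mul, mul_add, hx, hy]
  | tmul a b =>
    induction Y with
    | zero => simp
    | add x y hx hy => rw [add_mul, mul_add, hx, hy]
    | tmul c d => rw [Algebra.TensorProduct.tmul_mul_tmul, Algebra.TensorProduct.tmul_mul_tmul,
        mul_comm' K a, mul_comm' K b]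

/-- `forget` as an algebra homomorphism. -/
def forgetAlg : HF.Alg K →ₐ[K] Alg K :=
  AlgHom.ofLinearMap (forget K) (forget_one K) (forget_mul K)

theorem forgetAlg_of (u : PForest Unit) : forgetAlg K (HF.of K u) = of K (RForest.mk u) :=
  forget_single K u

/-- Grafting of a non-planar forest to a common root. -/
def graftRoot : Alg K →ₗ[K] Alg K :=
  Finsupp.lmapDomain K K (Quotient.map (fun u => PForest.cons () u .nil) fun _ _ h => .cons () h .nil)

theorem graftRoot_of (u : PForest Unit) :
    graftRoot K (of K (RForest.mk u)) = of K (RForest.mk (.cons () u .nil)) :=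
  Finsupp.mapDomain_single

/-- The cuts of a planar forest, as an element of the tensor square of the algebra of non-planar
forests. -/
def cutSum (u : PForest Unit) : Alg K ⊗[K] Alg K :=
  Algebra.TensorProduct.map (forgetAlg K) (forgetAlg K) (HF.Δ K (HF.of K u))

theorem cutSum_eq (u : PForest Unit) : cutSum K u =
    ((u.cuts).map fun p => of K (RForest.mk p.1) ⊗ₜ[K] of K (RForest.mk p.2)).sum := by
  rw [cutSum, show HF.Δ K (HF.of K u) = _ from HF.Δₗ_of K u, map_list_sum, List.map_map]
  refine congrArg List.sum (List.map_congr_left fun p _ => ?_)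
  rw [Function.comp_apply, Algebra.TensorProduct.map_tmul, forgetAlg_of, forgetAlg_of]

theorem cutSum_cons (a : Unit) (c f : PForest Unit) : cutSum K (.cons a c f) =
    (of K (RForest.mk (.cons a c .nil)) ⊗ₜ[K] 1 + (graftRoot K).lTensor _ (cutSum K c)) *
      cutSum K f := by
  have h1 : (forgetAlg K).toLinearMap ∘ₗ HF.graftRoot K = graftRoot K ∘ₗ (forgetAlg K).toLinearMap :=
    HF.linearMap_ext K fun u => by
      simp only [LinearMap.comp_apply, HF.graftRoot_of, AlgHom.toLinearMap_apply, forgetAlg_of,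
        graftRoot_of]
  have h2 : ∀ Z : HF.Alg K ⊗[K] HF.Alg K, Algebra.TensorProduct.map (forgetAlg K) (forgetAlg K)
      ((HF.graftRoot K).lTensor _ Z) =
      (graftRoot K).lTensor _ (Algebra.TensorProduct.map (forgetAlg K) (forgetAlg K) Z) := by
    intro Z
    induction Z with
    | zero => simp
    | add x y hx hy => simp only [map_add, hx, hy]
    | tmul x y =>
      have := DFunLike.congr_fun h1 y
      simp only [LinearMap.comp_apply, AlgHom.toLinearMap_apply] at this
      simp [this]
  rw [cutSum, HF.Δ_cons, map_mul, map_add, Algebra.TensorProduct.map_tmul, h2, forgetAlg_of,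
    map_one]
  rfl

/-- By the recursion each tree contributes a factor to the sum over cuts. These factors commute in
the tensor square of a commutative algebra, so neighbouring trees may be interchanged. -/
theorem cutSum_congr {u v : PForest Unit} (h : u.Equiv v) : cutSum K u = cutSum K v := by
  induction h with
  | nil => rfl
  | cons a hc hf h₁ h₂ =>
    rw [cutSum_cons, cutSum_cons, h₁, h₂, RForest.mk_eq_iff.2 (.cons a hc .nil)]
  | swap a b c d f =>
    rw [cutSum_cons, cutSum_cons, cutSum_cons, cutSum_cons, ← mul_assoc, ← mul_assoc,
      mul_comm_tensor K (_ + _)]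
  | trans _ _ h₁ h₂ => rw [h₁, h₂]

theorem isHom_forget : (HF.hopf K).IsHom (HCK.hopf K) (forget K) where
  map_mul := forget_mul K
  map_one := forget_one K
  map_comul x := by
    have h : TensorProduct.map (forget K) (forget K) ∘ₗ (HF.hopf K).comul =
        (HCK.hopf K).comul ∘ₗ forget K :=
      LinearMap.ext_on_range (top_le_iff.1 (span_single K _)) fun u => by
        rw [LinearMap.comp_apply, LinearMap.comp_apply, forget_single]
        refine Eq.trans (b := cutSum K u) rfl ?_
        -- The coproduct is defined by the cuts of a chosen planar representative; the choice does
        -- not matter.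
        rw [← cutSum_congr K (RForest.rep_mk u), cutSum_eq]
        simp [HCK.hopf]
        rfl
    exact DFunLike.congr_fun h x
  map_counit x := by
    have h : (HCK.hopf K).counit ∘ₗ forget K = (HF.hopf K).counit :=
      LinearMap.ext_on_range (top_le_iff.1 (span_single K _)) fun u => by
        rw [LinearMap.comp_apply, forget_single]
        cases u with
        | nil => simp [HCK.hopf, HF.hopf]
        | cons a c f =>
          refine (Finsupp.single_eq_of_ne ?_).trans (Finsupp.single_eq_of_ne (by simp)).symm
          intro h
          have hne : ∀ {u v : PForest Unit}, u.Equiv v → u = .nil → v = .nil := by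
            intro u v h
            induction h with
            | nil => exact id
            | cons => simp
            | swap => simp
            | trans _ _ h₁ h₂ => exact h₂ ∘ h₁
          exact absurd (hne (RForest.mk_eq_iff.1 h) rfl) (by simp)
    exact DFunLike.congr_fun h x

theorem isBialgebra : (HCK.hopf K).IsBialgebra :=
  (HF.isBialgebra K).of_surjective (isHom_forget K) (forget_surjective K)

theorem isHopfAlgebra : (HCK.hopf K).IsHopfAlgebra :=
  (isBialgebra K).isHopfAlgebra
    ((HF.isConnected K).of_surjective (isHom_forget K) (forget_surjective K))

end HCK

end HCK

/-- A linear map from an algebra that respects products respects the coproducts if it does so on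
generators. -/
theorem HopfData.IsHom.of_adjoin {K A W : Type*} [CommRing K] [Ring A] [Algebra K A]
    [AddCommGroup W] [Module K W] {H : HopfData K A} {G : HopfData K W} {f : A →ₗ[K] W}
    (hH : H.IsBialgebra) (hG : G.IsBialgebra) (hmul : H.mul = LinearMap.mul K A) (hone : H.one = 1)
    (map_mul : ∀ x y, f (x * y) = G.mul (f x) (f y)) (map_one : f 1 = G.one)
    {s : Set A} (hs : Algebra.adjoin K s = ⊤)
    (map_comul : ∀ x ∈ s, TensorProduct.map f f (H.comul x) = G.comul (f x))
    (map_counit : ∀ x ∈ s, G.counit (f x) = H.counit x) : H.IsHom G f := by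
  have hm : ∀ x y, f (H.mul x y) = G.mul (f x) (f y) := by
    rw [hmul]
    exact map_mul
  have h1 : f H.one = G.one := by rw [hone, map_one]
  have h2 : ∀ x y, x * y = H.mul x y := by
    rw [hmul]
    exact fun _ _ => rfl
  refine ⟨hm, h1, fun x => ?_, fun x => ?_⟩
  · have hx : x ∈ Algebra.adjoin K s := hs ▸ trivial
    induction hx using Algebra.adjoin_induction with
    | mem x hx => exact map_comul x hx
    | algebraMap r =>
      rw [Algebra.algebraMap_eq_smul_one, ← hone]
      simp only [map_smul, h1, hH.comul_one, hG.comul_one, TensorProduct.map_tmul]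
    | add x y _ _ hx hy => simp only [map_add, hx, hy]
    | mul x y _ _ hx hy =>
      rw [h2, hm, hH.comul_mul, hG.comul_mul, map_map₂ hm, hx, hy]
  · have hx : x ∈ Algebra.adjoin K s := hs ▸ trivial
    induction hx using Algebra.adjoin_induction with
    | mem x hx => exact map_counit x hx
    | algebraMap r =>
      rw [Algebra.algebraMap_eq_smul_one, ← hone]
      simp only [map_smul, h1, hH.counit_one, hG.counit_one]
    | add x y _ _ hx hy => simp only [map_add, hx, hy]
    | mul x y _ _ hx hy => rw [h2, hm, hH.counit_mul, hG.counit_mul, hx, hy]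

/-! ### Symmetric functions -/

section content

/-- The multiset of the nonzero exponents of a monomial. -/
def content {σ : Type*} (m : σ →₀ ℕ) : Multiset ℕ := m.support.val.map m

theorem content_place {I : List ℕ+} {n : Fin I.length → ℕ} (hn : Function.Injective n) :
    content (place n (parts I)) = (I.map fun a : ℕ+ => (a : ℕ) : List ℕ) := by
  have h1 : (place n (parts I)).support = Finset.univ.map ⟨n, hn⟩ := by
    ext x
    simp [Finsupp.mem_support_iff, place_apply_ne_zero hn]
  have h2 : I.map (fun a : ℕ+ => (a : ℕ)) = List.ofFn (parts I) := by
    conv_lhs => rw [← List.ofFn_get I, List.map_ofFn]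
    rfl
  rw [content, h1, Finset.map_val, Multiset.map_map, h2, ← Fin.univ_val_map]
  exact Multiset.map_congr rfl fun j _ => place_apply hn _ j

/-- Each value occurs equally often in both lists, so the positions can be matched value by value.
-/
theorem parts_perm {I J : List ℕ+} (h : I.Perm J) :
    ∃ s : Fin I.length → Fin J.length, Function.Injective s ∧ Function.Surjective s ∧
      ∀ j, parts I j = parts J (s j) := by
  classical
  have hc : ∀ (L : List ℕ+) (a : ℕ+), Fintype.card {j // L.get j = a} = L.count a := by
    intro L a
    have h1 : (L : Multiset ℕ+) = Finset.univ.val.map L.get := by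
      rw [Fin.univ_val_map, List.ofFn_get]
    rw [← Multiset.coe_count, h1, Multiset.count_map, Fintype.card_subtype, Finset.card,
      Finset.filter_val]
    simp only [eq_comm]
  have e : ∀ a : ℕ+, {j // I.get j = a} ≃ {j // J.get j = a} := fun a =>
    Fintype.equivOfCardEq (by rw [hc, hc, h.count_eq])
  let s := Equiv.ofFiberEquiv e
  exact ⟨s, s.injective, s.surjective, fun j =>
    congrArg PNat.val (Equiv.ofFiberEquiv_map e j).symm⟩

theorem place_comp {k l : ℕ} (n : Fin k → ℕ) (i : Fin k → ℕ) {s : Fin l → Fin k}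
    (hs : Function.Bijective s) : place (fun j => n (s j)) (fun j => i (s j)) = place n i :=
  Fintype.sum_bijective s hs _ _ fun _ => rfl

/-- Sorting the variables writes the monomial with some reordering of `I`; permuting the index
sequence accordingly gives `I` itself. Membership in m_λ thus depends only on the multiset of
exponents. -/
theorem exists_injective_place_iff (m : ℕ →₀ ℕ) (I : List ℕ+) :
    (∃ n : Fin I.length → ℕ, Function.Injective n ∧ m = place n (parts I)) ↔
      content m = (I.map fun a : ℕ+ => (a : ℕ) : List ℕ) := by
  constructor
  · rintro ⟨n, hn, rfl⟩
    exact content_place hn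
  · intro h
    obtain ⟨J, n, hn, rfl⟩ := exists_place m
    rw [content_place hn.injective, Multiset.coe_eq_coe] at h
    have h' : J.Perm I := (List.map_perm_map_iff PNat.coe_injective).1 h
    obtain ⟨s, hs, hs', hp⟩ := parts_perm h'.symm
    refine ⟨fun j => n (s j), hn.injective.comp hs, ?_⟩
    rw [show parts I = fun j => parts J (s j) from funext hp, place_comp _ _ ⟨hs, hs'⟩]

end content

section SYM

variable (K : Type*) [Field K]

theorem SYM.coeff_m (l : Multiset ℕ+) (m : ℕ →₀ ℕ) :
    MvPowerSeries.coeff m (SYM.m K l : MvPowerSeries ℕ K) =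
      PForest.ind K (content m) (l.map fun a : ℕ+ => (a : ℕ)) := by
  classical
  change (if _ then (1 : K) else 0) = _
  rw [PForest.ind_def]
  congr 1
  rw [eq_iff_iff, exists_injective_place_iff, ← Multiset.map_coe, Multiset.coe_toList]

theorem SYM.leadCoeff_m (l : Multiset ℕ+) (I : List ℕ+) :
    leadCoeff K I (SYM.m K l : MvPowerSeries ℕ K) = Finsupp.single l (1 : K) I := by
  classical
  rw [leadCoeff, SYM.coeff_m, content_place Fin.val_injective, PForest.ind_def, ← Multiset.map_coe,
    Finsupp.single_apply]
  congr 1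
  rw [(Multiset.map_injective PNat.coe_injective).eq_iff]
  exact propext eq_comm

theorem SYM.coeff_place (f : SYM K) {I : List ℕ+} {n : Fin I.length → ℕ}
    (hn : Function.Injective n) :
    MvPowerSeries.coeff (place n (parts I)) f.1 = leadCoeff K I f.1 :=
  f.2.2 _ _ _ hn

theorem SYM.leadCoeff_perm (f : SYM K) {I J : List ℕ+} (h : I.Perm J) :
    leadCoeff K I f.1 = leadCoeff K J f.1 := by
  obtain ⟨s, hs, hs', hp⟩ := parts_perm h
  rw [← SYM.coeff_place K f (Fin.val_injective.comp hs)]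
  rw [show parts I = fun j => parts J (s j) from funext hp]
  rw [leadCoeff, ← place_comp _ _ ⟨hs, hs'⟩]
  rfl

/-- Coefficients are defined through an arbitrary ordering of the multiset; by symmetry any other
ordering gives the same value. -/
theorem SYM.coeffs_coe (f : SYM K) (I : List ℕ+) : SYM.coeffs K f I = leadCoeff K I f.1 :=
  SYM.leadCoeff_perm K f (Multiset.coe_eq_coe.1 (Multiset.coe_toList _))

@[simp]
theorem SYM.coeffs_m (l : Multiset ℕ+) : SYM.coeffs K (SYM.m K l) = Finsupp.single l 1 := by
  ext μ
  refine Quotient.inductionOn μ fun I => ?_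
  exact (SYM.coeffs_coe K _ I).trans (SYM.leadCoeff_m K l I)

theorem SYM.coeffs_injective : Function.Injective (SYM.coeffs K) := by
  intro f g h
  refine Subtype.ext (MvPowerSeries.ext fun m => ?_)
  obtain ⟨I, n, hn, rfl⟩ := exists_place m
  rw [SYM.coeff_place K f hn.injective, SYM.coeff_place K g hn.injective, ← SYM.coeffs_coe, h,
    SYM.coeffs_coe]

theorem SYM.span_m : ⊤ ≤ Submodule.span K (Set.range (SYM.m K)) := by
  intro f _
  have h : f = Finsupp.linearCombination K (SYM.m K) (SYM.coeffs K f) := by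
    apply SYM.coeffs_injective K
    generalize SYM.coeffs K f = x
    induction x using Finsupp.induction_linear with
    | zero => simp
    | add x y hx hy => rw [map_add, map_add, ← hx, ← hy]
    | single l r => simp
  rw [h, ← Finsupp.range_linearCombination]
  exact ⟨_, rfl⟩

theorem SYM.m_zero : SYM.m K 0 = 1 := by
  refine Subtype.ext (MvPowerSeries.ext fun m => ?_)
  classical
  rw [SYM.coeff_m, PForest.ind_def, OneMemClass.coe_one, MvPowerSeries.coeff_one]
  simp [content]

/-- The inclusion of the symmetric functions in the quasi-symmetric functions. -/
def SYM.incl : SYM K →ₗ[K] QSYM K :=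
  Submodule.inclusion (p := (SYM K).toSubmodule) (p' := (QSYM K).toSubmodule) fun _ hf =>
    ⟨hf.1, fun k i n hn => hf.2 k i n hn.injective⟩

@[simp]
theorem SYM.coe_incl (f : SYM K) : (SYM.incl K f : MvPowerSeries ℕ K) = f := rfl

theorem SYM.incl_injective : Function.Injective (SYM.incl K) := fun _ _ h =>
  Subtype.ext (congrArg (fun x : QSYM K => (x : MvPowerSeries ℕ K)) h)

theorem SYM.comul_m (l : Multiset ℕ+) : (SYM.hopf K).comul (SYM.m K l) =
    ∑ a ∈ Finset.Iic l, SYM.m K a ⊗ₜ[K] SYM.m K (l - a) := by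
  simp [SYM.hopf]

/-- Product and counit are those of power series on both sides. For the coproduct of m_λ, pairing
with a pair of words `I`, `J` gives 1 on either side if λ is the union of their parts, and 0
otherwise. -/
theorem SYM.isHom_incl : (SYM.hopf K).IsHom (QSYM.hopf K) (SYM.incl K) where
  map_mul _ _ := rfl
  map_one := rfl
  map_comul f := by
    have h : TensorProduct.map (SYM.incl K) (SYM.incl K) ∘ₗ (SYM.hopf K).comul =
        (QSYM.hopf K).comul ∘ₗ SYM.incl K := by
      refine LinearMap.ext_on_range (top_le_iff.1 (SYM.span_m K)) fun l => ?_
      have hb : ∀ X Y : QSYM K ⊗[K] QSYM K, (∀ I J, tpair (pairNQBilin K) (pairNQBilin K)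
          (freeWord K I ⊗ₜ freeWord K J) X = tpair (pairNQBilin K) (pairNQBilin K)
          (freeWord K I ⊗ₜ freeWord K J) Y) → X = Y := by
        intro X Y hXY
        refine (separates_pairNQ K).ext_tensor (separates_pairNQ K) fun x y => ?_
        have h : (TensorProduct.mk K _ _).compr₂ ((tpair (pairNQBilin K) (pairNQBilin K)).flip X) =
            (TensorProduct.mk K _ _).compr₂ ((tpair (pairNQBilin K) (pairNQBilin K)).flip Y) :=
          LinearMap.ext_on_range (top_le_iff.1 (span_freeWord K)) fun I =>
            LinearMap.ext_on_range (top_le_iff.1 (span_freeWord K)) fun J => hXY I J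
        exact DFunLike.congr_fun (DFunLike.congr_fun h x) y
      refine hb _ _ fun I J => ?_
      rw [LinearMap.comp_apply, LinearMap.comp_apply, SYM.comul_m, ← (NSYM.isDual K).mul_left,
        show (NSYM.hopf K).mul (freeWord K I) (freeWord K J) = freeWord K (I ++ J) from
          (freeWord_append K I J).symm, pairNQBilin_freeWord]
      simp only [map_sum, TensorProduct.map_tmul, tpair_tmul, pairNQBilin_freeWord, SYM.coe_incl,
        SYM.leadCoeff_m]
      classical
      simp only [Finsupp.single_apply]
      by_cases h : l = ((I ++ J : List ℕ+) : Multiset ℕ+)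
      -- The first tensor factor forces the submultiset to consist of the letters of `I`; the
      -- complement is then that of `J`.
      · rw [if_pos h, Finset.sum_eq_single (I : Multiset ℕ+)]
        · rw [if_pos rfl, if_pos, mul_one]
          rw [h, ← Multiset.coe_add, add_tsub_cancel_left]
        · intro a _ ha
          rw [if_neg ha, zero_mul]
        · intro hI
          refine absurd (Finset.mem_Iic.2 ?_) hI
          rw [h, ← Multiset.coe_add]
          exact Multiset.le_add_right _ _
      · rw [if_neg h]
        refine Finset.sum_eq_zero fun a ha => ?_
        by_cases h1 : a = (I : Multiset ℕ+)
        · rw [if_neg (c := l - a = _), mul_zero]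
          intro h2
          apply h
          rw [← Multiset.coe_add, ← h1, ← h2, add_tsub_cancel_of_le (Finset.mem_Iic.1 ha)]
        · rw [if_neg h1, zero_mul]
    exact DFunLike.congr_fun h f
  map_counit _ := rfl

theorem SYM.isBialgebra : (SYM.hopf K).IsBialgebra :=
  (QSYM.isBialgebra K).of_injective (SYM.isHom_incl K) (SYM.incl_injective K)

theorem SYM.isHopfAlgebra : (SYM.hopf K).IsHopfAlgebra := by
  refine (SYM.isBialgebra K).isHopfAlgebra (b := SYM.m K) (deg := Multiset.card)
    ⟨SYM.span_m K, fun l => ?_, fun l hl => ?_⟩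
  · rw [SYM.comul_m]
    refine Submodule.sum_mem _ fun a ha => Submodule.subset_span ⟨a, l - a, ?_, rfl⟩
    rw [← Multiset.card_add, add_tsub_cancel_of_le (Finset.mem_Iic.1 ha)]
  · rw [Multiset.card_eq_zero.1 hl, SYM.m_zero]
    rfl

/-- `e_n = m_{(1,…,1)}`, for all natural `n`. -/
def SYM.eNat (n : ℕ) : SYM K := SYM.m K (Multiset.replicate n 1)

/-- The submultisets of n ones are the multisets of at most n ones, so the e_n satisfy the same
coproduct formula as the z_n. -/
theorem SYM.comul_eNat (n : ℕ) : (SYM.hopf K).comul (SYM.eNat K n) =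
    ∑ p ∈ Finset.HasAntidiagonal.antidiagonal n, SYM.eNat K p.1 ⊗ₜ[K] SYM.eNat K p.2 := by
  rw [SYM.eNat, SYM.comul_m]
  symm
  refine Finset.sum_bij (fun p _ => Multiset.replicate p.1 1) ?_ ?_ ?_ ?_
  · rintro ⟨a, b⟩ h
    rw [Finset.HasAntidiagonal.mem_antidiagonal] at h
    subst h
    rw [Finset.mem_Iic, Multiset.replicate_add]
    exact Multiset.le_add_right _ _
  · rintro ⟨a, b⟩ h ⟨a', b'⟩ h' heq
    rw [Finset.HasAntidiagonal.mem_antidiagonal] at h h'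
    have : a = a' := by simpa using congrArg Multiset.card heq
    dsimp only at h h'
    ext <;> simp <;> omega
  · intro l hl
    obtain ⟨k, hk, rfl⟩ := Multiset.le_replicate_iff.1 (Finset.mem_Iic.1 hl)
    exact ⟨(k, n - k), by rw [Finset.HasAntidiagonal.mem_antidiagonal]; simp; omega, rfl⟩
  · rintro ⟨a, b⟩ h
    rw [Finset.HasAntidiagonal.mem_antidiagonal] at h
    subst h
    rw [Multiset.replicate_add, add_tsub_cancel_left]
    rfl

/-- The algebra homomorphism with `zₙ ↦ eₙ`. -/
def SYM.ofNSYM : NSYM K →ₐ[K] SYM K := FreeAlgebra.lift K (SYM.e K)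

theorem SYM.ofNSYM_z (n : ℕ) : SYM.ofNSYM K (NSYM.z K n) = SYM.eNat K n := by
  rcases Nat.eq_zero_or_pos n with rfl | hn
  · rw [SYM.eNat, Multiset.replicate_zero, SYM.m_zero, NSYM.z, map_one]
  · lift n to ℕ+ using hn
    rw [NSYM.z_coe, SYM.ofNSYM, FreeAlgebra.lift_ι_apply]
    rfl

theorem SYM.isHom_ofNSYM : (NSYM.hopf K).IsHom (SYM.hopf K) (SYM.ofNSYM K).toLinearMap := by
  refine .of_adjoin (NSYM.isBialgebra K) (SYM.isBialgebra K) rfl rfl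
    (map_mul (SYM.ofNSYM K)) (map_one (SYM.ofNSYM K))
    (FreeAlgebra.adjoin_range_ι (R := K) (X := ℕ+)) ?_ ?_
  · rintro _ ⟨n, rfl⟩
    rw [← NSYM.z_coe, NSYM.comul_eq, AlgHom.toLinearMap_apply, AlgHom.toLinearMap_apply,
      NSYM.Δ_z, SYM.ofNSYM_z, SYM.comul_eNat, map_sum]
    simp only [TensorProduct.map_tmul, AlgHom.toLinearMap_apply, SYM.ofNSYM_z]
  · rintro _ ⟨n, rfl⟩
    rw [← NSYM.z_coe, NSYM.counit_z, if_neg n.ne_zero, AlgHom.toLinearMap_apply, SYM.ofNSYM_z]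
    refine (SYM.coeff_m K _ _).trans ?_
    classical
    rw [PForest.ind_def, if_neg]
    intro h
    exact n.ne_zero (by simpa [content, eq_comm] using congrArg Multiset.card h)

end SYM

/-! ### The basis of products of elementary symmetric functions -/

section SYM

variable (K : Type*) [Field K]

theorem content_embDomain {σ τ : Type*} (e : σ ↪ τ) (m : σ →₀ ℕ) :
    content (Finsupp.embDomain e m) = content m := by
  simp [content, Finsupp.support_embDomain, Finset.map_val, Multiset.map_map]

theorem coeff_esymm {σ : Type*} [Fintype σ] (k : ℕ) (x : σ →₀ ℕ) :
    (MvPolynomial.esymm σ K k).coeff x = PForest.ind K (content x) (Multiset.replicate k 1) := by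
  classical
  have hone : ∀ (t : Finset σ) (i : σ),
      (∑ j ∈ t, Finsupp.single j 1 : σ →₀ ℕ) i = if i ∈ t then 1 else 0 := by
    intro t i
    simp [Finsupp.finsetSum_apply, Finsupp.single_apply]
  rw [MvPolynomial.esymm_eq_sum_monomial, MvPolynomial.coeff_sum]
  simp only [MvPolynomial.coeff_monomial]
  rw [PForest.ind_def]
  by_cases h : content x = Multiset.replicate k 1
  · rw [if_pos h]
    rw [Multiset.eq_replicate, content, Multiset.card_map] at h
    have hx : (∑ j ∈ x.support, Finsupp.single j 1 : σ →₀ ℕ) = x := by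
      ext i
      rw [hone]
      split_ifs with hi
      · exact (h.2 _ (Multiset.mem_map_of_mem x hi)).symm
      · exact (Finsupp.notMem_support_iff.1 hi).symm
    rw [Finset.sum_eq_single x.support]
    · rw [if_pos hx]
    · intro t _ ht
      rw [if_neg]
      rintro rfl
      apply ht
      ext i
      rw [Finsupp.mem_support_iff, hone]
      simp
    · intro hn
      exact absurd (Finset.mem_powersetCard.2 ⟨Finset.subset_univ _, h.1⟩) hn
  · rw [if_neg h]
    refine Finset.sum_eq_zero fun t ht => ?_
    rw [if_neg]
    rintro rfl
    apply h
    have hs : (∑ j ∈ t, Finsupp.single j 1 : σ →₀ ℕ).support = t := by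
      ext i
      rw [Finsupp.mem_support_iff, hone]
      simp
    rw [Multiset.eq_replicate, content, hs, Multiset.card_map]
    refine ⟨(Finset.mem_powersetCard.1 ht).2, fun b hb => ?_⟩
    obtain ⟨i, hi, rfl⟩ := Multiset.mem_map.1 hb
    exact (hone t i).trans (if_pos hi)

/-- In finitely many variables, the elementary symmetric functions are the elementary symmetric
polynomials. -/
theorem killCompl_e (N : ℕ) (n : ℕ+) :
    MvPowerSeries.killCompl (Fin.valEmbedding (n := N)) (SYM.e K n : MvPowerSeries ℕ K) =
      (MvPolynomial.esymm (Fin N) K n : MvPowerSeries (Fin N) K) := by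
  ext x
  rw [MvPowerSeries.coeff_killCompl, SYM.e, SYM.coeff_m, content_embDomain, MvPolynomial.coeff_coe,
    coeff_esymm, Multiset.map_replicate]
  rfl

/-- The elementary symmetric functions are algebraically independent. -/
theorem SYM.aeval_e_injective : Function.Injective (MvPolynomial.aeval (R := K) (SYM.e K)) := by
  rw [injective_iff_map_eq_zero]
  intro P hP
  obtain ⟨s, q, rfl⟩ := MvPolynomial.exists_finset_rename P
  -- A polynomial relation involves finitely many e_n. With N their largest index, restriction to N
  -- variables turns e_1, …, e_N into the elementary symmetric polynomials, which are independent.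
  -- The maps `g` and `j` translate between n and the index n − 1 in `Fin N`.
  let N := s.sup fun n => (n : ℕ)
  let g : {x // x ∈ s} → Fin N := fun x => ⟨PNat.natPred x.1, by
    have h1 := Finset.le_sup (f := fun n : ℕ+ => (n : ℕ)) x.2
    have h2 := PNat.natPred_add_one x.1
    change _ ≤ N at h1
    omega⟩
  let j : Fin N → ℕ+ := fun i => (i : ℕ).succPNat
  have hj : ∀ x, j (g x) = x.1 := fun x => PNat.succPNat_natPred x.1
  have hq : MvPolynomial.rename Subtype.val q = MvPolynomial.rename j (MvPolynomial.rename g q) := by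
    rw [MvPolynomial.rename_rename]
    congr 2
    exact (funext hj).symm
  rw [hq] at hP ⊢
  generalize MvPolynomial.rename g q = p at hP ⊢
  have h1 : MvPolynomial.aeval (fun i : Fin N => MvPolynomial.esymm (Fin N) K (i + 1)) p = 0 := by
    apply MvPolynomial.coe_injective (Fin N) K
    have h2 := congrArg (fun f : SYM K => MvPowerSeries.killCompl (Fin.valEmbedding (n := N))
      (f : MvPowerSeries ℕ K)) hP
    have h3 : ((MvPowerSeries.killCompl (R := K) (Fin.valEmbedding (n := N))).comp
        (SYM K).val).comp ((MvPolynomial.aeval (SYM.e K)).comp (MvPolynomial.rename j)) =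
        (MvPolynomial.coeToMvPowerSeries.algHom K).comp
          (MvPolynomial.aeval fun i : Fin N => MvPolynomial.esymm (Fin N) K (i + 1)) := by
      ext1 i
      simp only [AlgHom.comp_apply, MvPolynomial.rename_X, MvPolynomial.aeval_X]
      refine (killCompl_e K N (j i)).trans ?_
      rw [MvPolynomial.coeToMvPowerSeries.algHom_apply]
      simp [j]
    have h4 := DFunLike.congr_fun h3 p
    simp only [AlgHom.comp_apply] at h4
    rw [hP, map_zero, map_zero, MvPolynomial.coeToMvPowerSeries.algHom_apply] at h4
    simpa using h4.symm
  have h5 : MvPolynomial.esymmAlgHom (Fin N) K N p = 0 := by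
    apply Subtype.ext
    rw [MvPolynomial.esymmAlgHom_apply, h1]
    rfl
  rw [MvPolynomial.esymmAlgHom_fin_injective K le_rfl (h5.trans (map_zero _).symm), map_zero]

/-- The products `e_λ`. -/
def SYM.eProd (l : Multiset ℕ+) : SYM K := (l.map (SYM.e K)).prod

/-- The linear map with `λ ↦ e_λ`. -/
def SYM.eMap : (Multiset ℕ+ →₀ K) →ₗ[K] SYM K := Finsupp.linearCombination K (SYM.eProd K)

theorem SYM.eMap_single (l : Multiset ℕ+) : SYM.eMap K (Finsupp.single l 1) = SYM.eProd K l := by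
  simp [SYM.eMap]

/-- The e_λ are the distinct monomials in the algebraically independent e_n. -/
theorem SYM.eMap_injective : Function.Injective (SYM.eMap K) := by
  classical
  let Φ : (Multiset ℕ+ →₀ K) →ₗ[K] MvPolynomial ℕ+ K :=
    Finsupp.linearCombination K fun l => MvPolynomial.monomial (Multiset.toFinsupp l) 1
  have h1 : (MvPolynomial.aeval (SYM.e K)).toLinearMap ∘ₗ Φ = SYM.eMap K := by
    refine LinearMap.ext_on_range (top_le_iff.1 (span_single K _)) fun l => ?_
    rw [SYM.eMap_single, LinearMap.comp_apply]
    simp only [Φ, Finsupp.linearCombination_single, one_smul, AlgHom.toLinearMap_apply,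
      MvPolynomial.aeval_monomial, map_one, one_mul]
    rw [SYM.eProd, Finset.prod_multiset_map_count, Finsupp.prod, Multiset.toFinsupp_support]
    simp
  have h2 : ∀ c l, MvPolynomial.coeff (Multiset.toFinsupp l) (Φ c) = c l := by
    intro c l
    induction c using Finsupp.induction_linear with
    | zero => simp
    | add x y hx hy => simp [hx, hy]
    | single μ r => simp [Φ, MvPolynomial.coeff_monomial, Finsupp.single_apply]
  rw [← h1]
  refine (SYM.aeval_e_injective K).comp fun x y hxy => Finsupp.ext fun l => ?_
  rw [← h2, hxy, h2]

/-- The weight of a partition. -/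
def weight (l : Multiset ℕ+) : ℕ := (l.map fun n : ℕ+ => (n : ℕ)).sum

theorem finite_weight (d : ℕ) : {l : Multiset ℕ+ | weight l = d}.Finite := by
  let F : {l : Multiset ℕ+ | weight l = d} → d.Partition := fun l =>
    ⟨l.1.map fun n : ℕ+ => (n : ℕ), by
      intro i hi
      obtain ⟨n, _, rfl⟩ := Multiset.mem_map.1 hi
      exact n.pos, l.2⟩
  have hF : Function.Injective F := fun l μ h => Subtype.ext <|
    Multiset.map_injective PNat.coe_injective (congrArg Nat.Partition.parts h)
  have := Finite.of_injective F hF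
  exact Set.toFinite _

theorem sum_parts (I : List ℕ+) : ∑ j, parts I j = weight I := by
  have : I.map (fun n : ℕ+ => (n : ℕ)) = List.ofFn (parts I) := by
    conv_lhs => rw [← List.ofFn_get I, List.map_ofFn]
    rfl
  rw [weight, Multiset.map_coe, Multiset.sum_coe, this, List.sum_ofFn]

theorem SYM.coeff_eProd {l : Multiset ℕ+} {m : ℕ →₀ ℕ}
    (h : MvPowerSeries.coeff m (SYM.eProd K l : MvPowerSeries ℕ K) ≠ 0) : m.degree = weight l := by
  classical
  induction l using Multiset.induction_on generalizing m with
  | empty =>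
    simp only [SYM.eProd, Multiset.map_zero, Multiset.prod_zero, OneMemClass.coe_one,
      MvPowerSeries.coeff_one] at h
    have : m = 0 := by
      by_contra hm
      exact h (if_neg hm)
    simp [this, weight]
  | cons n l ih =>
    rw [SYM.eProd, Multiset.map_cons, Multiset.prod_cons, MulMemClass.coe_mul,
      MvPowerSeries.coeff_mul] at h
    obtain ⟨p, hp, hne⟩ := Finset.exists_ne_zero_of_sum_ne_zero h
    rw [Finset.HasAntidiagonal.mem_antidiagonal] at hp
    have h1 := ih (right_ne_zero_of_mul hne)
    have h2 := left_ne_zero_of_mul hne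
    rw [SYM.e, SYM.coeff_m, PForest.ind_def] at h2
    have h3 : content p.1 = Multiset.replicate n 1 := by
      by_contra hc
      exact h2 (if_neg (by simpa using hc))
    have h4 : p.1.degree = n := by
      have := congrArg Multiset.sum h3
      simp only [content, Multiset.sum_replicate, smul_eq_mul, mul_one] at this
      exact this
    rw [← hp, map_add, h1, h4]
    simp [weight]

theorem SYM.coeffs_eProd {l μ : Multiset ℕ+} (h : SYM.coeffs K (SYM.eProd K l) μ ≠ 0) :
    weight μ = weight l := by
  revert h
  refine Quotient.inductionOn μ fun I h => ?_
  have h1 := SYM.coeff_eProd K (m := place (fun j => (j : ℕ)) (parts I))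
    (l := l) (by rwa [← leadCoeff, ← SYM.coeffs_coe])
  rw [degree_place, sum_parts] at h1
  exact h1

/-- In place of a triangularity argument: expanding e_λ in the m_μ preserves weight, and only
finitely many partitions have a given weight. On each weight space the expansion is an injective
endomorphism of a finite-dimensional space, hence surjective. -/
theorem SYM.eMap_surjective : Function.Surjective (SYM.eMap K) := by
  let U : ℕ → Submodule K (Multiset ℕ+ →₀ K) := fun d =>
    Finsupp.supported K K {l : Multiset ℕ+ | weight l = d}
  let A : (Multiset ℕ+ →₀ K) →ₗ[K] (Multiset ℕ+ →₀ K) := SYM.coeffs K ∘ₗ SYM.eMap K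
  have hA : ∀ d, ∀ x ∈ U d, A x ∈ U d := by
    intro d x hx
    rw [show U d = _ from Finsupp.supported_eq_span_single K _] at hx
    refine (Submodule.span_le (p := (U d).comap A)).2 ?_ hx
    rintro _ ⟨l, hl, rfl⟩
    refine (Finsupp.mem_supported' K _).2 fun μ hμ => ?_
    by_contra hne
    rw [LinearMap.comp_apply, SYM.eMap_single] at hne
    exact hμ ((SYM.coeffs_eProd K hne).trans hl)
  have hinj : Function.Injective A := (SYM.coeffs_injective K).comp (SYM.eMap_injective K)
  have hfin : ∀ d, FiniteDimensional K (U d) := fun d => by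
    have := (finite_weight d).to_subtype
    exact Module.Finite.equiv (Finsupp.supportedEquivFinsupp {l : Multiset ℕ+ | weight l = d}).symm
  intro f
  have hs : ∀ l, ∃ x, A x = Finsupp.single l 1 := by
    intro l
    have := hfin (weight l)
    have h1 : Function.Injective (A.restrict (hA (weight l))) := fun x y hxy =>
      Subtype.ext (hinj (congrArg Subtype.val hxy))
    obtain ⟨x, hx⟩ := (LinearMap.injective_iff_surjective (V := U (weight l))).1 h1
      ⟨Finsupp.single l 1, Finsupp.single_mem_supported K _ rfl⟩
    exact ⟨x, congrArg Subtype.val hx⟩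
  have hr : LinearMap.range A = ⊤ := by
    rw [← top_le_iff, ← top_le_iff.1 (span_single K _), Submodule.span_le]
    rintro _ ⟨l, rfl⟩
    exact hs l
  obtain ⟨x, hx⟩ := LinearMap.range_eq_top.1 hr (SYM.coeffs K f)
  exact ⟨x, SYM.coeffs_injective K hx⟩

/-- The basis of the products of elementary symmetric functions. -/
def SYM.eEquiv : (Multiset ℕ+ →₀ K) ≃ₗ[K] SYM K :=
  LinearEquiv.ofBijective (SYM.eMap K) ⟨SYM.eMap_injective K, SYM.eMap_surjective K⟩

theorem SYM.eEquiv_symm_eProd (l : Multiset ℕ+) :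
    (SYM.eEquiv K).symm (SYM.eProd K l) = Finsupp.single l 1 := by
  rw [LinearEquiv.symm_apply_eq]
  exact (SYM.eMap_single K l).symm

theorem SYM.ofNSYM_freeWord (I : List ℕ+) : SYM.ofNSYM K (freeWord K I) = SYM.eProd K I := by
  rw [freeWord, map_list_prod, List.map_map, SYM.eProd, Multiset.map_coe, Multiset.prod_coe]
  congr 2
  funext n
  simp [SYM.ofNSYM]

theorem SYM.ofNSYM_surjective : Function.Surjective (SYM.ofNSYM K) := by
  intro f
  obtain ⟨x, rfl⟩ := SYM.eMap_surjective K f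
  induction x using Finsupp.induction_linear with
  | zero => exact ⟨0, by simp⟩
  | add x y hx hy =>
    obtain ⟨a, ha⟩ := hx
    obtain ⟨b, hb⟩ := hy
    exact ⟨a + b, by rw [map_add, map_add, ha, hb]⟩
  | single l r =>
    refine ⟨r • freeWord K l.toList, ?_⟩
    rw [map_smul, SYM.ofNSYM_freeWord, Multiset.coe_toList, ← SYM.eMap_single, ← map_smul]
    simp

/-- The pairing of the space of symmetric functions with itself, for which the `e_λ` and the `m_λ`
are dual bases. -/
def SYM.pair : SYM K →ₗ[K] SYM K →ₗ[K] K :=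
  (dot K (Multiset ℕ+)).compl₁₂ (SYM.eEquiv K).symm.toLinearMap (SYM.coeffs K)

theorem SYM.pair_eProd (l : Multiset ℕ+) (f : SYM K) :
    SYM.pair K (SYM.eProd K l) f = SYM.coeffs K f l := by
  rw [SYM.pair, LinearMap.compl₁₂_apply, LinearEquiv.coe_coe, SYM.eEquiv_symm_eProd, dot_single,
    one_mul]

end SYM

/-! ### Ladders -/

namespace PForest

theorem ladder_coe (a : ℕ+) : ladder a = cons () (ladder a.natPred) nil := by
  conv_lhs => rw [← PNat.natPred_add_one a]
  rfl

theorem ladders_cons (a : ℕ+) (I : List ℕ+) :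
    ladders (a :: I) = cons () (ladder a.natPred) (ladders I) := by
  rw [ladders, ladder_coe]
  rfl

theorem size_ladder (n : ℕ) : (ladder n).size = n := by
  induction n with
  | zero => rfl
  | succ n ih => simp [ladder, size, ih]

theorem ladder_injective : Function.Injective ladder :=
  Function.LeftInverse.injective size_ladder

theorem ladders_injective : Function.Injective ladders := by
  intro I J h
  induction I generalizing J with
  | nil =>
    cases J with
    | nil => rfl
    | cons b J => rw [ladders_cons] at h; cases h
  | cons a I ih =>
    cases J with
    | nil => rw [ladders_cons] at h; cases h
    | cons b J =>
      rw [ladders_cons, ladders_cons, cons.injEq] at h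
      rw [ih h.2.2, PNat.natPred_injective (ladder_injective h.2.1)]

theorem Equiv.ladders {I J : List ℕ+} (h : I.Perm J) : Equiv (ladders I) (ladders J) := by
  induction h with
  | nil => exact .nil
  | cons a _ ih => exact .append_right _ ih
  | swap a b I => simp only [ladders_cons]; exact .swap _ _ _ _ _
  | trans _ _ h₁ h₂ => exact .trans h₁ h₂

end PForest

/-! ### Homomorphisms prescribed on generators, and the map to QSYM -/

section maps

variable (K : Type*) [Field K]

/-- Grafting raises the second factor of each term by one vertex; the missing term, with everything
pruned, is the extra term of the cocycle identity. -/
theorem HF.Δ_ladder (n : ℕ) : HF.Δ K (HF.of K (PForest.ladder n)) =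
    ∑ p ∈ Finset.HasAntidiagonal.antidiagonal n,
      HF.of K (PForest.ladder p.1) ⊗ₜ[K] HF.of K (PForest.ladder p.2) := by
  induction n with
  | zero =>
    rw [PForest.ladder, HF.of_nil, map_one]
    simp [PForest.ladder, HF.of_nil, Algebra.TensorProduct.one_def]
  | succ n ih =>
    rw [Finset.Nat.sum_antidiagonal_succ', PForest.ladder, HF.of_nil]
    refine (HF.Δ_tree K _ _).trans ?_
    rw [ih, map_sum]
    simp only [LinearMap.lTensor_tmul, HF.graftRoot_of, PForest.ladder]

/-- The homomorphism that maps the generators to the ladders, with values in an algebra. -/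
def NSYM.toForestAlg : NSYM K →ₐ[K] HF.Alg K :=
  FreeAlgebra.lift K fun n : ℕ+ => HF.of K (PForest.ladder n)

/-- The homomorphism that maps the generators to the ladders. -/
def NSYM.toForest : NSYM K →ₗ[K] HF K where
  toFun x := NSYM.toForestAlg K x
  map_add' := map_add (NSYM.toForestAlg K)
  map_smul' := map_smul (NSYM.toForestAlg K)

theorem NSYM.toForest_mul (x y : NSYM K) : NSYM.toForest K (x * y) =
    (HF.hopf K).mul (NSYM.toForest K x) (NSYM.toForest K y) :=
  map_mul (NSYM.toForestAlg K) x y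

theorem NSYM.toForest_one : NSYM.toForest K 1 = Finsupp.single .nil 1 :=
  map_one (NSYM.toForestAlg K)

theorem NSYM.toForest_ι (n : ℕ+) :
    NSYM.toForest K (FreeAlgebra.ι K n) = Finsupp.single (PForest.ladder n) 1 :=
  FreeAlgebra.lift_ι_apply (A := HF.Alg K) _ _

theorem NSYM.toForest_z (n : ℕ) :
    NSYM.toForest K (NSYM.z K n) = Finsupp.single (PForest.ladder n) 1 := by
  rcases Nat.eq_zero_or_pos n with rfl | hn
  · rw [NSYM.z, NSYM.toForest_one]
    rfl
  · lift n to ℕ+ using hn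
    rw [NSYM.z_coe, NSYM.toForest_ι]

theorem NSYM.toForest_freeWord (I : List ℕ+) :
    NSYM.toForest K (freeWord K I) = Finsupp.single (PForest.ladders I) 1 := by
  induction I with
  | nil => exact NSYM.toForest_one K
  | cons a I ih =>
    rw [freeWord, List.map_cons, List.prod_cons, NSYM.toForest_mul, ← freeWord, ih,
      NSYM.toForest_ι, HF.mul_single]
    rfl

theorem NSYM.isHom_toForest : (NSYM.hopf K).IsHom (HF.hopf K) (NSYM.toForest K) := by
  refine .of_adjoin (NSYM.isBialgebra K) (HF.isBialgebra K) rfl rfl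
    (NSYM.toForest_mul K) (NSYM.toForest_one K)
    (FreeAlgebra.adjoin_range_ι (R := K) (X := ℕ+)) ?_ ?_
  · rintro _ ⟨n, rfl⟩
    rw [← NSYM.z_coe, NSYM.comul_eq, AlgHom.toLinearMap_apply, NSYM.Δ_z, NSYM.toForest_z, map_sum]
    refine Eq.trans ?_ (HF.Δ_ladder K n).symm
    simp only [TensorProduct.map_tmul, NSYM.toForest_z]
    rfl
  · rintro _ ⟨n, rfl⟩
    rw [← NSYM.z_coe, NSYM.counit_z, if_neg n.ne_zero, NSYM.toForest_z, PForest.ladder_coe]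
    exact HF.εₗ_cons K _ _ _

/-! ### From planar trees to quasi-symmetric functions -/

open Classical in
/-- The map with `B⁺(l_{i₁} ⋯ l_{i_k}) ↦ M_{(i₁, …, i_k)}`, while the other trees go to `0`. -/
def HP.toQSYM : HP K →ₗ[K] QSYM K :=
  Finsupp.linearCombination K fun t =>
    if h : ∃ I, t = ⟨PForest.ladders I⟩ then QSYM.M K h.choose else 0

theorem HP.toQSYM_ladders (I : List ℕ+) :
    HP.toQSYM K (Finsupp.single ⟨PForest.ladders I⟩ 1) = QSYM.M K I := by
  have h : ∃ J, (⟨PForest.ladders I⟩ : PTree) = ⟨PForest.ladders J⟩ := ⟨I, rfl⟩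
  rw [HP.toQSYM, Finsupp.linearCombination_single, one_smul, dif_pos h]
  congr 1
  -- The composition is recovered from the tree, so the choice in the definition is forced.
  exact (PForest.ladders_injective (PTree.mk.inj h.choose_spec)).symm

theorem HP.toQSYM_of_ne (t : PTree) (h : ∀ I : List ℕ+, t ≠ ⟨PForest.ladders I⟩) :
    HP.toQSYM K (Finsupp.single t 1) = 0 := by
  rw [HP.toQSYM, Finsupp.linearCombination_single, one_smul, dif_neg (not_exists.2 h)]

theorem pairFPBilin_toForest (x : NSYM K) (t : HP K) :
    pairFPBilin K (NSYM.toForest K x) t = pairNQBilin K x (HP.toQSYM K t) := by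
  have h : pairFPBilin K ∘ₗ NSYM.toForest K =
      (pairNQBilin K).compl₂ (HP.toQSYM K) := by
    refine LinearMap.ext_on_range (top_le_iff.1 (span_freeWord K)) fun I =>
      LinearMap.ext_on_range (top_le_iff.1 (span_single K _)) fun t => ?_
    rw [LinearMap.comp_apply, LinearMap.compl₂_apply, NSYM.toForest_freeWord,
      pairNQBilin_freeWord, pairFPBilin_single]
    by_cases ht : ∃ J, t = ⟨PForest.ladders J⟩
    · obtain ⟨J, rfl⟩ := ht
      rw [HP.toQSYM_ladders, leadCoeff_M]
      classical
      simp only [Finsupp.single_apply, PTree.mk.injEq, PForest.ladders_injective.eq_iff]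
    · rw [HP.toQSYM_of_ne K t (not_exists.1 ht)]
      exact Finsupp.single_eq_of_ne fun h => ht ⟨I, h.symm⟩
  exact DFunLike.congr_fun (DFunLike.congr_fun h x) t

theorem HP.isHom_toQSYM : (HP.hopf K).IsHom (QSYM.hopf K) (HP.toQSYM K) :=
  (NSYM.isHom_toForest K).transpose (NSYM.isDual K) (HF.isDual K) (separates_pairNQ K)
    (pairFPBilin_toForest K)

/-! ### From the enveloping algebra to planar trees and to symmetric functions -/

/-- The space of planar trees as an algebra. -/
abbrev HP.Alg := (HP.hopf K).Carrier (HP.isBialgebra K).isMonoid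

/-- The homomorphism that maps the generators to `B⁺(l_n)`, with values in an algebra. -/
def ULU.toTreeAlg : ULU K →ₐ[K] HP.Alg K :=
  ULU.liftGen K fun n => (Finsupp.single ⟨PForest.ladder n⟩ 1 : HP K)

/-- The homomorphism that maps the generators to `B⁺(l_n)`. -/
def ULU.toTree : ULU K →ₗ[K] HP K where
  toFun x := ULU.toTreeAlg K x
  map_add' := map_add (ULU.toTreeAlg K)
  map_smul' := map_smul (ULU.toTreeAlg K)

theorem ULU.toTree_mul (x y : ULU K) : ULU.toTree K (x * y) =
    (HP.hopf K).mul (ULU.toTree K x) (ULU.toTree K y) :=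
  map_mul (ULU.toTreeAlg K) x y

theorem ULU.toTree_one : ULU.toTree K 1 = Finsupp.single ⟨.nil⟩ 1 := map_one (ULU.toTreeAlg K)

theorem ULU.toTree_e (n : ℕ+) :
    ULU.toTree K (ULU.e K n) = Finsupp.single ⟨PForest.ladder n⟩ 1 :=
  ULU.liftGen_e (A := HP.Alg K) K _ n

/-- The tree B⁺(l_n) has a single branch, so its only splittings are the two trivial ones and it is
primitive. -/
theorem ULU.isHom_toTree : (ULU.hopf K).IsHom (HP.hopf K) (ULU.toTree K) := by
  refine .of_adjoin (ULU.isBialgebra K) (HP.isBialgebra K) rfl rfl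
    (ULU.toTree_mul K) (ULU.toTree_one K) (ULU.adjoin_e K) ?_ ?_
  · rintro _ ⟨n, rfl⟩
    rw [ULU.comul_eq, AlgHom.toLinearMap_apply, ULU.Δ_e, map_add,
      TensorProduct.map_tmul, TensorProduct.map_tmul, ULU.toTree_one, ULU.toTree_e,
      HP.comul_single, PForest.ladder_coe, add_comm]
    simp [PForest.splits]
  · rintro _ ⟨n, rfl⟩
    rw [ULU.toTree_e, PForest.ladder_coe]
    refine Eq.trans (Finsupp.single_eq_of_ne (by simp)) (ULU.ε_e K n).symm

/-- The algebra homomorphism that maps the generators to the power sums. -/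
def ULU.toSYM : ULU K →ₐ[K] SYM K := ULU.liftGen K fun n => SYM.m K {n}

theorem ULU.toSYM_e (n : ℕ+) : ULU.toSYM K (ULU.e K n) = SYM.m K {n} := ULU.liftGen_e K _ n

theorem ULU.isHom_toSYM : (ULU.hopf K).IsHom (SYM.hopf K) (ULU.toSYM K).toLinearMap := by
  refine .of_adjoin (ULU.isBialgebra K) (SYM.isBialgebra K) rfl rfl
    (map_mul (ULU.toSYM K)) (map_one (ULU.toSYM K)) (ULU.adjoin_e K) ?_ ?_
  · rintro _ ⟨n, rfl⟩
    have h : Finset.Iic ({n} : Multiset ℕ+) = {0, {n}} := by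
      ext a
      rw [Finset.mem_Iic, Multiset.le_singleton, Finset.mem_insert, Finset.mem_singleton]
    rw [ULU.comul_eq, AlgHom.toLinearMap_apply, AlgHom.toLinearMap_apply, ULU.Δ_e, map_add,
      TensorProduct.map_tmul, TensorProduct.map_tmul, AlgHom.toLinearMap_apply,
      AlgHom.toLinearMap_apply, map_one, ULU.toSYM_e, SYM.comul_m, h,
      Finset.sum_pair (by simp), tsub_zero, tsub_self, SYM.m_zero, add_comm]
  · rintro _ ⟨n, rfl⟩
    rw [AlgHom.toLinearMap_apply, ULU.toSYM_e]
    refine Eq.trans ?_ (ULU.ε_e K n).symm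
    refine (SYM.coeff_m K _ _).trans ?_
    classical
    rw [PForest.ind_def, if_neg]
    intro h
    simpa [content] using congrArg Multiset.card h

theorem SYM.incl_m (n : ℕ+) : SYM.incl K (SYM.m K {n}) = QSYM.M K [n] := by
  refine QSYM.coeffs_injective K (Finsupp.ext fun I => ?_)
  rw [QSYM.coeffs_M, QSYM.coeffs_apply, SYM.coe_incl, SYM.leadCoeff_m]
  classical
  simp [Finsupp.single_apply, Multiset.coe_eq_singleton, eq_comm]

/-- Both composites are multiplicative, and on generators both give the power sum m_(n) = M_(n). -/
theorem HP.toQSYM_toTree (y : ULU K) :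
    HP.toQSYM K (ULU.toTree K y) = SYM.incl K (ULU.toSYM K y) := by
  refine DFunLike.congr_fun (f := HP.toQSYM K ∘ₗ ULU.toTree K)
    (g := SYM.incl K ∘ₗ (ULU.toSYM K).toLinearMap) ?_ y
  refine LinearMap.ext_on_range (top_le_iff.1 (ULU.span_word K)) fun I => ?_
  simp only [LinearMap.comp_apply, AlgHom.toLinearMap_apply]
  have hγ := HP.isHom_toQSYM K
  have hi := SYM.isHom_incl K
  induction I with
  | nil =>
    rw [ULU.word, List.map_nil, List.prod_nil, map_one (ULU.toSYM K), ULU.toTree_one]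
    exact hγ.map_one.trans hi.map_one.symm
  | cons a I ih =>
    rw [ULU.word_cons, map_mul (ULU.toSYM K), ULU.toTree_mul, hγ.map_mul, ih, ULU.toTree_e]
    refine Eq.trans ?_ (hi.map_mul _ _).symm
    rw [ULU.toSYM_e, SYM.incl_m, ← HP.toQSYM_ladders, PForest.ladders, PForest.ladders,
      PForest.append_nil]

end maps

/-! ### Contractions of forests -/

section contract

variable (K : Type*) [Field K]

theorem map_list_sum₂ {V W M α β : Type*} [AddCommMonoid V] [Module K V] [AddCommMonoid W]
    [Module K W] [AddCommMonoid M] [Module K M] (B : V →ₗ[K] W →ₗ[K] M) (l : List α) (m : List β)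
    (f : α → V) (g : β → W) : B (l.map f).sum (m.map g).sum =
      (l.map fun x => (m.map fun y => B (f x) (g y)).sum).sum := by
  induction l with
  | nil => simp
  | cons a l ih =>
    rw [List.map_cons, List.sum_cons, map_add, LinearMap.add_apply, ih, map_list_sum, List.map_map,
      List.map_cons, List.sum_cons]
    rfl

theorem HU.shuffle_comm (v w : List ℕ+) : HU.shuffle K v w = HU.shuffle K w v := by
  induction v generalizing w with
  | nil => rw [HU.shuffle_nil, HU.shuffle_nil_right]
  | cons a v ihv =>
    induction w with
    | nil => rw [HU.shuffle_nil, HU.shuffle_nil_right]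
    | cons b w ihw => rw [HU.shuffle_cons, HU.shuffle_cons, ihv, ihw, add_comm]

theorem HU.mul_comm (x y : HU K) : (HU.hopf K).mul x y = (HU.hopf K).mul y x := by
  have h : (HU.hopf K).mul = (HU.hopf K).mul.flip :=
    LinearMap.ext_on_range (top_le_iff.1 (span_single K _)) fun v =>
      LinearMap.ext_on_range (top_le_iff.1 (span_single K _)) fun w => by
        rw [LinearMap.flip_apply, HU.mul_single, HU.mul_single, HU.shuffle_comm]
  exact DFunLike.congr_fun (DFunLike.congr_fun h x) y

/-- Appending a last letter. -/
def HU.snoc (a : ℕ+) : HU K →ₗ[K] HU K := Finsupp.lmapDomain K K fun w => w ++ [a]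

theorem HU.snoc_single (a : ℕ+) (w : List ℕ+) :
    HU.snoc K a (Finsupp.single w 1) = Finsupp.single (w ++ [a]) 1 :=
  Finsupp.mapDomain_single

theorem HU.snoc_apply_nil (a : ℕ+) (x : HU K) : HU.snoc K a x [] = 0 := by
  refine Finsupp.mapDomain_of_notMem_range _ _ ?_
  rintro ⟨w, hw⟩
  simp at hw

/-- The first letter of `w ++ [b]` is that of `w`, unless `w` is empty; the second summand accounts
for this exception. -/
theorem HU.removeHead_snoc (a b : ℕ+) (x : HU K) : HU.removeHead K a (HU.snoc K b x) =
    HU.snoc K b (HU.removeHead K a x) + (PForest.ind K a b * x []) • Finsupp.single [] 1 := by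
  classical
  have hs : ∀ (c : ℕ+) (w : List ℕ+), HU.removeHead K a (Finsupp.single (c :: w) 1) =
      if a = c then Finsupp.single w 1 else 0 := fun c w => by
    rw [HU.single_cons, HU.removeHead_cons]
  induction x using Finsupp.induction_linear with
  | zero => simp
  | add x y hx hy =>
    simp only [map_add, hx, hy, Finsupp.add_apply, mul_add, add_smul]
    abel
  | single w r =>
    have h : Finsupp.single w r = r • (Finsupp.single w 1 : HU K) := by simp
    rw [h, map_smul, map_smul, map_smul, map_smul, HU.snoc_single, Finsupp.smul_apply,
      smul_eq_mul, mul_left_comm, mul_smul, ← smul_add]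
    congr 1
    cases w with
    | nil => simp [hs, HU.removeHead_nil, PForest.ind_def]
    | cons c w =>
      rw [List.cons_append, hs, hs]
      split_ifs <;> simp [HU.snoc_single]

theorem piWord_nil : piWord K .nil = Finsupp.single [] 1 := by
  simp [piWord, linExt]

theorem piWord_cons (a : ℕ+) (c f : PForest ℕ+) : piWord K (.cons a c f) =
    (HU.hopf K).mul (HU.snoc K a (piWord K c)) (piWord K f) := by
  simp only [piWord, linExt, list_sum_flatMap]
  rw [map_list_sum (HU.snoc K a), List.map_map, map_list_sum₂]
  simp only [Function.comp_apply, HU.snoc_single, HU.mul_single, HU.shuffle]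

theorem piWord_append (u v : PForest ℕ+) : piWord K (u.append v) =
    (HU.hopf K).mul (piWord K u) (piWord K v) := by
  induction u with
  | nil => rw [piWord_nil, HU.nil_mul]; rfl
  | cons a c f _ ih =>
    rw [PForest.append, piWord_cons, piWord_cons, ih, (HU.isBialgebra K).mul_assoc]

/-- The sum of `π(v)` over the contractions of a forest, graded by the length of the path that is
left out of `v`. -/
def contractSum (u : PForest Unit) : ℕ →₀ HU K :=
  ((u.contract).map fun p => Finsupp.single p.1 (piWord K p.2)).sum

theorem contractSum_zero (u : PForest Unit) : contractSum K u 0 = piClass K u := by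
  rw [contractSum, piClass, PForest.labelled, List.map_map]
  generalize u.contract = l
  induction l with
  | nil => rfl
  | cons p l ih =>
    rw [List.map_cons, List.sum_cons, Finsupp.add_apply, ih, List.filter_cons]
    by_cases h : p.1 = 0
    · simp [h]
    · simp [h]

/-- The path at the root of a tree becomes the last letter. -/
def closePath : (ℕ →₀ HU K) →ₗ[K] HU K := Finsupp.lsum K fun n => HU.snoc K n.succPNat

theorem closePath_single (n : ℕ) (x : HU K) :
    closePath K (Finsupp.single n x) = HU.snoc K n.succPNat x := by
  simp [closePath]

theorem closePath_apply_nil (X : ℕ →₀ HU K) : closePath K X [] = 0 := by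
  induction X using Finsupp.induction_linear with
  | zero => simp
  | add x y hx hy => rw [map_add, Finsupp.add_apply, hx, hy, add_zero]
  | single n x => rw [closePath_single, HU.snoc_apply_nil]

/-- The extra term comes from the empty word in the component of index n: a left-out path of n
vertices with nothing else above the root. Closing it gives the one-letter word n + 1. -/
theorem removeHead_closePath (n : ℕ) (X : ℕ →₀ HU K) :
    HU.removeHead K n.succPNat (closePath K X) =
      closePath K (Finsupp.mapRange.linearMap (HU.removeHead K n.succPNat) X) +
        X n [] • Finsupp.single [] 1 := by
  induction X using Finsupp.induction_linear with
  | zero => simp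
  | add x y hx hy =>
    simp only [map_add, hx, hy, Finsupp.add_apply, add_smul]
    abel
  | single m x =>
    classical
    rw [closePath_single, HU.removeHead_snoc, Finsupp.mapRange.linearMap_apply,
      Finsupp.mapRange_single, closePath_single, PForest.ind_def, Finsupp.single_apply]
    simp only [Nat.succPNat_inj, eq_comm (a := n)]
    split_ifs <;> simp

/-- The rule by which the contractions of a forest arise from those of the branches of its first
tree and those of the other trees. -/
def contractCons : (ℕ →₀ HU K) →ₗ[K] (ℕ →₀ HU K) →ₗ[K] (ℕ →₀ HU K) :=
  -- The path through the first root either ends there and becomes a letter, in which case a path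
  -- may still be left out of the other trees. Or it stays open with one more vertex, which requires
  -- that none is left out of the others, hence `Y 0`.
  LinearMap.mk₂ K (fun X Y => Finsupp.mapRange.linearMap ((HU.hopf K).mul (closePath K X)) Y +
      Finsupp.mapRange.linearMap ((HU.hopf K).mul.flip (Y 0)) (Finsupp.lmapDomain _ K Nat.succ X))
    (fun X X' Y => Finsupp.ext fun k => by simp [Finsupp.mapDomain_add]; abel)
    (fun r X Y => Finsupp.ext fun k => by simp)
    (fun X Y Y' => Finsupp.ext fun k => by simp; abel)
    (fun r X Y => Finsupp.ext fun k => by simp)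

theorem contractCons_apply (X Y : ℕ →₀ HU K) : contractCons K X Y =
    Finsupp.mapRange.linearMap ((HU.hopf K).mul (closePath K X)) Y +
      Finsupp.mapRange.linearMap ((HU.hopf K).mul.flip (Y 0)) (Finsupp.lmapDomain _ K Nat.succ X) :=
  rfl

theorem contractCons_apply_zero (X Y : ℕ →₀ HU K) :
    contractCons K X Y 0 = (HU.hopf K).mul (closePath K X) (Y 0) := by
  simp [contractCons_apply, Finsupp.mapDomain_of_notMem_range]

theorem contractCons_apply_succ (X Y : ℕ →₀ HU K) (k : ℕ) : contractCons K X Y (k + 1) =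
    (HU.hopf K).mul (closePath K X) (Y (k + 1)) + (HU.hopf K).mul (X k) (Y 0) := by
  have := Finsupp.mapDomain_apply Nat.succ_injective X k
  simp [contractCons_apply, this]

theorem contractSum_nil : contractSum K .nil = Finsupp.single 0 (Finsupp.single [] 1) := by
  simp [contractSum, PForest.contract, piWord_nil]

theorem contractSum_cons (a : Unit) (c f : PForest Unit) : contractSum K (.cons a c f) =
    contractCons K (contractSum K c) (contractSum K f) := by
  have h : ∀ p q : ℕ × PForest ℕ+, contractCons K (Finsupp.single p.1 (piWord K p.2))
      (Finsupp.single q.1 (piWord K q.2)) =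
      Finsupp.single q.1 (piWord K (.cons p.1.succPNat p.2 q.2)) +
        if q.1 = 0 then Finsupp.single (p.1 + 1) (piWord K (p.2.append q.2)) else 0 := by
    intro p q
    rw [contractCons_apply, closePath_single, piWord_cons, piWord_append]
    simp only [Finsupp.mapRange.linearMap_apply, Finsupp.mapRange_single,
      Finsupp.lmapDomain_apply, Finsupp.mapDomain_single, LinearMap.flip_apply]
    split_ifs with h
    · simp [h]
    · simp [Finsupp.single_eq_of_ne' h]
  rw [contractSum, contractSum, contractSum, map_list_sum₂]
  simp only [PForest.contract, list_sum_flatMap, List.map_cons, List.sum_cons, h]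
  congr! 7
  split_ifs <;> simp

/-- The open path lies in at most one tree and the shuffle product is commutative, so the rule
treats neighbouring trees symmetrically. -/
theorem contractSum_congr {u v : PForest Unit} (h : u.Equiv v) :
    contractSum K u = contractSum K v := by
  induction h with
  | nil => rfl
  | cons a _ _ h₁ h₂ => rw [contractSum_cons, contractSum_cons, h₁, h₂]
  | swap a b c d f =>
    have hassoc := (HU.isBialgebra K).mul_assoc
    have hleft : ∀ x y z, (HU.hopf K).mul x ((HU.hopf K).mul y z) =
        (HU.hopf K).mul y ((HU.hopf K).mul x z) := fun x y z => by
      rw [← hassoc, HU.mul_comm K x, hassoc]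
    rw [contractSum_cons, contractSum_cons, contractSum_cons, contractSum_cons]
    ext1 k
    cases k with
    | zero => simp only [contractCons_apply_zero]; exact hleft _ _ _
    | succ k =>
      simp only [contractCons_apply_zero, contractCons_apply_succ, map_add]
      rw [hleft, hleft (contractSum K c k), hleft (closePath K (contractSum K c)) (contractSum K d k)]
      abel
  | trans _ _ h₁ h₂ => rw [h₁, h₂]

/-- The empty word occurs only if the left-out path exhausts the forest, which is then a ladder. -/
theorem contractSum_apply_nil (k : ℕ) (u : PForest Unit) :
    contractSum K u k [] = PForest.ind K u (PForest.ladder k) := by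
  induction u generalizing k with
  | nil =>
    rw [contractSum_nil]
    cases k with
    | zero => simp [PForest.ladder]
    | succ k => simp [PForest.ladder]
  | cons a c f hc hf =>
    rw [contractSum_cons]
    cases k with
    | zero =>
      rw [contractCons_apply_zero, HU.mul_apply_nil, closePath_apply_nil, zero_mul, PForest.ladder,
        PForest.ind_cons_nil]
    | succ k =>
      rw [contractCons_apply_succ, Finsupp.add_apply, HU.mul_apply_nil, HU.mul_apply_nil,
        closePath_apply_nil, zero_mul, zero_add, hc, hf, PForest.ladder, PForest.ladder, PForest.ind_cons, PForest.ind_self, one_mul]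

/-- The sum of the values of a function at the forests that remain if `f` is pruned. -/
def pruneSum {M : Type*} [AddCommMonoid M] [Module K M] (f : PForest Unit) (φ : PForest Unit → M)
    (u : PForest Unit) : M :=
  ((u.cuts).map fun p => PForest.ind K p.1 f • φ p.2).sum

theorem map_pruneSum {M N : Type*} [AddCommMonoid M] [Module K M] [AddCommMonoid N] [Module K N]
    (L : M →ₗ[K] N) (f : PForest Unit) (φ : PForest Unit → M) (u : PForest Unit) :
    L (pruneSum K f φ u) = pruneSum K f (fun v => L (φ v)) u := by
  rw [pruneSum, map_list_sum, List.map_map]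
  simp [pruneSum, Function.comp_def]

theorem pruneSum_nil {M : Type*} [AddCommMonoid M] [Module K M] (φ : PForest Unit → M)
    (u : PForest Unit) : pruneSum K .nil φ u = φ u := by
  induction u generalizing φ with
  | nil => simp [pruneSum, PForest.cuts]
  | cons a c f hc hf =>
    have h : ∀ x y : PForest Unit, PForest.ind K (x.append y) .nil =
        PForest.ind K x .nil * PForest.ind K y .nil := by
      intro x y
      cases x <;> simp [PForest.append]
    simp only [pruneSum, PForest.cuts, list_sum_flatMap, List.map_cons, List.sum_cons,
      PForest.ind_cons_nil, zero_smul, zero_add, List.map_map, Function.comp_def, h, mul_smul]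
    rw [list_sum_comm]
    have h1 := hc fun x => pruneSum K .nil (fun y => φ (.cons a x y)) f
    rw [hf] at h1
    rw [← h1]
    simp [pruneSum, List.smul_sum, List.map_map, Function.comp_def]

/-- A ladder is a single tree: it is pruned either as the whole first tree, or from its branches, or
from the other trees. This is a Leibniz rule with an additional term, of the same shape as
`removeHead_contractCons`. -/
theorem pruneSum_ladder_cons {M : Type*} [AddCommMonoid M] [Module K M] (n : ℕ)
    (φ : PForest Unit → M) (a : Unit) (c f : PForest Unit) :
    pruneSum K (PForest.ladder (n + 1)) φ (.cons a c f) =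
      PForest.ind K c (PForest.ladder n) • φ f +
        (pruneSum K (PForest.ladder (n + 1)) (fun x => φ (.cons a x f)) c +
          pruneSum K (PForest.ladder (n + 1)) (fun y => φ (.cons a c y)) f) := by
  have h : ∀ x y : PForest Unit, PForest.ind K (x.append y) (PForest.ladder (n + 1)) =
      PForest.ind K x (PForest.ladder (n + 1)) * PForest.ind K y .nil +
        PForest.ind K x .nil * PForest.ind K y (PForest.ladder (n + 1)) := by
    intro x y
    cases x with
    | nil => simp [PForest.append, PForest.ladder]
    | cons b d x =>
      have h1 : PForest.ind K (x.append y) .nil =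
          PForest.ind K x .nil * PForest.ind K y .nil := by
        cases x <;> simp [PForest.append]
      simp [PForest.append, PForest.ladder, PForest.ind_cons, h1, mul_assoc]
  -- The trivial pruning of the untouched part is inserted, so that all terms become sums over pairs
  -- of cuts of `c` and `f`.
  have e1 : pruneSum K (PForest.ladder (n + 1)) (fun x => φ (.cons a x f)) c =
      pruneSum K (PForest.ladder (n + 1)) (fun x => pruneSum K .nil (fun y => φ (.cons a x y)) f) c := by
    simp only [pruneSum_nil]
  have e2 : pruneSum K (PForest.ladder (n + 1)) (fun y => φ (.cons a c y)) f =
      pruneSum K .nil (fun x => pruneSum K (PForest.ladder (n + 1)) (fun y => φ (.cons a x y)) f) c := by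
    simp only [pruneSum_nil]
  rw [e1, e2, ← pruneSum_nil K φ f]
  simp only [pruneSum, PForest.cuts, list_sum_flatMap, List.map_cons, List.sum_cons,
    List.map_map, Function.comp_def, h, add_smul, List.sum_map_add, List.smul_sum, mul_smul]
  congr 1
  · simp [PForest.ladder, PForest.ind_cons, mul_smul]
  · congr 1 <;> exact list_sum_comm _ _ _

/-- Removal of the first letter is a derivation of the shuffle product; the additional term comes
from closing a path with nothing else above the root. -/
theorem removeHead_contractCons (n : ℕ) (X Y : ℕ →₀ HU K) :
    Finsupp.mapRange.linearMap (HU.removeHead K n.succPNat) (contractCons K X Y) =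
      X n [] • Y +
      (contractCons K (Finsupp.mapRange.linearMap (HU.removeHead K n.succPNat) X) Y +
        contractCons K X (Finsupp.mapRange.linearMap (HU.removeHead K n.succPNat) Y)) := by
  ext1 k
  cases k with
  | zero =>
    simp only [Finsupp.mapRange.linearMap_apply, Finsupp.mapRange_apply, Finsupp.add_apply,
      contractCons_apply_zero, HU.removeHead_mul, removeHead_closePath, map_add, map_smul,
      LinearMap.add_apply, LinearMap.smul_apply, HU.nil_mul, Finsupp.smul_apply]
    abel
  | succ k =>
    simp only [Finsupp.mapRange.linearMap_apply, Finsupp.mapRange_apply, Finsupp.add_apply,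
      contractCons_apply_succ, HU.removeHead_mul, removeHead_closePath, map_add, map_smul,
      LinearMap.add_apply, LinearMap.smul_apply, HU.nil_mul, Finsupp.smul_apply]
    abel

/-- Both sides obey the same recursion in the first tree. The open path is carried along because the
statement for `piClass` alone is not inductive: the branches of a root enter through all lengths of
the path left out. -/
theorem removeHead_contractSum (n : ℕ) (u : PForest Unit) :
    Finsupp.mapRange.linearMap (HU.removeHead K n.succPNat) (contractSum K u) =
      pruneSum K (PForest.ladder (n + 1)) (contractSum K) u := by
  induction u with
  | nil =>
    simp [contractSum_nil, HU.removeHead_nil, pruneSum, PForest.cuts, PForest.ladder]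
  | cons a c f hc hf =>
    rw [pruneSum_ladder_cons, contractSum_cons, removeHead_contractCons, contractSum_apply_nil, hc,
      hf, map_pruneSum K (contractCons K _), ← LinearMap.flip_apply (contractCons K),
      map_pruneSum K ((contractCons K).flip _)]
    simp only [contractSum_cons, LinearMap.flip_apply]

theorem removeHead_piClass (a : ℕ+) (u : PForest Unit) :
    HU.removeHead K a (piClass K u) = pruneSum K (PForest.ladder a) (piClass K) u := by
  have h := DFunLike.congr_fun (removeHead_contractSum K a.natPred u) 0
  rw [PNat.succPNat_natPred, PNat.natPred_add_one, Finsupp.mapRange.linearMap_apply,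
    Finsupp.mapRange_apply, contractSum_zero, ← Finsupp.lapply_apply (R := K),
    map_pruneSum K (Finsupp.lapply 0)] at h
  simpa only [Finsupp.lapply_apply, contractSum_zero] using h

theorem piClass_apply_nil (u : PForest Unit) : piClass K u [] = PForest.ind K u .nil := by
  rw [← contractSum_zero, contractSum_apply_nil, PForest.ladder]

theorem piClass_congr {u v : PForest Unit} (h : u.Equiv v) : piClass K u = piClass K v := by
  rw [← contractSum_zero, ← contractSum_zero, contractSum_congr K h]

end contract

/-! ### The maps of the first square -/

section square

variable (K : Type*) [Field K]

/-- Left multiplication by a tree B⁺(f) is the transpose of pruning `f`, by the duality with the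
coproduct of planar forests. -/
theorem HP.single_mul_apply (f u : PForest Unit) (t : HP K) :
    (HP.hopf K).mul (Finsupp.single ⟨f⟩ 1) t ⟨u⟩ = pruneSum K f (fun v => t ⟨v⟩) u := by
  rw [← pairFPBilin_single, (HF.isDual K).mul_right, HF.comul_single,
    ← LinearMap.flip_apply (tpair _ _), map_list_sum, List.map_map, pruneSum]
  refine congrArg List.sum (List.map_congr_left fun p _ => ?_)
  simp only [Function.comp_apply, LinearMap.flip_apply, tpair_tmul, pairFPBilin_single, HP.single_apply, smul_eq_mul]
  rw [PForest.ind_comm]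

/-- Induct on the word: removing its first letter prunes a ladder from `u`, and multiplying by the
image of the corresponding generator does the same on the other side. -/
theorem piClass_apply (u : PForest Unit) (w : List ℕ+) :
    piClass K u w = ULU.toTree K (ULU.word K w) ⟨u⟩ := by
  induction w generalizing u with
  | nil =>
    rw [piClass_apply_nil, PForest.ind_comm, ← HP.single_apply, ← ULU.toTree_one]
    rfl
  | cons a w ih =>
    rw [ULU.word_cons, ULU.toTree_mul, ULU.toTree_e, HP.single_mul_apply, ← HU.removeHead_apply,
      removeHead_piClass, ← Finsupp.lapply_apply (R := K), map_pruneSum K (Finsupp.lapply w)]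
    simp only [Finsupp.lapply_apply, ih]

/-- The sum of `π(v)` over all contractions `v` of a planar forest, extended linearly. -/
def HF.toHU : HF K →ₗ[K] HU K := Finsupp.linearCombination K (piClass K)

theorem HF.toHU_single (u : PForest Unit) : HF.toHU K (Finsupp.single u 1) = piClass K u := by
  simp [HF.toHU]

theorem pairULBilin_toHU (y : ULU K) (x : HF K) :
    pairULBilin K y (HF.toHU K x) = pairFPBilin K x (ULU.toTree K y) := by
  have h : (pairULBilin K).compl₂ (HF.toHU K) = (pairFPBilin K).flip ∘ₗ ULU.toTree K :=
    LinearMap.ext_on_range (top_le_iff.1 (ULU.span_word K)) fun I =>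
      LinearMap.ext_on_range (top_le_iff.1 (span_single K _)) fun u => by
        rw [LinearMap.compl₂_apply, LinearMap.comp_apply, LinearMap.flip_apply, HF.toHU_single,
          pairULBilin_word, pairFPBilin_single, piClass_apply]
  exact DFunLike.congr_fun (DFunLike.congr_fun h y) x

/-- No coproduct is computed: the map is the transpose of a homomorphism out of the enveloping
algebra. -/
theorem HF.isHom_toHU : (HF.hopf K).IsHom (HU.hopf K) (HF.toHU K) :=
  (ULU.isHom_toTree K).transpose (ULU.isDual K) (HF.isDual K).flip (separates_pairUL K)
    fun y x => (pairULBilin_toHU K y x).symm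

/-- The sum of `π(v)` over all contractions `v` of a non-planar forest, extended linearly. -/
def HCK.toHU : HCK K →ₗ[K] HU K := Finsupp.linearCombination K fun u => piClass K u.rep

theorem HCK.toHU_single (u : PForest Unit) :
    HCK.toHU K (Finsupp.single (RForest.mk u) 1) = piClass K u := by
  rw [HCK.toHU, Finsupp.linearCombination_single, one_smul, piClass_congr K (RForest.rep_mk u)]

theorem HCK.toHU_comp_forget : HCK.toHU K ∘ₗ HCK.forget K = HF.toHU K :=
  LinearMap.ext_on_range (top_le_iff.1 (span_single K _)) fun u => by
    rw [LinearMap.comp_apply, HCK.forget_single, HCK.toHU_single, HF.toHU_single]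

theorem HCK.isHom_toHU : (HCK.hopf K).IsHom (HU.hopf K) (HCK.toHU K) :=
  .of_comp_surjective (HCK.toHU_comp_forget K ▸ HF.isHom_toHU K) (HCK.isHom_forget K)
    (HCK.forget_surjective K)

/-- The map with `e_λ ↦ ∏ l_{λ_i}`. -/
def SYM.toHCK : SYM K →ₗ[K] HCK K :=
  (Finsupp.linearCombination K fun l : Multiset ℕ+ =>
    Finsupp.single (RForest.mk (PForest.ladders l.toList)) 1) ∘ₗ (SYM.eEquiv K).symm.toLinearMap

theorem SYM.toHCK_eProd (I : List ℕ+) :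
    SYM.toHCK K (SYM.eProd K I) = Finsupp.single (RForest.mk (PForest.ladders I)) 1 := by
  rw [SYM.toHCK, LinearMap.comp_apply, LinearEquiv.coe_coe, SYM.eEquiv_symm_eProd,
    Finsupp.linearCombination_single, one_smul]
  congr 1
  exact RForest.mk_eq_iff.2 (.ladders (Multiset.coe_eq_coe.1 (Multiset.coe_toList _)))

theorem SYM.toHCK_comp_ofNSYM :
    SYM.toHCK K ∘ₗ (SYM.ofNSYM K).toLinearMap = HCK.forget K ∘ₗ NSYM.toForest K :=
  LinearMap.ext_on_range (top_le_iff.1 (span_freeWord K)) fun I => by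
    rw [LinearMap.comp_apply, LinearMap.comp_apply, AlgHom.toLinearMap_apply, SYM.ofNSYM_freeWord,
      SYM.toHCK_eProd, NSYM.toForest_freeWord, HCK.forget_single]

/-- Forgetting the planar structure of the ladder forests factors through the surjection from NSYM
to SYM, and the factor inherits the homomorphism property. -/
theorem SYM.isHom_toHCK : (SYM.hopf K).IsHom (HCK.hopf K) (SYM.toHCK K) :=
  .of_comp_surjective
    (SYM.toHCK_comp_ofNSYM K ▸ (HCK.isHom_forget K).comp (NSYM.isHom_toForest K))
    (SYM.isHom_ofNSYM K) (SYM.ofNSYM_surjective K)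

theorem SYM.eProd_singleton (n : ℕ+) : SYM.eProd K ([n] : List ℕ+) = SYM.e K n := by
  simp [SYM.eProd]

theorem SYM.toHCK_e (n : ℕ+) :
    SYM.toHCK K (SYM.e K n) = Finsupp.single (RForest.mk (PForest.ladder n)) 1 := by
  rw [← SYM.eProd_singleton, SYM.toHCK_eProd, PForest.ladders, PForest.ladders, PForest.append_nil]

theorem SYM.pair_ofNSYM (x : NSYM K) (f : SYM K) :
    SYM.pair K (SYM.ofNSYM K x) f = pairNQBilin K x (SYM.incl K f) := by
  have h : SYM.pair K ∘ₗ (SYM.ofNSYM K).toLinearMap = (pairNQBilin K).compl₂ (SYM.incl K) :=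
    LinearMap.ext_on_range (top_le_iff.1 (span_freeWord K)) fun I => by
      ext1 f
      rw [LinearMap.comp_apply, LinearMap.compl₂_apply, AlgHom.toLinearMap_apply,
        SYM.ofNSYM_freeWord, SYM.pair_eProd, pairNQBilin_freeWord, SYM.coeffs_coe, SYM.coe_incl]
  exact DFunLike.congr_fun (DFunLike.congr_fun h x) f

/-- Lift `f` to NSYM and move across the other three dualities, using that the second square
commutes. -/
theorem pairULBilin_toHCK (y : ULU K) (f : SYM K) :
    pairULBilin K y (HCK.toHU K (SYM.toHCK K f)) = SYM.pair K f (ULU.toSYM K y) := by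
  obtain ⟨x, rfl⟩ := SYM.ofNSYM_surjective K f
  have h1 := DFunLike.congr_fun (SYM.toHCK_comp_ofNSYM K) x
  have h2 := DFunLike.congr_fun (HCK.toHU_comp_forget K) (NSYM.toForest K x)
  simp only [LinearMap.comp_apply, AlgHom.toLinearMap_apply] at h1 h2
  rw [h1, h2, pairULBilin_toHU, pairFPBilin_toForest, HP.toQSYM_toTree, SYM.pair_ofNSYM]

end square

end

/-! ### The two squares, their duality and the factorization -/

theorem proposition4 (K : Type*) [Field K] [CharZero K] :
    -- the objects are Hopf algebras
    ((NSYM.hopf K).IsHopfAlgebra ∧ (HF.hopf K).IsHopfAlgebra ∧ (SYM.hopf K).IsHopfAlgebra ∧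
      (HU.hopf K).IsHopfAlgebra ∧ (ULU.hopf K).IsHopfAlgebra ∧ (HP.hopf K).IsHopfAlgebra ∧
      (QSYM.hopf K).IsHopfAlgebra ∧ (HCK.hopf K).IsHopfAlgebra) ∧
    ∃ (β₁ : NSYM K →ₗ[K] HF K) (β₂ : HF K →ₗ[K] HU K)
      (β₃ : NSYM K →ₗ[K] SYM K) (β₄ : SYM K →ₗ[K] HU K)
      (γ₁ : HP K →ₗ[K] QSYM K) (γ₂ : ULU K →ₗ[K] HP K)
      (γ₃ : SYM K →ₗ[K] QSYM K) (γ₄ : ULU K →ₗ[K] SYM K)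
      (α₂ : HF K →ₗ[K] HCK K) (α₄ : SYM K →ₗ[K] HCK K) (ρ : HCK K →ₗ[K] HU K)
      (B : SYM K →ₗ[K] SYM K →ₗ[K] K),
      -- the maps of the first square: Hopf algebra homomorphisms, values, commutativity
      ((NSYM.hopf K).IsHom (HF.hopf K) β₁ ∧ (HF.hopf K).IsHom (HU.hopf K) β₂ ∧
        (NSYM.hopf K).IsHom (SYM.hopf K) β₃ ∧ (SYM.hopf K).IsHom (HU.hopf K) β₄) ∧
      ((∀ n : ℕ+, β₁ (FreeAlgebra.ι K n) = Finsupp.single (PForest.ladder n) 1) ∧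
        (∀ u : PForest Unit, β₂ (Finsupp.single u 1) = piClass K u) ∧
        (∀ n : ℕ+, β₃ (FreeAlgebra.ι K n) = SYM.e K n) ∧
        (∀ n : ℕ+, β₄ (SYM.e K n) = piClass K (PForest.ladder n))) ∧
      β₂ ∘ₗ β₁ = β₄ ∘ₗ β₃ ∧
      -- the maps of the second square: Hopf algebra homomorphisms, values, commutativity
      ((HP.hopf K).IsHom (QSYM.hopf K) γ₁ ∧ (ULU.hopf K).IsHom (HP.hopf K) γ₂ ∧
        (SYM.hopf K).IsHom (QSYM.hopf K) γ₃ ∧ (ULU.hopf K).IsHom (SYM.hopf K) γ₄) ∧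
      ((∀ I : List ℕ+, γ₁ (Finsupp.single ⟨PForest.ladders I⟩ 1) = QSYM.M K I) ∧
        (∀ t : PTree, (∀ I : List ℕ+, t ≠ ⟨PForest.ladders I⟩) →
          γ₁ (Finsupp.single t 1) = 0) ∧
        (∀ n : ℕ+, γ₂ (ULU.e K n) = Finsupp.single ⟨PForest.ladder n⟩ 1) ∧
        (∀ f : SYM K, (γ₃ f : MvPowerSeries ℕ K) = f) ∧
        (∀ n : ℕ+, γ₄ (ULU.e K n) = SYM.m K {n})) ∧
      γ₁ ∘ₗ γ₂ = γ₃ ∘ₗ γ₄ ∧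
      -- the second square is dual to the first one
      (∀ l μ : Multiset ℕ+,
        B (l.map (SYM.e K)).prod (SYM.m K μ) = Finsupp.single l (1 : K) μ) ∧
      (∀ x t, pairFP K (β₁ x) t = pairNQ K x (γ₁ t)) ∧
      (∀ x y, pairUL K (β₂ x) y = pairFP K x (γ₂ y)) ∧
      (∀ x f, B (β₃ x) f = pairNQ K x (γ₃ f)) ∧
      (∀ f y, pairUL K (β₄ f) y = B f (γ₄ y)) ∧
      -- the first square factors through the one for the Connes-Kreimer Hopf algebra
      ((HF.hopf K).IsHom (HCK.hopf K) α₂ ∧ (SYM.hopf K).IsHom (HCK.hopf K) α₄ ∧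
        (HCK.hopf K).IsHom (HU.hopf K) ρ) ∧
      ((∀ u : PForest Unit, α₂ (Finsupp.single u 1) = Finsupp.single (RForest.mk u) 1) ∧
        (∀ n : ℕ+, α₄ (SYM.e K n) = Finsupp.single (RForest.mk (PForest.ladder n)) 1) ∧
        (∀ u : PForest Unit, ρ (Finsupp.single (RForest.mk u) 1) = piClass K u)) ∧
      α₂ ∘ₗ β₁ = α₄ ∘ₗ β₃ ∧ β₂ = ρ ∘ₗ α₂ ∧ β₄ = ρ ∘ₗ α₄ := by
  refine ⟨⟨NSYM.isHopfAlgebra K, HF.isHopfAlgebra K, SYM.isHopfAlgebra K, HU.isHopfAlgebra K,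
    ULU.isHopfAlgebra K, HP.isHopfAlgebra K, QSYM.isHopfAlgebra K, HCK.isHopfAlgebra K⟩,
    NSYM.toForest K, HF.toHU K, (SYM.ofNSYM K).toLinearMap, HCK.toHU K ∘ₗ SYM.toHCK K,
    HP.toQSYM K, ULU.toTree K, SYM.incl K, (ULU.toSYM K).toLinearMap,
    HCK.forget K, SYM.toHCK K, HCK.toHU K, SYM.pair K,
    ⟨NSYM.isHom_toForest K, HF.isHom_toHU K, SYM.isHom_ofNSYM K,
      (HCK.isHom_toHU K).comp (SYM.isHom_toHCK K)⟩,
    ⟨NSYM.toForest_ι K, HF.toHU_single K, fun n => FreeAlgebra.lift_ι_apply _ _, fun n => ?_⟩, ?_,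
    ⟨HP.isHom_toQSYM K, ULU.isHom_toTree K, SYM.isHom_incl K, ULU.isHom_toSYM K⟩,
    ⟨HP.toQSYM_ladders K, HP.toQSYM_of_ne K, ULU.toTree_e K, SYM.coe_incl K, ULU.toSYM_e K⟩,
    LinearMap.ext (HP.toQSYM_toTree K), fun l μ => ?_, pairFPBilin_toForest K,
    fun x y => pairULBilin_toHU K y x, SYM.pair_ofNSYM K, fun f y => pairULBilin_toHCK K y f,
    ⟨HCK.isHom_forget K, SYM.isHom_toHCK K, HCK.isHom_toHU K⟩,
    ⟨HCK.forget_single K, SYM.toHCK_e K, HCK.toHU_single K⟩,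
    (SYM.toHCK_comp_ofNSYM K).symm, (HCK.toHU_comp_forget K).symm, rfl⟩
  · rw [LinearMap.comp_apply, SYM.toHCK_e, HCK.toHU_single]
  · rw [LinearMap.comp_assoc, SYM.toHCK_comp_ofNSYM, ← LinearMap.comp_assoc, HCK.toHU_comp_forget]
  · refine (SYM.pair_eProd K l _).trans ?_
    rw [SYM.coeffs_m]
    classical
    simp only [Finsupp.single_apply, eq_comm]
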